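/- **Setting.** Let $\Lambda$ be a countable group (product $(i,j)\mapsto ij$, unit $0$) and $h:\Lambda\to\mathbb Z$ a height function, i.e. $h(ij)=h(i)+h(j)$. Let $\sigma\ge2$, $m\ge1$, let $A_{s,k}$ $(1\le s\le\sigma,\ 1\le k\le m)$ be finite subsets of $\{i\in\Lambda:h(i)=1\}$, and let $\Delta_k:=\bigcup_{s=1}^{\sigma}A_{s,k}$; $A_{s,0}:=\Delta_0:=\emptyset$. (In applications to a monotone cellular automaton with local maps $\varphi_1,\dots,\varphi_m$, each $A_{s,k}$ is a minimal one-set of $\varphi_k$.) **Contours.** A *Toom graph* is a finite directed graph with vertex set $V=V_\circ\cup V_*\cup V_1\cup\dots\cup V_\sigma$ (sources, sinks, internal vertices of charge $s$) and edge sets $\vec E_1,\dots,\vec E_\sigma\subset V\times V$ (edges of charge $s$) such that: a source has no incoming edges, a sink has no outgoing edges; a source that is not a sink has exactly one outgoing edge of each charge; a sink that is not a source has exactly one incoming edge of each charge; a vertex that is both is isolated; a vertex of $V_s$ has exactly one incoming and one outgoing edge of charge $s$ and no edges of other charges. A *decorated Toom contour rooted at $0$* is $D=(v_\circ,V,\vec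 E,\psi,\kappa)$ consisting of a connected Toom graph, a root $v_\circ\in V_\circ$, a map $\psi:V\to\Lambda$ with $\psi(v_\circ)=0$ such that $\psi(v)\ne\psi(w)$ whenever $v\neq w$ and either $v\in V_*$ or $v,w\in V_s\cup\{v_\circ\}$ for some $s$, and a function $\kappa:\psi(V)\to\{0,\dots,m\}$ such that $\kappa=0$ on $\psi(V_*)$, $j\in A_{s,\kappa(i)}$ for $(i,ij)\in\psi(\vec E^\bullet_s)$, and $j\in\Delta_{\kappa(i)}$ for $(i,ij)\in\psi(\vec E^\circ_s)$, where $\vec E_s^\bullet$ and $\vec E_s^\circ$ are the edges of charge $s$ whose starting vertex lies in $V_s\cup\{v_\circ\}$ and in $V_\circ\setminus\{v_\circ\}$, respectively. $\mathcal D_0$ is the set of these up to isomorphism (relabelling of $V$). Put $n_*(D)=|V_*|$, $n_\diamond(D)=|\psi(V)\setminus\psi(V_*)|$, and $n_\star(D)=|\vec E_s^\star|$ for $\star\in\{\circ,\bullet\}$, which does not depend on $s$. **Incomplete contours.** An *incomplete Toom graph* is a connected graph of the above kind with $V=\{0,\dots,N\}$ and root $0\in V_\circ$, where the degree conditions are relaxed: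 sources have no incoming and at most one outgoing edge of each charge, sinks no outgoing and at most one incoming edge of each charge, vertices of $V_s$ at most one incoming and one outgoing edge of charge $s$ and no others; and which, unless it is the trivial Toom graph (one isolated vertex), satisfies: each vertex of $(V_\sigma\cup V_\circ)\setminus\{0\}$ has an outgoing edge of charge $\sigma$, for $s<\sigma$ each vertex of $V_s$ has an incoming edge of charge $s$, and each sink has an incoming edge of some charge $s<\sigma$. Incomplete decorated contours rooted at $0$ are defined from these as above, with the same conditions on $\psi$ and $\kappa$. A *loose end* is a pair $(v,s)$ such that either $s<\sigma$, $v\in V_\circ\cup V_s$ and $v$ has no outgoing edge of charge $s$, or $s=\sigma$, $v\in V_*\cup V_\sigma$ and $v$ has no incoming edge of charge $\sigma$ (the trivial Toom graph has no loose ends by convention). The *most urgent* one has the smallest $s$ and, for this $s$, the smallest $v$. The *natural order* on the vertices of a contour is obtained by starting with the root and successively adding, at the most urgent loose end, the missing edge of the contour, numbering new vertices in the order of their appearance. Let $\tau'(v)=s$ for $v\in V_s$, $\tau'(v)=\circ$ for $v\in V_\circ\setminus\{v_\circ\}$, and $\tau'(v_\circ)=1$; for $i\in\psi(V)\setminus\psi(V_*)$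 let $\tau(i)=\tau'(v)$ for the first $v$ in the natural order with $\psi(v)=i$. **Theorem.** Let $\hat p,p_\circ\in[0,1]$; let $\mathbf a^\bullet_{s,k}$ and $\mathbf a^\circ_{s,k}$ be subprobability laws on $A_{s,k}$ and $\Delta_k$ (extended by $0$ to $\Lambda$); let $\hat{\mathbf r}_t$ $(t\in\{\circ,1,\dots,\sigma\})$ be probability laws on $\{1,\dots,m\}$; and let $B_\star=\sum_{j\in\Lambda}\sup_{1\le k\le m}\mathbf a^\star_{\sigma,k}(j)$ (with $1/0:=0$ below if $B_\star=0$). Then the natural order exists and is unique, the numbers $n_\star(D)$ are well defined, every incomplete decorated contour without loose ends is a decorated Toom contour, and $$\nu(D)=\hat p^{\,n_*(D)}(1-\hat p)^{n_\diamond(D)}\prod_{i\in\psi(V)\setminus\psi(V_*)}\hat{\mathbf r}_{\tau(i)}(\kappa(i))\ \prod_{\star\in\{\circ,\bullet\}}\prod_{s=1}^\sigma\prod_{(i,ij)\in\psi(\vec E^\star_s)}\mathbf a^\star_{s,\kappa(i)}(j)\ \cdot\ B_\circ^{-n_\circ(D)}B_\bullet^{-n_\bullet(D)}p_\circ^{n_\circ(D)}(1-p_\circ)^{n_\bullet(D)}$$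 defines a subprobability measure on $\mathcal D_0$. Moreover there is a Markov chain, with values in the incomplete decorated contours rooted at $0$ together with a cemetery state, whose probability of ever reaching a contour without loose ends that is isomorphic to $D$ equals $\nu(D)$ for every $D\in\mathcal D_0$. It is the following chain. It starts from a single vertex (the root, a source) at $0$; the point $0$ receives a decoration with law $q_1$, where $q_t(0)=\hat p$ and $q_t(k)=(1-\hat p)\hat{\mathbf r}_t(k)$ for $1\le k\le m$, and if this is $0$ the root is also a sink. Contours without loose ends and the cemetery state are absorbing. Otherwise let $(v,s)$ be the most urgent loose end and $i=\psi(v)$. * If $s<\sigma$: draw $j$ from $\mathbf a^\star_{s,\kappa(i)}$, with $\star=\circ$ if $v$ is a source other than the root and $\star=\bullet$ otherwise. If there is a sink at $ij$, add an edge of charge $s$ from $v$ to it. If not, give $ij$ a decoration with law $q_s$ unless it already has one, and add an edge of charge $s$ from $v$ to a new vertex at $ij$, which is a sink if the decoration is $0$ and an internal vertex of charge $s$ otherwise. * If $s=\sigma$: with probability $1-p_\circ$ set $\star=\bullet$, $t=\sigma$, and with probability $p_\circ$ set $\star=\circ$, $t=\circ$. A pair $(j,k)$, $j\in\Lambda$,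 $1\le k\le m$, is drawn with probability $B_\star^{-1}\mathbf a^\star_{\sigma,k}(j)$ times $1_{\{\kappa(ij^{-1})=k\}}$ if $ij^{-1}$ already belongs to the contour, and times $q_t(k)$ if not; in the latter case $ij^{-1}$ receives the decoration $k$. If $\star=\circ$, add a new source at $ij^{-1}$ with an edge of charge $\sigma$ to $v$. If $\star=\bullet$, do the same with a new internal vertex of charge $\sigma$, except that if $ij^{-1}=0$ and the root has no outgoing edge of charge $\sigma$, the edge is drawn from the root to $v$. With the remaining probability, and whenever the result would not be an incomplete decorated contour, the chain moves to the cemetery state. -/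

import Mathlib

open MeasureTheory

universe u

namespace Toom

/-! Charges `1, …, σ` are the elements of `Fin σ`; the first charge is `0`, the last one is `⊤`.
The space-time `Λ` is a group in multiplicative notation, so its unit (the origin) is `1`. -/

/-- The types a vertex can have. -/
inductive VType (σ : ℕ) where
  | source : VType σ
  | sink : VType σ
  | internal (s : Fin σ) : VType σ

/-- A typed directed graph with vertex types source, sink and `s`-internal, and edge types (charges)
`s : Fin σ`. A vertex may have several types, and there is at most one edge of each charge from one
vertex to another one. -/
structure TypedDigraph (V : Type*) (σ : ℕ) where
  src : Finset V
  snk : Finset V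
  internal : Fin σ → Finset V
  edge : Fin σ → Finset (V × V)

namespace TypedDigraph

variable {V W : Type*} {σ : ℕ}

/-- The number of edges of charge `s` that enter `v`. -/
def inDeg [DecidableEq V] (G : TypedDigraph V σ) (s : Fin σ) (v : V) : ℕ :=
  ((G.edge s).filter fun e => e.2 = v).card

/-- The number of edges of charge `s` that leave `v`. -/
def outDeg [DecidableEq V] (G : TypedDigraph V σ) (s : Fin σ) (v : V) : ℕ :=
  ((G.edge s).filter fun e => e.1 = v).card

/-- Every vertex has at least one type. -/
def Typed (G : TypedDigraph V σ) : Prop :=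
  ∀ v, v ∈ G.src ∨ v ∈ G.snk ∨ ∃ s, v ∈ G.internal s

/-- The associated undirected graph is connected. -/
def Connected (G : TypedDigraph V σ) : Prop :=
  (SimpleGraph.fromRel fun v w => ∃ s, (v, w) ∈ G.edge s).Connected

/-- The image of a typed directed graph under a relabelling of the vertices. -/
def map (G : TypedDigraph V σ) (χ : V ≃ W) : TypedDigraph W σ where
  src := G.src.map χ.toEmbedding
  snk := G.snk.map χ.toEmbedding
  internal s := (G.internal s).map χ.toEmbedding
  edge s := (G.edge s).map (χ.prodCongr χ).toEmbedding

theorem map_refl (G : TypedDigraph V σ) : G.map (Equiv.refl V) = G := by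
  have he : (Equiv.refl V).prodCongr (Equiv.refl V) = Equiv.refl (V × V) := by
    ext <;> rfl
  cases G
  simp [map, he]

theorem map_trans {X : Type*} (G : TypedDigraph V σ) (χ : V ≃ W) (ξ : W ≃ X) :
    G.map (χ.trans ξ) = (G.map χ).map ξ := by
  cases G
  simp only [map, Finset.map_map, TypedDigraph.mk.injEq]
  exact ⟨rfl, rfl, rfl, rfl⟩

/-- Toom graphs. A source that is not also a sink emits one edge of each charge and a sink that is
not also a source receives one edge of each charge; a vertex that is both is isolated. -/
structure IsToomGraph [DecidableEq V] (G : TypedDigraph V σ) : Prop where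
  typed : G.Typed
  source : ∀ v ∈ G.src, ∀ s, G.inDeg s v = 0 ∧ G.outDeg s v = if v ∈ G.snk then 0 else 1
  sink : ∀ v ∈ G.snk, ∀ s, G.outDeg s v = 0 ∧ G.inDeg s v = if v ∈ G.src then 0 else 1
  inner : ∀ s, ∀ v ∈ G.internal s, G.inDeg s v = 1 ∧ G.outDeg s v = 1 ∧
    ∀ l, l ≠ s → G.inDeg l v = 0 ∧ G.outDeg l v = 0

/-- Embeddings of a typed directed graph with root `r`: sinks do not overlap with other vertices,
and internal vertices do not overlap with internal vertices of the same charge, where the root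
counts as an internal vertex of every charge. -/
structure IsEmbedding {Λ : Type*} (G : TypedDigraph V σ) (r : V) (ψ : V → Λ) : Prop where
  sink : ∀ v ∈ G.snk, ∀ w, v ≠ w → ψ v ≠ ψ w
  inner : ∀ s v w, (v ∈ G.internal s ∨ v = r) → (w ∈ G.internal s ∨ w = r) → v ≠ w → ψ v ≠ ψ w

/-- The edges of charge `s` that leave an internal vertex of charge `s` or the root `r`. -/
def edgeInt [DecidableEq V] (G : TypedDigraph V σ) (r : V) (s : Fin σ) : Finset (V × V) :=
  (G.edge s).filter fun e => e.1 ∈ G.internal s ∨ e.1 = r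

/-- The edges of charge `s` that leave a source other than the root `r`. -/
def edgeSrc [DecidableEq V] (G : TypedDigraph V σ) (r : V) (s : Fin σ) : Finset (V × V) :=
  (G.edge s).filter fun e => e.1 ∈ G.src ∧ e.1 ≠ r

/-- Add a new last vertex of type `t`, without edges. -/
def addVertex {n : ℕ} (G : TypedDigraph (Fin n) σ) (t : VType σ) :
    TypedDigraph (Fin (n + 1)) σ where
  src := G.src.map Fin.castSuccEmb ∪ match t with
    | .source => {Fin.last n}
    | _ => ∅
  snk := G.snk.map Fin.castSuccEmb ∪ match t with
    | .sink => {Fin.last n}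
    | _ => ∅
  internal s := (G.internal s).map Fin.castSuccEmb ∪ match t with
    | .internal l => if l = s then {Fin.last n} else ∅
    | _ => ∅
  edge s := (G.edge s).map (Fin.castSuccEmb.prodMap Fin.castSuccEmb)

/-- Add an edge of charge `s` between `v` and `w`: the edge `(v, w)` if `s` is not the last charge,
and the reversed edge `(w, v)` if it is. -/
def attach [DecidableEq V] [NeZero σ] (G : TypedDigraph V σ) (s : Fin σ) (v w : V) :
    TypedDigraph V σ where
  src := G.src
  snk := G.snk
  internal := G.internal
  edge := Function.update G.edge s (insert (if s = ⊤ then (w, v) else (v, w)) (G.edge s))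

/-- The trivial Toom graph: an isolated vertex that is a source and a sink. -/
def IsTrivial {N : ℕ} (G : TypedDigraph (Fin (N + 1)) σ) : Prop :=
  N = 0 ∧ G.src = {0} ∧ G.snk = {0} ∧ (∀ s, G.internal s = ∅) ∧ ∀ s, G.edge s = ∅

/-- Incomplete Toom graphs, with vertex set `{0, …, N}` and root `0`. -/
structure IsIncomplete [NeZero σ] {N : ℕ} (G : TypedDigraph (Fin (N + 1)) σ) : Prop where
  typed : G.Typed
  conn : G.Connected
  root : 0 ∈ G.src
  source : ∀ v ∈ G.src, ∀ s, G.inDeg s v = 0 ∧ G.outDeg s v ≤ 1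
  sink : ∀ v ∈ G.snk, ∀ s, G.outDeg s v = 0 ∧ G.inDeg s v ≤ 1
  inner : ∀ s, ∀ v ∈ G.internal s, G.inDeg s v ≤ 1 ∧ G.outDeg s v ≤ 1 ∧
    ∀ l, l ≠ s → G.inDeg l v = 0 ∧ G.outDeg l v = 0
  grown : G.IsTrivial ∨
    (∀ v, (v ∈ G.internal ⊤ ∨ v ∈ G.src) → v ≠ 0 → G.outDeg ⊤ v = 1) ∧
    (∀ s, s ≠ ⊤ → ∀ v ∈ G.internal s, G.inDeg s v = 1) ∧
    (∀ v ∈ G.snk, ∃ s, s ≠ ⊤ ∧ G.inDeg s v = 1)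

/-- Loose ends. (The isolated vertex of the trivial Toom graph carries no loose ends; in all other
incomplete Toom graphs no vertex is both a source and a sink.) -/
def LooseEnd [NeZero σ] {N : ℕ} (G : TypedDigraph (Fin (N + 1)) σ) (v : Fin (N + 1)) (s : Fin σ) :
    Prop :=
  (s ≠ ⊤ ∧ ((v ∈ G.src ∧ v ∉ G.snk) ∨ v ∈ G.internal s) ∧ G.outDeg s v = 0) ∨
  (s = ⊤ ∧ ((v ∈ G.snk ∧ v ∉ G.src) ∨ v ∈ G.internal s) ∧ G.inDeg s v = 0)

/-- The most urgent loose end: smallest charge first, then smallest vertex. -/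
def MostUrgent [NeZero σ] {N : ℕ} (G : TypedDigraph (Fin (N + 1)) σ) (v : Fin (N + 1))
    (s : Fin σ) : Prop :=
  G.LooseEnd v s ∧ ∀ w l, G.LooseEnd w l → s < l ∨ (s = l ∧ v ≤ w)

/-- The trivial incomplete Toom graph: a single source, which is not a sink. -/
def start (σ : ℕ) : TypedDigraph (Fin (0 + 1)) σ where
  src := {0}
  snk := ∅
  internal _ := ∅
  edge _ := ∅

/-- The incomplete Toom graphs that arise from the trivial incomplete one by successive extensions
at the most urgent loose end. An extension adds one edge at the loose end; the other endpoint of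
this edge is either an old vertex (`join`) or a new vertex, which gets the next label (`grow`). -/
inductive Constructible [NeZero σ] : {N : ℕ} → TypedDigraph (Fin (N + 1)) σ → Prop
  | start : Constructible (TypedDigraph.start σ)
  | join {N : ℕ} {G : TypedDigraph (Fin (N + 1)) σ} {v : Fin (N + 1)} {s : Fin σ}
      (hG : Constructible G) (hv : G.MostUrgent v s) (w : Fin (N + 1))
      (hI : (G.attach s v w).IsIncomplete) : Constructible (G.attach s v w)
  | grow {N : ℕ} {G : TypedDigraph (Fin (N + 1)) σ} {v : Fin (N + 1)} {s : Fin σ}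
      (hG : Constructible G) (hv : G.MostUrgent v s) (t : VType σ)
      (hI : ((G.addVertex t).attach s v.castSucc (Fin.last (N + 1))).IsIncomplete) :
      Constructible ((G.addVertex t).attach s v.castSucc (Fin.last (N + 1)))

end TypedDigraph

/-- The data of a decorated contour on the vertex set `{0, …, N}`: a typed directed graph, a root, a
map `pos` (usually called `ψ`) from vertices to space-time points, and a decoration `dec` (usually
called `κ`) of space-time points, where `none` stands for the decoration `0` and `some k`, with
`k : Fin m`, for the nonzero decorations. The decoration is extended by `none` to the points that
are not in the image of `pos`. -/
structure DecGraph (Λ : Type u) (σ m : ℕ) where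
  N : ℕ
  G : TypedDigraph (Fin (N + 1)) σ
  root : Fin (N + 1)
  pos : Fin (N + 1) → Λ
  dec : Λ → Option (Fin m)

open scoped Classical in
/-- `Δ_k`, the union over all charges `s` of the sets `A_{s,k}`. -/
noncomputable def Delta {Λ : Type u} {σ m : ℕ} (A : Fin σ → Fin m → Finset Λ) (k : Fin m) :
    Finset Λ :=
  Finset.univ.biUnion fun s => A s k

namespace DecGraph

variable {Λ : Type u} {σ m : ℕ}

/-- Isomorphism: relabelling of the vertices. -/
def Iso (D E : DecGraph Λ σ m) : Prop :=
  ∃ χ : Fin (D.N + 1) ≃ Fin (E.N + 1), χ D.root = E.root ∧ D.G.map χ = E.G ∧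
    (∀ v, D.pos v = E.pos (χ v)) ∧ D.dec = E.dec

theorem Iso.refl (D : DecGraph Λ σ m) : D.Iso D :=
  ⟨Equiv.refl _, rfl, D.G.map_refl, fun _ => rfl, rfl⟩

theorem Iso.symm {D E : DecGraph Λ σ m} (h : D.Iso E) : E.Iso D := by
  obtain ⟨χ, h1, h2, h3, h4⟩ := h
  refine ⟨χ.symm, by simp [← h1], ?_, fun v => by simp [h3], h4.symm⟩
  rw [← h2, ← TypedDigraph.map_trans, Equiv.self_trans_symm, TypedDigraph.map_refl]

theorem Iso.trans {D E F : DecGraph Λ σ m} (h : D.Iso E) (g : E.Iso F) : D.Iso F := by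
  obtain ⟨χ, h1, h2, h3, h4⟩ := h
  obtain ⟨ξ, g1, g2, g3, g4⟩ := g
  refine ⟨χ.trans ξ, by simp [h1, g1], ?_, fun v => by simp [h3, g3], h4.trans g4⟩
  rw [TypedDigraph.map_trans, h2, g2]

/-- The conditions on the decoration: sinks have decoration `0`; an edge of charge `s` from `i` to
`i * j` that leaves an internal vertex or the root has `j ∈ A_{s,κ(i)}`; if it leaves a source other
than the root, then `j ∈ Δ_{κ(i)}` (with `A_{s,0}` and `Δ_0` empty). -/
structure IsDecorated [Group Λ] (A : Fin σ → Fin m → Finset Λ) (D : DecGraph Λ σ m) : Prop where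
  off : ∀ i, i ∉ Set.range D.pos → D.dec i = none
  sink : ∀ v ∈ D.G.snk, D.dec (D.pos v) = none
  inner : ∀ s, ∀ e ∈ D.G.edgeInt D.root s,
    ∃ k, D.dec (D.pos e.1) = some k ∧ (D.pos e.1)⁻¹ * D.pos e.2 ∈ A s k
  source : ∀ s, ∀ e ∈ D.G.edgeSrc D.root s,
    ∃ k, D.dec (D.pos e.1) = some k ∧ (D.pos e.1)⁻¹ * D.pos e.2 ∈ Delta A k

/-- Decorated Toom contours rooted at the origin. -/
structure IsContour [Group Λ] (A : Fin σ → Fin m → Finset Λ) (D : DecGraph Λ σ m) : Prop where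
  toom : D.G.IsToomGraph
  conn : D.G.Connected
  root : D.root ∈ D.G.src
  emb : D.G.IsEmbedding D.root D.pos
  dec : D.IsDecorated A
  origin : D.pos D.root = 1

/-- Incomplete decorated Toom contours rooted at the origin; the root is the vertex `0`. -/
structure IsIncContour [Group Λ] [NeZero σ] (A : Fin σ → Fin m → Finset Λ) (D : DecGraph Λ σ m) :
    Prop where
  graph : D.G.IsIncomplete
  root : D.root = 0
  emb : D.G.IsEmbedding D.root D.pos
  dec : D.IsDecorated A
  origin : D.pos D.root = 1

/-- There are no loose ends. -/
def Complete [NeZero σ] (D : DecGraph Λ σ m) : Prop :=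
  ∀ v s, ¬ D.G.LooseEnd v s

open scoped Classical in
/-- Add a new last vertex of type `t` at the point `i`, and give `i` the decoration `d`. -/
noncomputable def addVertex (D : DecGraph Λ σ m) (t : VType σ) (i : Λ) (d : Option (Fin m)) :
    DecGraph Λ σ m where
  N := D.N + 1
  G := D.G.addVertex t
  root := D.root.castSucc
  pos := Fin.snoc (α := fun _ => Λ) D.pos i
  dec := Function.update D.dec i d

/-- Add an edge of charge `s` between two vertices, oriented as in `TypedDigraph.attach`. -/
def attach [NeZero σ] (D : DecGraph Λ σ m) (s : Fin σ) (v w : Fin (D.N + 1)) : DecGraph Λ σ m :=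
  { D with G := D.G.attach s v w }

/-- Add an edge of charge `s` between `v` and a new last vertex of type `t` at `i`. -/
noncomputable def grow [NeZero σ] (D : DecGraph Λ σ m) (s : Fin σ) (v : Fin (D.N + 1))
    (t : VType σ) (i : Λ) (d : Option (Fin m)) : DecGraph Λ σ m :=
  (D.addVertex t i d).attach s v.castSucc (Fin.last (D.N + 1))

open scoped Classical in
/-- The trivial contours: a single vertex at the origin with decoration `d`, which is a source, and
also a sink if `d` is the decoration `0`. -/
noncomputable def trivial (Λ : Type u) [Group Λ] (σ : ℕ) {m : ℕ} (d : Option (Fin m)) :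
    DecGraph Λ σ m where
  N := 0
  G :=
    { src := {0}
      snk := if d = none then {0} else ∅
      internal := fun _ => ∅
      edge := fun _ => ∅ }
  root := 0
  pos _ := 1
  dec := Function.update (fun _ => none) 1 d

/-- `η` enumerates the vertices in the natural order: the root comes first, and the graph relabelled
by `η` arises by successive extensions at the most urgent loose end. (For the trivial Toom graph,
which has a single vertex, there is nothing to be ordered.) -/
def IsNatural [NeZero σ] (D : DecGraph Λ σ m) (η : Equiv.Perm (Fin (D.N + 1))) : Prop :=
  η D.root = 0 ∧ (D.G.IsTrivial ∨ (D.G.map η).Constructible)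

open scoped Classical in
/-- `τ'(v)`: the charge `s` for an internal vertex of charge `s`, the first charge for the root, and
`none`, which stands for the type `∘`, for the other sources. (Its value at sinks is not used.) -/
noncomputable def vertexType [NeZero σ] (D : DecGraph Λ σ m) (v : Fin (D.N + 1)) :
    Option (Fin σ) :=
  if v = D.root then some 0
  else if v ∈ D.G.src then none
  else if h : ∃ s, v ∈ D.G.internal s then some h.choose
  else none

/-- `τ(i)`: the type of the first vertex, in the order given by `η`, that is embedded at `i`. -/
noncomputable def pointType [NeZero σ] (D : DecGraph Λ σ m) (η : Equiv.Perm (Fin (D.N + 1)))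
    (i : Λ) : Option (Fin σ) :=
  D.vertexType (η.symm (sInf {k | D.pos (η.symm k) = i}))

open scoped Classical in
/-- `ψ(V) \ ψ(V_*)`, the points of the contour that are not occupied by a sink. -/
noncomputable def nonSinkPoints (D : DecGraph Λ σ m) : Finset Λ :=
  Finset.univ.image D.pos \ D.G.snk.image D.pos

open scoped Classical in
/-- `ψ(F)`, the image in space-time of a set `F` of edges. -/
noncomputable def edgeImage (D : DecGraph Λ σ m) (F : Finset (Fin (D.N + 1) × Fin (D.N + 1))) :
    Finset (Λ × Λ) :=
  F.image fun e => (D.pos e.1, D.pos e.2)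

/-- `n_*`, the number of sinks. -/
def nStar (D : DecGraph Λ σ m) : ℕ := D.G.snk.card

/-- `n_◇`, the number of points of the contour not occupied by a sink. -/
noncomputable def nDiamond (D : DecGraph Λ σ m) : ℕ := D.nonSinkPoints.card

/-- `n_∘`, the number of edges of a given charge, for instance the last one, that leave a source
other than the root. -/
def nSrc [NeZero σ] (D : DecGraph Λ σ m) : ℕ := (D.G.edgeSrc D.root ⊤).card

/-- `n_•`, the number of edges of a given charge, for instance the last one, that leave an internal
vertex or the root. -/
def nInt [NeZero σ] (D : DecGraph Λ σ m) : ℕ := (D.G.edgeInt D.root ⊤).card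

end DecGraph

section Spaces

variable {Λ : Type u} [Group Λ] {σ m : ℕ}

/-- Decorated Toom contours rooted at the origin, with vertex set `{0, …, N}` for some `N`. -/
abbrev Contour (A : Fin σ → Fin m → Finset Λ) : Type u :=
  {D : DecGraph Λ σ m // D.IsContour A}

instance contourSetoid (A : Fin σ → Fin m → Finset Λ) : Setoid (Contour A) where
  r D E := D.1.Iso E.1
  iseqv := ⟨fun D => .refl D.1, fun h => h.symm, fun h g => h.trans g⟩

/-- The set of decorated Toom contours rooted at the origin, up to isomorphism. -/
abbrev ContourClass (A : Fin σ → Fin m → Finset Λ) : Type u := Quotient (contourSetoid A)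

instance contourClassMeasurableSpace (A : Fin σ → Fin m → Finset Λ) :
    MeasurableSpace (ContourClass A) := ⊤

/-- Incomplete decorated Toom contours rooted at the origin. -/
abbrev IncContour [NeZero σ] (A : Fin σ → Fin m → Finset Λ) : Type u :=
  {D : DecGraph Λ σ m // D.IsIncContour A}

/-- The parameters: `pHat` and `pCirc` in `[0, 1]`, subprobability laws `aInt s k` (usually written
`a^•_{s,k}`) concentrated on `A_{s,k}` and `aSrc s k` (usually written `a^∘_{s,k}`) concentrated on
`Δ_k`, and probability laws `rHat t` on `Fin m`, where `t` is a charge or `none` (the type `∘`). -/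
structure Params (A : Fin σ → Fin m → Finset Λ) where
  pHat : ℝ
  pHat_mem : pHat ∈ Set.Icc (0 : ℝ) 1
  pCirc : ℝ
  pCirc_mem : pCirc ∈ Set.Icc (0 : ℝ) 1
  aInt : Fin σ → Fin m → Λ → ℝ
  aInt_nonneg : ∀ s k j, 0 ≤ aInt s k j
  aInt_off : ∀ s k, ∀ j ∉ A s k, aInt s k j = 0
  aInt_sum : ∀ s k, ∑ j ∈ A s k, aInt s k j ≤ 1
  aSrc : Fin σ → Fin m → Λ → ℝ
  aSrc_nonneg : ∀ s k j, 0 ≤ aSrc s k j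
  aSrc_off : ∀ s k, ∀ j ∉ Delta A k, aSrc s k j = 0
  aSrc_sum : ∀ s k, ∑ j ∈ Delta A k, aSrc s k j ≤ 1
  rHat : Option (Fin σ) → Fin m → ℝ
  rHat_nonneg : ∀ t k, 0 ≤ rHat t k
  rHat_sum : ∀ t, ∑ k, rHat t k = 1

namespace Params

variable {A : Fin σ → Fin m → Finset Λ}

/-- `B_• = ∑_j sup_k a^•_{σ,k}(j)`. -/
noncomputable def bInt [NeZero σ] (P : Params A) : ℝ := ∑' j, ⨆ k, P.aInt ⊤ k j

/-- `B_∘ = ∑_j sup_k a^∘_{σ,k}(j)`. -/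
noncomputable def bSrc [NeZero σ] (P : Params A) : ℝ := ∑' j, ⨆ k, P.aSrc ⊤ k j

/-- The product formula for the weight of a decorated Toom contour `D` whose vertices are ordered
by `η`. -/
noncomputable def weight [NeZero σ] (P : Params A) (D : DecGraph Λ σ m)
    (η : Equiv.Perm (Fin (D.N + 1))) : ℝ :=
  P.pHat ^ D.nStar * (1 - P.pHat) ^ D.nDiamond *
    (∏ i ∈ D.nonSinkPoints, (D.dec i).elim 0 fun k => P.rHat (D.pointType η i) k) *
    (∏ s, ∏ e ∈ D.edgeImage (D.G.edgeSrc D.root s),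
      (D.dec e.1).elim 0 fun k => P.aSrc s k (e.1⁻¹ * e.2)) *
    (∏ s, ∏ e ∈ D.edgeImage (D.G.edgeInt D.root s),
      (D.dec e.1).elim 0 fun k => P.aInt s k (e.1⁻¹ * e.2)) *
    ((P.bSrc ^ D.nSrc)⁻¹ * (P.bInt ^ D.nInt)⁻¹ * P.pCirc ^ D.nSrc * (1 - P.pCirc) ^ D.nInt)

/-- The law of the decoration of a new point: `0` with probability `pHat`, and `k` with probability
`(1 - pHat) * rHat t k`. -/
noncomputable def freshLaw (P : Params A) (t : Option (Fin σ)) (d : Option (Fin m)) : ℝ :=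
  d.elim P.pHat fun k => (1 - P.pHat) * P.rHat t k

open scoped Classical in
/-- The law of the decoration of the point `i`, given the incomplete contour `D`: it is known if `i`
belongs to `D`, and has the law `freshLaw t` otherwise. -/
noncomputable def decLaw (P : Params A) (D : DecGraph Λ σ m) (i : Λ) (t : Option (Fin σ))
    (d : Option (Fin m)) : ℝ :=
  if i ∈ Set.range D.pos then (if D.dec i = d then 1 else 0) else P.freshLaw t d

variable [NeZero σ]

/-- `E` is obtained from `D` by adding an edge of charge `s ≠ ⊤` from `v` to the point `i`, with
decoration `d`: if there is a sink at `i`, then the edge leads to this sink; otherwise it leads to a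
new vertex, which is a sink if `d` is `0` and an internal vertex of charge `s` if not. -/
def UpResult (D : DecGraph Λ σ m) (v : Fin (D.N + 1)) (s : Fin σ) (i : Λ) (d : Option (Fin m))
    (E : DecGraph Λ σ m) : Prop :=
  (∃ w ∈ D.G.snk, D.pos w = i ∧ E = D.attach s v w) ∨
  ((¬ ∃ w ∈ D.G.snk, D.pos w = i) ∧
    E = D.grow s v (d.elim VType.sink fun _ => VType.internal s) i d)

/-- `E` is obtained from `D` by adding an edge of charge `⊤` from the point `i`, with decoration
`k`, to `v`: if `i` is the origin and the root emits no edge of charge `⊤` yet, then the edge comes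
from the root; otherwise it comes from a new internal vertex. -/
def DownResult (D : DecGraph Λ σ m) (v : Fin (D.N + 1)) (i : Λ) (k : Fin m)
    (E : DecGraph Λ σ m) : Prop :=
  (i = 1 ∧ D.G.outDeg ⊤ D.root = 0 ∧ E = D.attach ⊤ v D.root) ∨
  (¬ (i = 1 ∧ D.G.outDeg ⊤ D.root = 0) ∧ E = D.grow ⊤ v (VType.internal ⊤) i (some k))

open scoped Classical in
/-- The probability that the upward extension of `D` at the loose end `(v, s)` is `E`. -/
noncomputable def upProb (P : Params A) (D : DecGraph Λ σ m) (v : Fin (D.N + 1)) (s : Fin σ)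
    (E : DecGraph Λ σ m) : ℝ :=
  (D.dec (D.pos v)).elim 0 fun k => ∑ j ∈ Delta A k, ∑ d : Option (Fin m),
    if UpResult D v s (D.pos v * j) d E then
      (if v ∈ D.G.src ∧ v ≠ D.root then P.aSrc s k j else P.aInt s k j) *
        P.decLaw D (D.pos v * j) (some s) d
    else 0

open scoped Classical in
/-- The probability that the downward extension of `D` at the loose end `(v, ⊤)` is `E`. -/
noncomputable def downProb (P : Params A) (D : DecGraph Λ σ m) (v : Fin (D.N + 1))
    (E : DecGraph Λ σ m) : ℝ :=
  ∑ k, ∑ j ∈ Delta A k,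
    if DownResult D v (D.pos v * j⁻¹) k E then
      P.bInt⁻¹ * P.aInt ⊤ k j * P.decLaw D (D.pos v * j⁻¹) (some ⊤) (some k)
    else 0

open scoped Classical in
/-- The probability that the source extension of `D` at the loose end `(v, ⊤)` is `E`. -/
noncomputable def sourceProb (P : Params A) (D : DecGraph Λ σ m) (v : Fin (D.N + 1))
    (E : DecGraph Λ σ m) : ℝ :=
  ∑ k, ∑ j ∈ Delta A k,
    if E = D.grow ⊤ v VType.source (D.pos v * j⁻¹) (some k) then
      P.bSrc⁻¹ * P.aSrc ⊤ k j * P.decLaw D (D.pos v * j⁻¹) none (some k)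
    else 0

open scoped Classical in
/-- The probability that the random extension of `D` at its (unique) most urgent loose end is `E`. -/
noncomputable def stepProb (P : Params A) (D E : DecGraph Λ σ m) : ℝ :=
  ∑ v, ∑ s, if D.G.MostUrgent v s then
      (if s = ⊤ then (1 - P.pCirc) * P.downProb D v E + P.pCirc * P.sourceProb D v E
        else P.upProb D v s E)
    else 0

open scoped Classical in
/-- The transition probability from one incomplete decorated contour to another one. Complete
contours are absorbing. -/
noncomputable def transInc (P : Params A) (x y : IncContour A) : ENNReal :=
  if x.1.Complete then (if x = y then 1 else 0) else ENNReal.ofReal (P.stepProb x.1 y.1)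

/-- The transition probabilities of the contour extending Markov chain; `none` is the cemetery
state. The extension fails with the remaining probability, in particular if the drawn extension is
not an incomplete decorated contour. -/
noncomputable def trans (P : Params A) : Option (IncContour A) → Option (IncContour A) → ENNReal
  | none, none => 1
  | none, some _ => 0
  | some x, some y => P.transInc x y
  | some x, none => 1 - ∑' y, P.transInc x y

open scoped Classical in
/-- The initial law of the chain: a trivial contour with random decoration. -/
noncomputable def initLaw (P : Params A) : Option (IncContour A) → ENNReal
  | none => 0
  | some x => ∑ d : Option (Fin m),
      if x.1 = DecGraph.trivial Λ σ d then ENNReal.ofReal (P.freshLaw (some 0) d) else 0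

/-- `X` is a contour extending Markov chain on the probability space `(Ω, μ)`. -/
structure IsContourChain (P : Params A) {Ω : Type*} [MeasurableSpace Ω] (μ : Measure Ω)
    (X : ℕ → Ω → Option (IncContour A)) : Prop where
  meas : ∀ n (S : Set (Option (IncContour A))), MeasurableSet (X n ⁻¹' S)
  law : ∀ n (x : ℕ → Option (IncContour A)),
    μ {ω | ∀ k ≤ n, X k ω = x k} =
      P.initLaw (x 0) * ∏ k ∈ Finset.range n, P.trans (x k) (x (k + 1))

end Params

end Spaces

end Toom

/-!
The weight of a contour is the probability that the chain builds this contour edge by edge in its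
natural order, so everything comes from one deterministic procedure, the *exploration*
(`TypedDigraph.Explore`): starting at the root of a Toom graph `G`, find again and again the edge of
`G` that is missing at the most urgent loose end of the part found so far, numbering new vertices in
the order of their appearance. If the root is not a sink, the stage after `k` steps is unique
(`Explore.unique`), it is an incomplete Toom graph (`Explore.isIncomplete`), and the procedure stops
since `G` has finitely many edges. A stage without loose ends is itself a Toom graph
(`IsIncomplete.isToomGraph`: counting the endpoints of the edges of each charge shows that there are
as many sources as sinks, so also those edges are present whose absence is not a loose end), and a
Toom graph that is part of a connected one is all of it (`IsPart.surjective`). This gives existence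
and uniqueness of the natural order. That the number of edges that leave a source or an internal
vertex does not depend on the charge is seen from the heights: all edges go up by one, so the edges
of a charge count the heights of the sinks minus those of the sources (`IsContour.card_edge`).

For a contour `D`, let the weight of a stage be the product of a factor for each edge found and of
the law of the decoration for each point found. A step of the exploration changes it by exactly the
transition probability of the chain (`stageWeight_succ`): the edge is joined to an old vertex only
if this vertex is a sink or the root, which is how the chain decides between an old and a new
vertex. At the end the weight is the product formula (`stageWeight_eq_weight`).

Conversely, if a sequence of extensions leads to a graph isomorphic to `D`, then removing the last
edge again and again shows that every term is the stage of the exploration of `D`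
(`explore_of_isExtension`). Almost surely the chain makes only transitions of positive probability.
Hence, up to a null set, the event that it reaches `D` is the cylinder event that it follows the
exploration of `D`, whose probability is the weight (`measure_reach`). As complete contours are
absorbing, these events are almost surely disjoint for different classes, so the weights have total
mass at most one.
-/

namespace Toom

/-! ### Markov chains with given transition probabilities -/

section Markov
open ProbabilityTheory

/-- Ionescu-Tulcea: for a law `f` and transition probabilities `T` on any type `S`, there is a
Markov chain with values in `S`, with its finite-dimensional laws. -/
theorem exists_markov_chain {S : Type u} (f : S → ENNReal) (hf : ∑' x, f x = 1)
    (T : S → S → ENNReal) (hT : ∀ x, ∑' y, T x y = 1) :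
    ∃ (Ω : Type u) (_ : MeasurableSpace Ω) (μ : Measure Ω) (X : ℕ → Ω → S),
      IsProbabilityMeasure μ ∧ (∀ n (B : Set S), MeasurableSet (X n ⁻¹' B)) ∧
      ∀ n (x : ℕ → S), μ {ω | ∀ k ≤ n, X k ω = x k} =
        f (x 0) * ∏ k ∈ Finset.range n, T (x k) (x (k + 1)) := by
  let _ : MeasurableSpace S := ⊤
  have : MeasurableSingletonClass S := ⟨fun _ => trivial⟩
  -- All laws are discrete, so they can be taken on the σ-algebra of all sets.
  let p (x : S) : PMF S := ⟨T x, hT x ▸ ENNReal.summable.hasSum⟩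
  let p0 : PMF S := ⟨f, hf ▸ ENNReal.summable.hasSum⟩
  let K : Kernel S S := ⟨fun x => (p x).toMeasure, measurable_from_top⟩
  have : IsMarkovKernel K :=
    ⟨fun x => by change IsProbabilityMeasure (p x).toMeasure; infer_instance⟩
  let κ (n : ℕ) : Kernel (∀ _ : Finset.Iic n, S) S :=
    K.comap (fun y => y ⟨n, Finset.mem_Iic.2 le_rfl⟩) (measurable_pi_apply _)
  let μ : Measure (ℕ → S) := Kernel.trajMeasure (X := fun _ => S) p0.toMeasure κ
  have hμ : IsProbabilityMeasure μ := inferInstance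
  refine ⟨ℕ → S, inferInstance, μ, fun n ω => ω n, hμ, fun n B => ?_, fun n x => ?_⟩
  · exact (measurable_pi_apply (X := fun _ : ℕ => S) n) (t := B) trivial
  have hset (n : ℕ) : {ω : ℕ → S | ∀ k ≤ n, ω k = x k} =
      Preorder.frestrictLe (π := fun _ => S) n ⁻¹' {(fun i => x i : ∀ _ : Finset.Iic n, S)} := by
    ext ω
    simp only [Set.mem_ofPred_eq, Set.mem_preimage, Set.mem_singleton_iff, funext_iff,
      Preorder.frestrictLe_apply, Subtype.forall, Finset.mem_Iic]
  induction n with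
  | zero =>
    have h0 : μ.map (Preorder.frestrictLe (π := fun _ => S) 0) =
        p0.toMeasure.map (MeasurableEquiv.piUnique fun _ : Finset.Iic 0 => S).symm := by
      rw [show μ = Kernel.trajMeasure (X := fun _ => S) p0.toMeasure κ from rfl,
        Kernel.trajMeasure,
        Measure.map_comp _ _ (Preorder.measurable_frestrictLe (X := fun _ => S) 0),
        Kernel.traj_map_frestrictLe,
        Kernel.partialTraj_self, Measure.id_comp]
    rw [hset, ← Measure.map_apply (Preorder.measurable_frestrictLe (X := fun _ => S) 0)
      (by measurability), h0,
      Measure.map_apply (by fun_prop) (by measurability)]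
    have h1 : (MeasurableEquiv.piUnique fun _ : Finset.Iic 0 => S).symm ⁻¹'
        {(fun i => x i : ∀ _ : Finset.Iic 0, S)} = {x 0} := by
      ext y
      simp only [Set.mem_preimage, Set.mem_singleton_iff]
      rw [MeasurableEquiv.symm_apply_eq]
      rfl
    rw [h1, PMF.toMeasure_apply_singleton _ _ (by measurability)]
    rw [Finset.range_zero, Finset.prod_empty, mul_one]
    rfl
  | succ n ih =>
    -- The cylinder up to time `n + 1` is a product set for the path up to `n` and the next state.
    have h1 : {ω : ℕ → S | ∀ k ≤ n + 1, ω k = x k} =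
        (fun ω : ℕ → S => (Preorder.frestrictLe (π := fun _ => S) n ω, ω (n + 1))) ⁻¹'
          ({(fun i => x i : ∀ _ : Finset.Iic n, S)} ×ˢ {x (n + 1)}) := by
      rw [Set.mk_preimage_prod, ← hset n]
      ext ω
      simp only [Set.mem_ofPred_eq, Set.mem_inter_iff, Set.mem_preimage, Set.mem_singleton_iff]
      refine ⟨fun h => ⟨fun k hk => h k (by omega), h _ le_rfl⟩, fun h k hk => ?_⟩
      rcases Nat.lt_or_ge n k with h' | h'
      · obtain rfl : k = n + 1 := by omega
        exact h.2
      · exact h.1 k h'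
    rw [h1, ← Measure.map_apply (by fun_prop) (by measurability),
      ← Kernel.map_frestrictLe_trajMeasure_compProd_eq_map_trajMeasure,
      Measure.compProd_apply_prod (by measurability) (by measurability), Measure.restrict_singleton,
      lintegral_smul_measure, lintegral_dirac, Measure.map_apply (by fun_prop) (by measurability),
      ← hset n]
    have h2 : κ n (fun i => x i) {x (n + 1)} = T (x n) (x (n + 1)) := by
      change (p (x n)).toMeasure {x (n + 1)} = _
      rw [PMF.toMeasure_apply_singleton _ _ (by measurability)]
      rfl
    rw [h2]
    change μ _ * _ = _
    rw [ih, Finset.prod_range_succ, mul_assoc]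

/-- On a countable state space, a Markov chain makes almost surely only transitions of positive
probability. -/
theorem ae_transition_ne_zero {S Ω : Type*} [Countable S] [MeasurableSpace Ω] {μ : Measure Ω}
    {X : ℕ → Ω → S} {f : S → ENNReal} {T : S → S → ENNReal}
    (hX : ∀ n (x : ℕ → S), μ {ω | ∀ k ≤ n, X k ω = x k} =
      f (x 0) * ∏ k ∈ Finset.range n, T (x k) (x (k + 1))) :
    ∀ᵐ ω ∂μ, f (X 0 ω) ≠ 0 ∧ ∀ n, T (X n ω) (X (n + 1) ω) ≠ 0 := by
  have key : ∀ᵐ ω ∂μ, ∀ n, f (X 0 ω) * ∏ k ∈ Finset.range n, T (X k ω) (X (k + 1) ω) ≠ 0 := by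
    rw [ae_all_iff]
    intro n
    -- Only the values up to time `n` matter, so countably many trajectories have to be excluded.
    let ext (y : Fin (n + 1) → S) (k : ℕ) : S := y ⟨min k n, by omega⟩
    have hnull : μ (⋃ (y : Fin (n + 1) → S)
        (_ : f (ext y 0) * ∏ k ∈ Finset.range n, T (ext y k) (ext y (k + 1)) = 0),
        {ω | ∀ k ≤ n, X k ω = ext y k}) = 0 := by
      refine measure_iUnion_null fun y => measure_iUnion_null fun hy => ?_
      rw [hX, hy]
    refine measure_mono_null (fun ω hω => ?_) hnull
    have hω : f (X 0 ω) * ∏ k ∈ Finset.range n, T (X k ω) (X (k + 1) ω) = 0 := not_not.1 hω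
    have hext (k : ℕ) (hk : k ≤ n) : ext (fun i => X i ω) k = X k ω := by
      simp [ext, min_eq_left hk]
    refine Set.mem_iUnion₂.2 ⟨fun i => X i ω, ?_, fun k hk => (hext k hk).symm⟩
    rw [← hω, hext 0 (Nat.zero_le n)]
    congr 1
    refine Finset.prod_congr rfl fun k hk => ?_
    rw [Finset.mem_range] at hk
    rw [hext k hk.le, hext (k + 1) hk]
  filter_upwards [key] with ω hω
  refine ⟨fun h => hω 0 (by simp [h]), fun n h => hω (n + 1) ?_⟩
  rw [Finset.prod_range_succ, h, mul_zero, mul_zero]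

end Markov

/-! ### Toom graphs and incomplete Toom graphs -/

namespace TypedDigraph

section Degrees

variable {V : Type*} [DecidableEq V] {σ : ℕ} {G : TypedDigraph V σ} {s : Fin σ} {v w w' : V}

theorem outDeg_eq_zero_iff : G.outDeg s v = 0 ↔ ∀ w, (v, w) ∉ G.edge s := by
  simp only [outDeg, Finset.card_eq_zero, Finset.filter_eq_empty_iff, Prod.forall]
  exact ⟨fun h w hw => h v w hw rfl, fun h a b hab e => h b (e ▸ hab)⟩

theorem inDeg_eq_zero_iff : G.inDeg s v = 0 ↔ ∀ w, (w, v) ∉ G.edge s := by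
  simp only [inDeg, Finset.card_eq_zero, Finset.filter_eq_empty_iff, Prod.forall]
  exact ⟨fun h w hw => h w v hw rfl, fun h a b hab e => h a (e ▸ hab)⟩

theorem outDeg_pos_iff : 0 < G.outDeg s v ↔ ∃ w, (v, w) ∈ G.edge s := by
  rw [Nat.pos_iff_ne_zero, Ne, outDeg_eq_zero_iff]
  push Not
  rfl

theorem inDeg_pos_iff : 0 < G.inDeg s v ↔ ∃ w, (w, v) ∈ G.edge s := by
  rw [Nat.pos_iff_ne_zero, Ne, inDeg_eq_zero_iff]
  push Not
  rfl

theorem outDeg_le_one_iff :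
    G.outDeg s v ≤ 1 ↔ ∀ w w', (v, w) ∈ G.edge s → (v, w') ∈ G.edge s → w = w' := by
  rw [outDeg, Finset.card_le_one]
  simp only [Finset.mem_filter, Prod.forall, Prod.mk.injEq]
  constructor
  · exact fun h w w' hw hw' => (h v w ⟨hw, rfl⟩ v w' ⟨hw', rfl⟩).2
  · rintro h a b ⟨hab, rfl⟩ c d ⟨hcd, rfl⟩
    exact ⟨rfl, h b d hab hcd⟩

theorem inDeg_le_one_iff :
    G.inDeg s v ≤ 1 ↔ ∀ w w', (w, v) ∈ G.edge s → (w', v) ∈ G.edge s → w = w' := by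
  rw [inDeg, Finset.card_le_one]
  simp only [Finset.mem_filter, Prod.forall, Prod.mk.injEq]
  constructor
  · exact fun h w w' hw hw' => (h w v ⟨hw, rfl⟩ w' v ⟨hw', rfl⟩).1
  · rintro h a b ⟨hab, rfl⟩ c d ⟨hcd, rfl⟩
    exact ⟨h a c hab hcd, rfl⟩

variable (G s) in
theorem sum_outDeg [Fintype V] : ∑ v, G.outDeg s v = (G.edge s).card := by
  simp only [outDeg]
  exact (Finset.card_eq_sum_card_fiberwise fun _ _ => Finset.mem_coe.2 (Finset.mem_univ _)).symm

variable (G s) in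
theorem sum_inDeg [Fintype V] : ∑ v, G.inDeg s v = (G.edge s).card := by
  simp only [inDeg]
  exact (Finset.card_eq_sum_card_fiberwise fun _ _ => Finset.mem_coe.2 (Finset.mem_univ _)).symm

end Degrees

namespace IsToomGraph

variable {V : Type*} [DecidableEq V] {σ : ℕ} {G : TypedDigraph V σ} {s l : Fin σ} {v w w' : V}

theorem not_src_of_internal (hG : G.IsToomGraph) (hv : v ∈ G.internal s) : v ∉ G.src := fun h => by
  have h1 := (hG.source v h s).1
  have h2 := (hG.inner s v hv).1
  omega

theorem not_snk_of_internal (hG : G.IsToomGraph) (hv : v ∈ G.internal s) : v ∉ G.snk := fun h => by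
  have h1 := (hG.sink v h s).1
  have h2 := (hG.inner s v hv).2.1
  omega

theorem internal_inj (hG : G.IsToomGraph) (hv : v ∈ G.internal s) (hl : v ∈ G.internal l) :
    s = l := by
  by_contra h
  have h1 := (hG.inner s v hv).1
  have h2 := ((hG.inner l v hl).2.2 s h).1
  omega

theorem outDeg_le_one (hG : G.IsToomGraph) (s : Fin σ) (v : V) : G.outDeg s v ≤ 1 := by
  rcases hG.typed v with h | h | ⟨l, h⟩
  · rw [(hG.source v h s).2]
    split_ifs <;> simp
  · simp [(hG.sink v h s).1]
  · by_cases e : s = l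
    · subst e
      exact (hG.inner s v h).2.1.le
    · simp [((hG.inner l v h).2.2 s e).2]

theorem inDeg_le_one (hG : G.IsToomGraph) (s : Fin σ) (v : V) : G.inDeg s v ≤ 1 := by
  rcases hG.typed v with h | h | ⟨l, h⟩
  · simp [(hG.source v h s).1]
  · rw [(hG.sink v h s).2]
    split_ifs <;> simp
  · by_cases e : s = l
    · subst e
      exact (hG.inner s v h).1.le
    · simp [((hG.inner l v h).2.2 s e).1]

theorem edge_right_unique (hG : G.IsToomGraph) (h : (v, w) ∈ G.edge s) (h' : (v, w') ∈ G.edge s) :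
    w = w' :=
  outDeg_le_one_iff.1 (hG.outDeg_le_one s v) w w' h h'

theorem edge_left_unique (hG : G.IsToomGraph) (h : (w, v) ∈ G.edge s) (h' : (w', v) ∈ G.edge s) :
    w = w' :=
  inDeg_le_one_iff.1 (hG.inDeg_le_one s v) w w' h h'

/-- An edge of charge `s` starts at a source or at an internal vertex of charge `s`. -/
theorem edge_start (hG : G.IsToomGraph) (h : (v, w) ∈ G.edge s) :
    (v ∈ G.src ∧ v ∉ G.snk) ∨ v ∈ G.internal s := by
  have hpos : 0 < G.outDeg s v := outDeg_pos_iff.2 ⟨w, h⟩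
  rcases hG.typed v with hv | hv | ⟨l, hv⟩
  · refine .inl ⟨hv, fun hv' => ?_⟩
    have := (hG.sink v hv' s).1
    omega
  · have := (hG.sink v hv s).1
    omega
  · by_cases e : s = l
    · exact .inr (e ▸ hv)
    · have := ((hG.inner l v hv).2.2 s e).2
      omega

/-- An edge of charge `s` ends at a sink or at an internal vertex of charge `s`. -/
theorem edge_end (hG : G.IsToomGraph) (h : (v, w) ∈ G.edge s) :
    (w ∈ G.snk ∧ w ∉ G.src) ∨ w ∈ G.internal s := by
  have hpos : 0 < G.inDeg s w := inDeg_pos_iff.2 ⟨v, h⟩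
  rcases hG.typed w with hv | hv | ⟨l, hv⟩
  · have := (hG.source w hv s).1
    omega
  · refine .inl ⟨hv, fun hv' => ?_⟩
    have := (hG.source w hv' s).1
    omega
  · by_cases e : s = l
    · exact .inr (e ▸ hv)
    · have := ((hG.inner l w hv).2.2 s e).1
      omega

theorem exists_edge_from (hG : G.IsToomGraph) (h : (v ∈ G.src ∧ v ∉ G.snk) ∨ v ∈ G.internal s) :
    ∃ w, (v, w) ∈ G.edge s := by
  rw [← outDeg_pos_iff]
  rcases h with ⟨h, h'⟩ | h
  · simp [(hG.source v h s).2, h']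
  · simp [(hG.inner s v h).2.1]

theorem exists_edge_to (hG : G.IsToomGraph) (h : (v ∈ G.snk ∧ v ∉ G.src) ∨ v ∈ G.internal s) :
    ∃ w, (w, v) ∈ G.edge s := by
  rw [← inDeg_pos_iff]
  rcases h with ⟨h, h'⟩ | h
  · simp [(hG.sink v h s).2, h']
  · simp [(hG.inner s v h).1]

end IsToomGraph

theorem IsTrivial.isToomGraph {σ N : ℕ} {G : TypedDigraph (Fin (N + 1)) σ} (hG : G.IsTrivial) :
    G.IsToomGraph := by
  obtain ⟨rfl, h1, h2, h3, h4⟩ := hG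
  have hin (s v) : G.inDeg s v = 0 := by simp [inDeg, h4]
  have hout (s v) : G.outDeg s v = 0 := by simp [outDeg, h4]
  refine ⟨fun v => .inl ?_, fun v _ s => ?_, fun v _ s => ?_, fun s v hv => ?_⟩
  · simp [h1, Fin.fin_one_eq_zero v]
  · simp [hin, hout, h2, Fin.fin_one_eq_zero v]
  · simp [hin, hout, h1, Fin.fin_one_eq_zero v]
  · simp [h3] at hv

section Complete

variable {σ N : ℕ} [NeZero σ] {G : TypedDigraph (Fin (N + 1)) σ}

/-- An incomplete Toom graph without loose ends is a Toom graph. What has to be excluded is that the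
root lacks an outgoing edge of the last charge, or a sink an incoming edge of another charge, since
these are not loose ends. For `s ≠ ⊤`, comparing the starting points and endpoints of the edges of
charge `s` shows that the number of sources is the number of sinks with an incoming edge of charge
`s`; for the last charge, it shows that the number of sinks is the number of sources with an
outgoing edge of charge `⊤`. Hence there are as many sources as sinks, and nothing is missing. -/
theorem IsIncomplete.isToomGraph (hσ : 2 ≤ σ) (hG : G.IsIncomplete)
    (hc : ∀ v s, ¬ G.LooseEnd v s) : G.IsToomGraph := by
  by_cases hT : G.IsTrivial
  · exact hT.isToomGraph
  obtain ⟨g1, g2, g3⟩ := hG.grown.resolve_left hT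
  have hout1 (s : Fin σ) (hs : s ≠ ⊤) (v) (hv : (v ∈ G.src ∧ v ∉ G.snk) ∨ v ∈ G.internal s) :
      G.outDeg s v ≠ 0 := fun h => hc v s (.inl ⟨hs, hv, h⟩)
  have hin1 (v) (hv : (v ∈ G.snk ∧ v ∉ G.src) ∨ v ∈ G.internal ⊤) : G.inDeg ⊤ v ≠ 0 :=
    fun h => hc v ⊤ (.inr ⟨rfl, hv, h⟩)
  have hdisj (v) (h : v ∈ G.src) : v ∉ G.snk := fun h' => by
    obtain ⟨s, _, h1⟩ := g3 v h'
    have := (hG.source v h s).1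
    omega
  have hsrc (v) (hv : v ∈ G.src) (s : Fin σ) (hs : s ≠ ⊤) : G.outDeg s v = 1 := by
    have := (hG.source v hv s).2
    have := hout1 s hs v (.inl ⟨hv, hdisj v hv⟩)
    omega
  have hsnk (v) (hv : v ∈ G.snk) : G.inDeg ⊤ v = 1 := by
    have := (hG.sink v hv ⊤).2
    have := hin1 v (.inl ⟨hv, fun h => hdisj v h hv⟩)
    omega
  have : Nontrivial (Fin σ) := Fin.nontrivial_iff_two_le.2 hσ
  obtain ⟨s₀, hs₀⟩ := exists_ne (⊤ : Fin σ)
  have hint (s v) (hv : v ∈ G.internal s) : G.inDeg s v = 1 ∧ G.outDeg s v = 1 := by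
    obtain ⟨h1, h2, h3⟩ := hG.inner s v hv
    by_cases hs : s = ⊤
    · subst hs
      have hns : v ∉ G.src := fun h => by
        have := hsrc v h s₀ hs₀
        have := (h3 s₀ hs₀).2
        omega
      have h0 : v ≠ 0 := fun h => hns (h ▸ hG.root)
      have := hin1 v (.inr hv)
      exact ⟨by omega, g1 v (.inl hv) h0⟩
    · have := hout1 s hs v (.inr hv)
      exact ⟨g2 s hs v hv, by omega⟩
  have hsi (s v) (hv : v ∈ G.internal s) : v ∉ G.src := fun h => by
    have := (hG.source v h s).1
    have := (hint s v hv).1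
    omega
  have hki (s v) (hv : v ∈ G.internal s) : v ∉ G.snk := fun h => by
    have := (hG.sink v h s).1
    have := (hint s v hv).2
    omega
  -- Balance of in- and outgoing edges at each vertex, first for charges `s ≠ ⊤`, then for `⊤`.
  have hbal (s : Fin σ) (hs : s ≠ ⊤) (v) : G.outDeg s v + (if v ∈ G.snk then G.inDeg s v else 0) =
      G.inDeg s v + if v ∈ G.src then 1 else 0 := by
    rcases hG.typed v with h | h | ⟨l, h⟩
    · simp [h, hdisj v h, hsrc v h s hs, (hG.source v h s).1]
    · simp [h, show v ∉ G.src from fun h' => hdisj v h' h, (hG.sink v h s).1]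
    · simp only [hsi l v h, hki l v h, if_false]
      by_cases e : s = l
      · subst e
        have := hint s v h
        omega
      · have := (hG.inner l v h).2.2 s e
        omega
  have hbal' (v) : G.outDeg ⊤ v + (if v ∈ G.snk then 1 else 0) =
      G.inDeg ⊤ v + if v ∈ G.src then G.outDeg ⊤ v else 0 := by
    rcases hG.typed v with h | h | ⟨l, h⟩
    · simp [h, hdisj v h, (hG.source v h ⊤).1]
    · simp [h, show v ∉ G.src from fun h' => hdisj v h' h, (hG.sink v h ⊤).1, hsnk v h]
    · simp only [hsi l v h, hki l v h, if_false]
      by_cases e : ⊤ = l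
      · subst e
        have := hint ⊤ v h
        omega
      · have := (hG.inner l v h).2.2 ⊤ e
        omega
  have hsum (s : Fin σ) (hs : s ≠ ⊤) : ∑ v ∈ G.snk, G.inDeg s v = G.src.card := by
    have := Finset.sum_congr (rfl : (Finset.univ : Finset (Fin (N + 1))) = _)
      fun v _ => hbal s hs v
    simp only [Finset.sum_add_distrib, sum_outDeg, sum_inDeg, Finset.sum_ite_mem,
      Finset.univ_inter, Finset.sum_const, smul_eq_mul, mul_one] at this
    omega
  have hsum' : G.snk.card = ∑ v ∈ G.src, G.outDeg ⊤ v := by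
    have := Finset.sum_congr (rfl : (Finset.univ : Finset (Fin (N + 1))) = _)
      fun v _ => hbal' v
    simp only [Finset.sum_add_distrib, sum_outDeg, sum_inDeg, Finset.sum_ite_mem,
      Finset.univ_inter, Finset.sum_const, smul_eq_mul, mul_one] at this
    omega
  -- `#src ≤ #snk` by `hsum` and `#snk ≤ #src` by `hsum'`, so all these bounds are equalities.
  have hle (s) : ∑ v ∈ G.snk, G.inDeg s v ≤ ∑ v ∈ G.snk, 1 :=
    Finset.sum_le_sum fun v hv => (hG.sink v hv s).2
  have hle' : ∑ v ∈ G.src, G.outDeg ⊤ v ≤ ∑ v ∈ G.src, 1 :=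
    Finset.sum_le_sum fun v hv => (hG.source v hv ⊤).2
  have hone : ∑ v ∈ G.snk, 1 = G.snk.card := by simp
  have hone' : ∑ v ∈ G.src, 1 = G.src.card := by simp
  have hsnk' (s v) (hv : v ∈ G.snk) : G.inDeg s v = 1 := by
    by_cases hs : s = ⊤
    · exact hs ▸ hsnk v hv
    · have h1 := hle s₀
      rw [hsum s₀ hs₀] at h1
      refine (Finset.sum_eq_sum_iff_of_le fun v hv => (hG.sink v hv s).2).1 ?_ v hv
      rw [hsum s hs]
      omega
  have hsrc' (s v) (hv : v ∈ G.src) : G.outDeg s v = 1 := by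
    by_cases hs : s = ⊤
    · subst hs
      have h1 := hle s₀
      rw [hsum s₀ hs₀] at h1
      refine (Finset.sum_eq_sum_iff_of_le fun v hv => (hG.source v hv ⊤).2).1 ?_ v hv
      omega
    · exact hsrc v hv s hs
  refine ⟨hG.typed, fun v hv s => ⟨(hG.source v hv s).1, ?_⟩, fun v hv s =>
    ⟨(hG.sink v hv s).1, ?_⟩, fun s v hv =>
    ⟨(hint s v hv).1, (hint s v hv).2, (hG.inner s v hv).2.2⟩⟩
  · rw [hsrc' s v hv, if_neg (hdisj v hv)]
  · rw [hsnk' s v hv, if_neg fun h => hdisj v h hv]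

end Complete

end TypedDigraph

namespace DecGraph

variable {Λ : Type u} [Group Λ] {σ m : ℕ} {A : Fin σ → Fin m → Finset Λ} {D : DecGraph Λ σ m}

theorem IsIncContour.isContour [NeZero σ] (hσ : 2 ≤ σ) (hD : D.IsIncContour A)
    (hc : D.Complete) : D.IsContour A :=
  ⟨hD.graph.isToomGraph hσ hc, hD.graph.conn, hD.root ▸ hD.graph.root, hD.emb, hD.dec, hD.origin⟩

/-- With a height function `h` for which all edges go up by one, the number of edges of a given
charge is the total height of the sinks minus that of the sources, since each internal vertex is
entered once and left once by its charge. -/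
theorem IsContour.card_edge (hD : D.IsContour A) (h : Λ → ℤ) (hh : ∀ i j, h (i * j) = h i + h j)
    (hA : ∀ s k, ∀ j ∈ A s k, h j = 1) (s : Fin σ) :
    ((D.G.edge s).card : ℤ) = ∑ v ∈ D.G.snk \ D.G.src, h (D.pos v) -
      ∑ v ∈ D.G.src \ D.G.snk, h (D.pos v) := by
  have hstep : ∀ e ∈ D.G.edge s, h (D.pos e.2) - h (D.pos e.1) = 1 := by
    rintro ⟨v, w⟩ he
    have hinv (i j : Λ) : h j - h i = h (i⁻¹ * j) := by
      have := hh i (i⁻¹ * j)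
      rw [mul_inv_cancel_left] at this
      omega
    rw [hinv]
    have hDelta (k) (j) (hj : j ∈ Delta A k) : h j = 1 := by
      simp only [Delta, Finset.mem_biUnion] at hj
      obtain ⟨s, _, hs⟩ := hj
      exact hA s k j hs
    by_cases hv : v = D.root
    · obtain ⟨k, _, hk⟩ := hD.dec.inner s (v, w) (Finset.mem_filter.2 ⟨he, .inr hv⟩)
      exact hA s k _ hk
    rcases hD.toom.edge_start he with hs | hs
    · obtain ⟨k, _, hk⟩ := hD.dec.source s (v, w) (Finset.mem_filter.2 ⟨he, hs.1, hv⟩)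
      exact hDelta k _ hk
    · obtain ⟨k, _, hk⟩ := hD.dec.inner s (v, w) (Finset.mem_filter.2 ⟨he, .inl hs⟩)
      exact hA s k _ hk
  have hin : ∑ e ∈ D.G.edge s, h (D.pos e.2) = ∑ v, D.G.inDeg s v * h (D.pos v) := by
    rw [← Finset.sum_fiberwise_of_maps_to (t := Finset.univ) (g := Prod.snd)
      fun _ _ => Finset.mem_univ _]
    refine Finset.sum_congr rfl fun v _ => ?_
    rw [Finset.sum_congr rfl fun e he => by rw [(Finset.mem_filter.1 he).2], Finset.sum_const,
      nsmul_eq_mul]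
    rfl
  have hout : ∑ e ∈ D.G.edge s, h (D.pos e.1) = ∑ v, D.G.outDeg s v * h (D.pos v) := by
    rw [← Finset.sum_fiberwise_of_maps_to (t := Finset.univ) (g := Prod.fst)
      fun _ _ => Finset.mem_univ _]
    refine Finset.sum_congr rfl fun v _ => ?_
    rw [Finset.sum_congr rfl fun e he => by rw [(Finset.mem_filter.1 he).2], Finset.sum_const,
      nsmul_eq_mul]
    rfl
  have hcard : ((D.G.edge s).card : ℤ) =
      ∑ e ∈ D.G.edge s, (h (D.pos e.2) - h (D.pos e.1)) := by
    rw [Finset.sum_congr rfl hstep]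
    simp
  -- Only sinks and sources contribute: internal vertices are entered and left equally often.
  have hbal (v) : (D.G.inDeg s v : ℤ) * h (D.pos v) - D.G.outDeg s v * h (D.pos v) =
      (if v ∈ D.G.snk \ D.G.src then h (D.pos v) else 0) -
        if v ∈ D.G.src \ D.G.snk then h (D.pos v) else 0 := by
    simp only [Finset.mem_sdiff]
    have hT := hD.toom
    rcases hT.typed v with hv | hv | ⟨l, hv⟩
    · by_cases hv' : v ∈ D.G.snk <;> simp [hv, hv', (hT.source v hv s).1, (hT.source v hv s).2]
    · by_cases hv' : v ∈ D.G.src <;> simp [hv, hv', (hT.sink v hv s).1, (hT.sink v hv s).2]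
    · simp only [hT.not_src_of_internal hv, hT.not_snk_of_internal hv, false_and, if_false]
      by_cases e : s = l
      · subst e
        simp [(hT.inner s v hv).1, (hT.inner s v hv).2.1]
      · simp [(hT.inner l v hv).2.2 s e]
  rw [hcard, Finset.sum_sub_distrib, hin, hout, ← Finset.sum_sub_distrib,
    Finset.sum_congr rfl fun v _ => hbal v, Finset.sum_sub_distrib]
  simp only [Finset.sum_ite_mem, Finset.univ_inter]

/-- Each source other than the root that is not a sink emits one edge of charge `s`. -/
theorem IsContour.card_edgeSrc (hD : D.IsContour A) (s : Fin σ) :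
    (D.G.edgeSrc D.root s).card = ((D.G.src \ D.G.snk).erase D.root).card := by
  refine Finset.card_bij (fun e _ => e.1) ?_ ?_ ?_
  · rintro e he
    obtain ⟨h1, h2, h3⟩ := Finset.mem_filter.1 he
    refine Finset.mem_erase.2 ⟨h3, Finset.mem_sdiff.2 ⟨h2, ?_⟩⟩
    rcases hD.toom.edge_start h1 with h | h
    · exact h.2
    · exact hD.toom.not_snk_of_internal h
  · rintro ⟨a, b⟩ h ⟨c, d⟩ h' rfl
    rw [hD.toom.edge_right_unique (Finset.mem_filter.1 h).1 (Finset.mem_filter.1 h').1]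
  · intro v hv
    obtain ⟨h1, h2⟩ := Finset.mem_erase.1 hv
    obtain ⟨w, hw⟩ := hD.toom.exists_edge_from (s := s) (.inl (Finset.mem_sdiff.1 h2))
    exact ⟨(v, w), Finset.mem_filter.2 ⟨hw, (Finset.mem_sdiff.1 h2).1, h1⟩, rfl⟩

theorem IsContour.disjoint_edgeSrc_edgeInt (hD : D.IsContour A) (s : Fin σ) :
    Disjoint (D.G.edgeSrc D.root s) (D.G.edgeInt D.root s) := by
  refine Finset.disjoint_filter.2 fun e _ h h' => ?_
  rcases h' with h' | h'
  · exact hD.toom.not_src_of_internal h' h.1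
  · exact h.2 h'

theorem IsContour.edgeSrc_union_edgeInt (hD : D.IsContour A) (s : Fin σ) :
    D.G.edgeSrc D.root s ∪ D.G.edgeInt D.root s = D.G.edge s := by
  rw [TypedDigraph.edgeSrc, TypedDigraph.edgeInt, ← Finset.filter_or, Finset.filter_true_of_mem]
  intro e he
  rcases hD.toom.edge_start he with h | h
  · by_cases h' : e.1 = D.root
    · exact .inr (.inr h')
    · exact .inl ⟨h.1, h'⟩
  · exact .inr (.inl h)

theorem IsContour.card_edgeSrc_add_card_edgeInt (hD : D.IsContour A) (s : Fin σ) :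
    (D.G.edgeSrc D.root s).card + (D.G.edgeInt D.root s).card = (D.G.edge s).card := by
  rw [← Finset.card_union_of_disjoint (hD.disjoint_edgeSrc_edgeInt s), hD.edgeSrc_union_edgeInt]

end DecGraph

/-! ### Adding vertices and edges -/

namespace TypedDigraph

section Extend

variable {V : Type*} {σ : ℕ}

/-- The vertex `v` has the type `t`. -/
def HasType (G : TypedDigraph V σ) (v : V) : VType σ → Prop
  | .source => v ∈ G.src
  | .sink => v ∈ G.snk
  | .internal s => v ∈ G.internal s

/-- There is an edge of charge `s` between `v` and `w`, oriented as in `TypedDigraph.attach`. -/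
def Link [NeZero σ] (G : TypedDigraph V σ) (s : Fin σ) (v w : V) : Prop :=
  (if s = ⊤ then (w, v) else (v, w)) ∈ G.edge s

theorem mem_attach_edge [DecidableEq V] [NeZero σ] {G : TypedDigraph V σ} {s l : Fin σ} {v w : V}
    {e : V × V} : e ∈ (G.attach s v w).edge l ↔
      e ∈ G.edge l ∨ (l = s ∧ e = if s = ⊤ then (w, v) else (v, w)) := by
  by_cases h : l = s
  · subst h
    simp [attach, or_comm]
  · simp [attach, h]

theorem link_attach [DecidableEq V] [NeZero σ] (G : TypedDigraph V σ) (s : Fin σ) (v w : V) :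
    (G.attach s v w).Link s v w :=
  mem_attach_edge.2 (.inr ⟨rfl, rfl⟩)

theorem hasType_attach [DecidableEq V] [NeZero σ] {G : TypedDigraph V σ} {s : Fin σ} {v w a : V}
    {t : VType σ} : (G.attach s v w).HasType a t ↔ G.HasType a t := by
  cases t <;> rfl

variable {n : ℕ} {G : TypedDigraph (Fin n) σ} {t t' : VType σ}

theorem hasType_addVertex_castSucc {v : Fin n} :
    (G.addVertex t).HasType v.castSucc t' ↔ G.HasType v t' := by
  have hne : v.castSucc ≠ Fin.last n := (Fin.castSucc_lt_last v).ne
  cases t' <;> cases t <;> simp [HasType, addVertex, hne]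
  split_ifs <;> simp [hne]

theorem hasType_addVertex_last :
    (G.addVertex t).HasType (Fin.last n) t' ↔ t = t' := by
  have hne (v : Fin n) : v.castSucc ≠ Fin.last n := (Fin.castSucc_lt_last v).ne
  cases t' <;> cases t <;> simp [HasType, addVertex, hne]
  split_ifs with h <;> simp [h]

theorem mem_addVertex_edge {s : Fin σ} {e : Fin (n + 1) × Fin (n + 1)} :
    e ∈ (G.addVertex t).edge s ↔ ∃ a b, (a, b) ∈ G.edge s ∧ e = (a.castSucc, b.castSucc) := by
  simp only [addVertex, Finset.mem_map, Prod.exists]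
  constructor
  · rintro ⟨a, b, h, rfl⟩
    exact ⟨a, b, h, rfl⟩
  · rintro ⟨a, b, h, rfl⟩
    exact ⟨a, b, h, rfl⟩

theorem castSucc_mem_addVertex_edge {s : Fin σ} {a b : Fin n} :
    (a.castSucc, b.castSucc) ∈ (G.addVertex t).edge s ↔ (a, b) ∈ G.edge s := by
  rw [mem_addVertex_edge]
  constructor
  · rintro ⟨c, d, h, e⟩
    simp only [Prod.mk.injEq, Fin.castSucc_inj] at e
    exact e.1 ▸ e.2 ▸ h
  · exact fun h => ⟨a, b, h, rfl⟩

end Extend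

section Urgent

variable {σ N : ℕ} [NeZero σ] {G : TypedDigraph (Fin (N + 1)) σ} {s l : Fin σ} {v w : Fin (N + 1)}

theorem MostUrgent.unique (h : G.MostUrgent v s) (h' : G.MostUrgent w l) : v = w ∧ s = l := by
  have h1 := h.2 w l h'.1
  have h2 := h'.2 v s h.1
  rcases h1 with h1 | ⟨rfl, h1⟩
  · rcases h2 with h2 | ⟨rfl, h2⟩
    · exact absurd h1 h2.not_gt
    · exact absurd h1 (lt_irrefl _)
  · rcases h2 with h2 | ⟨_, h2⟩
    · exact absurd h2 (lt_irrefl _)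
    · exact ⟨le_antisymm h1 h2, rfl⟩

theorem LooseEnd.exists_mostUrgent (h : G.LooseEnd v s) : ∃ w l, G.MostUrgent w l := by
  obtain ⟨l, ⟨x, hx⟩, hl⟩ := wellFounded_lt.has_min {l | ∃ x, G.LooseEnd x l} ⟨s, v, h⟩
  obtain ⟨w, hw, hw'⟩ := wellFounded_lt.has_min {x | G.LooseEnd x l} ⟨x, hx⟩
  refine ⟨w, l, hw, fun y l' hy => ?_⟩
  rcases lt_trichotomy l l' with h' | rfl | h'
  · exact .inl h'
  · exact .inr ⟨rfl, not_lt.1 (hw' y hy)⟩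
  · exact absurd h' (hl l' ⟨y, hy⟩)

/-- At a loose end the edge that would be added is not there yet. -/
theorem LooseEnd.not_link (h : G.LooseEnd v s) (w : Fin (N + 1)) : ¬ G.Link s v w := by
  rw [Link]
  rcases h with ⟨hs, _, h⟩ | ⟨rfl, _, h⟩
  · rw [if_neg hs]
    exact outDeg_eq_zero_iff.1 h w
  · rw [if_pos rfl]
    exact inDeg_eq_zero_iff.1 h w

theorem sum_card_attach_edge {V : Type*} [DecidableEq V] {G : TypedDigraph V σ} {v w : V}
    (h : ¬ G.Link s v w) :
    ∑ l, ((G.attach s v w).edge l).card = ∑ l, (G.edge l).card + 1 := by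
  rw [← Finset.add_sum_erase _ _ (Finset.mem_univ s),
    ← Finset.add_sum_erase _ (fun l => (G.edge l).card) (Finset.mem_univ s)]
  have h1 : ((G.attach s v w).edge s).card = (G.edge s).card + 1 := by
    rw [← Finset.card_insert_of_notMem h]
    simp [attach]
  have h2 : ∑ l ∈ Finset.univ.erase s, ((G.attach s v w).edge l).card =
      ∑ l ∈ Finset.univ.erase s, (G.edge l).card :=
    Finset.sum_congr rfl fun l hl => by
      simp [attach, Function.update_of_ne (Finset.mem_erase.1 hl).1]
  rw [h1, h2]
  omega

theorem Connected.attach {V : Type*} [DecidableEq V] {G : TypedDigraph V σ} (h : G.Connected)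
    (s : Fin σ) (v w : V) : (G.attach s v w).Connected := by
  refine h.mono fun a b hab => ?_
  rw [SimpleGraph.fromRel_adj] at hab ⊢
  refine ⟨hab.1, hab.2.imp ?_ ?_⟩ <;>
  exact fun ⟨l, hl⟩ => ⟨l, mem_attach_edge.2 (.inl hl)⟩

theorem Connected.addVertex_attach {n : ℕ} {G : TypedDigraph (Fin n) σ} (h : G.Connected)
    (t : VType σ) (s : Fin σ) (v : Fin n) :
    ((G.addVertex t).attach s v.castSucc (Fin.last n)).Connected := by
  have hadj : (SimpleGraph.fromRel fun a b => ∃ l, (a, b) ∈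
      ((G.addVertex t).attach s v.castSucc (Fin.last n)).edge l).Adj v.castSucc (Fin.last n) := by
    rw [SimpleGraph.fromRel_adj]
    refine ⟨(Fin.castSucc_lt_last v).ne, ?_⟩
    by_cases hs : s = ⊤
    · exact .inr ⟨s, mem_attach_edge.2 (.inr ⟨rfl, by rw [if_pos hs]⟩)⟩
    · exact .inl ⟨s, mem_attach_edge.2 (.inr ⟨rfl, by rw [if_neg hs]⟩)⟩
  let f : (SimpleGraph.fromRel fun a b => ∃ l, (a, b) ∈ G.edge l) →g
      (SimpleGraph.fromRel fun a b => ∃ l, (a, b) ∈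
        ((G.addVertex t).attach s v.castSucc (Fin.last n)).edge l) :=
    { toFun := Fin.castSucc
      map_rel' := fun {a b} hab => by
        rw [SimpleGraph.fromRel_adj] at hab ⊢
        refine ⟨fun h => hab.1 (Fin.castSucc_injective _ h), hab.2.imp ?_ ?_⟩ <;>
        exact fun ⟨l, hl⟩ =>
          ⟨l, mem_attach_edge.2 (.inl (castSucc_mem_addVertex_edge.2 hl))⟩ }
  have hreach (a : Fin (n + 1)) : (SimpleGraph.fromRel fun a b => ∃ l, (a, b) ∈
      ((G.addVertex t).attach s v.castSucc (Fin.last n)).edge l).Reachable v.castSucc a := by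
    induction a using Fin.lastCases with
    | last => exact hadj.reachable
    | cast a => exact (h.preconnected v a).map f
  exact ⟨fun a b => (hreach a).symm.trans (hreach b)⟩

end Urgent

/-! ### Parts of a graph -/

/-- `H` is identified through `φ` with a part of `G`: the vertices of `H` have the same types as
their images, but some of the edges between them may be missing. -/
structure IsPart {V W : Type*} {σ : ℕ} (H : TypedDigraph W σ) (G : TypedDigraph V σ) (φ : W → V) :
    Prop where
  inj : Function.Injective φ
  type : ∀ v t, H.HasType v t ↔ G.HasType (φ v) t
  edge : ∀ s v w, (v, w) ∈ H.edge s → (φ v, φ w) ∈ G.edge s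

namespace IsPart

variable {V W : Type*} {σ : ℕ} {H : TypedDigraph W σ} {G : TypedDigraph V σ} {φ : W → V}

theorem src (h : H.IsPart G φ) {v : W} : v ∈ H.src ↔ φ v ∈ G.src := h.type v .source

theorem snk (h : H.IsPart G φ) {v : W} : v ∈ H.snk ↔ φ v ∈ G.snk := h.type v .sink

theorem internal (h : H.IsPart G φ) {v : W} {s : Fin σ} : v ∈ H.internal s ↔ φ v ∈ G.internal s :=
  h.type v (.internal s)

theorem link [NeZero σ] (h : H.IsPart G φ) {v w : W} {s : Fin σ} (hl : H.Link s v w) :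
    G.Link s (φ v) (φ w) := by
  unfold Link at hl ⊢
  split_ifs at hl ⊢ <;> exact h.edge _ _ _ hl

theorem of_attach [DecidableEq W] [NeZero σ] {s : Fin σ} {v w : W}
    (h : (H.attach s v w).IsPart G φ) : H.IsPart G φ :=
  ⟨h.inj, fun a t => hasType_attach.symm.trans (h.type a t),
    fun l a b hab => h.edge l a b (mem_attach_edge.2 (.inl hab))⟩

theorem attach [DecidableEq W] [NeZero σ] {s : Fin σ} {v w : W} (h : H.IsPart G φ)
    (hl : G.Link s (φ v) (φ w)) : (H.attach s v w).IsPart G φ := by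
  refine ⟨h.inj, fun a t => hasType_attach.trans (h.type a t), fun l a b hab => ?_⟩
  rcases mem_attach_edge.1 hab with hab | ⟨rfl, hab⟩
  · exact h.edge l a b hab
  · unfold Link at hl
    split_ifs at hl hab <;> cases hab <;> exact hl

theorem of_addVertex {n : ℕ} {H : TypedDigraph (Fin n) σ} {φ : Fin (n + 1) → V} {t : VType σ}
    (h : (H.addVertex t).IsPart G φ) : H.IsPart G (φ ∘ Fin.castSucc) :=
  ⟨h.inj.comp (Fin.castSucc_injective _),
    fun _ t' => hasType_addVertex_castSucc.symm.trans (h.type _ t'),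
    fun l _ _ hab => h.edge l _ _ (castSucc_mem_addVertex_edge.2 hab)⟩

theorem addVertex {n : ℕ} {H : TypedDigraph (Fin n) σ} {φ : Fin n → V} {t : VType σ} {w : V}
    (h : H.IsPart G φ) (hw : w ∉ Set.range φ) (ht : ∀ t', t = t' ↔ G.HasType w t') :
    (H.addVertex t).IsPart G (Fin.snoc (α := fun _ => V) φ w) := by
  refine ⟨?_, fun a t' => ?_, fun l a b hab => ?_⟩
  · rw [Fin.snoc_injective_iff]
    exact ⟨h.inj, hw⟩
  · induction a using Fin.lastCases with
    | last => rw [hasType_addVertex_last, Fin.snoc_last, ht]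
    | cast a => rw [hasType_addVertex_castSucc, Fin.snoc_castSucc, h.type]
  · obtain ⟨_, _, hab', e⟩ := mem_addVertex_edge.1 hab
    cases e
    rw [Fin.snoc_castSucc, Fin.snoc_castSucc]
    exact h.edge l _ _ hab'

end IsPart

end TypedDigraph

/-! ### Exploration at the most urgent loose end -/

namespace TypedDigraph

section Toom

variable {V : Type*} [DecidableEq V] {σ : ℕ} {G : TypedDigraph V σ} {s : Fin σ} {v w w' : V}

/-- In a Toom graph only isolated vertices have more than one type. -/
theorem IsToomGraph.hasType_unique (hG : G.IsToomGraph) (hv : ¬ (v ∈ G.src ∧ v ∈ G.snk))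
    {t t' : VType σ} (h : G.HasType v t) (h' : G.HasType v t') : t = t' := by
  cases t <;> cases t' <;> simp only [HasType] at h h'
  · rfl
  · exact absurd ⟨h, h'⟩ hv
  · exact absurd h (hG.not_src_of_internal h')
  · exact absurd ⟨h', h⟩ hv
  · rfl
  · exact absurd h (hG.not_snk_of_internal h')
  · exact absurd h' (hG.not_src_of_internal h)
  · exact absurd h' (hG.not_snk_of_internal h)
  · rw [hG.internal_inj h h']

variable [NeZero σ]

/-- At each vertex there is at most one edge for each charge in the direction of the exploration. -/
theorem IsToomGraph.link_unique (hG : G.IsToomGraph) (h : G.Link s v w) (h' : G.Link s v w') :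
    w = w' := by
  unfold Link at h h'
  split_ifs at h h'
  · exact hG.edge_left_unique h h'
  · exact hG.edge_right_unique h h'

/-- The type of the vertex that the search finds at the other end of an edge of charge `s`. -/
theorem IsToomGraph.link_type (hG : G.IsToomGraph) (h : G.Link s v w) :
    (s = ⊤ ∧ ((w ∈ G.src ∧ w ∉ G.snk) ∨ w ∈ G.internal ⊤)) ∨
      (s ≠ ⊤ ∧ ((w ∈ G.snk ∧ w ∉ G.src) ∨ w ∈ G.internal s)) := by
  unfold Link at h
  split_ifs at h with hs
  · subst hs
    exact .inl ⟨rfl, hG.edge_start h⟩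
  · exact .inr ⟨hs, hG.edge_end h⟩

theorem IsToomGraph.link_not_both (hG : G.IsToomGraph) (h : G.Link s v w) :
    ¬ (w ∈ G.src ∧ w ∈ G.snk) := by
  rintro ⟨h1, h2⟩
  rcases hG.link_type h with ⟨_, h | h⟩ | ⟨_, h | h⟩
  · exact h.2 h2
  · exact hG.not_src_of_internal h h1
  · exact h.2 h1
  · exact hG.not_src_of_internal h h1

/-- At a loose end of a part of a Toom graph, the missing edge can be found in the Toom graph. -/
theorem IsPart.exists_link {N : ℕ} {H : TypedDigraph (Fin (N + 1)) σ} {φ : Fin (N + 1) → V}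
    (h : H.IsPart G φ) (hG : G.IsToomGraph) {v : Fin (N + 1)} (hv : H.LooseEnd v s) :
    ∃ w, G.Link s (φ v) w := by
  unfold Link
  rcases hv with ⟨hs, hv, _⟩ | ⟨rfl, hv, _⟩
  · simp only [if_neg hs]
    rw [h.src, h.snk, h.internal] at hv
    exact hG.exists_edge_from hv
  · simp only [if_true]
    rw [h.src, h.snk, h.internal] at hv
    exact hG.exists_edge_to hv

/-- The part of the definition of incomplete Toom graphs that concerns the edges by which the
vertices were found. -/
def Grown {N : ℕ} (H : TypedDigraph (Fin (N + 1)) σ) : Prop :=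
  (∀ v, (v ∈ H.internal ⊤ ∨ v ∈ H.src) → v ≠ 0 → ∃ w, (v, w) ∈ H.edge ⊤) ∧
    (∀ s, s ≠ ⊤ → ∀ v ∈ H.internal s, ∃ w, (w, v) ∈ H.edge s) ∧
    (∀ v ∈ H.snk, ∃ s, s ≠ ⊤ ∧ ∃ w, (w, v) ∈ H.edge s)

theorem Grown.attach {N : ℕ} {H : TypedDigraph (Fin (N + 1)) σ} (h : H.Grown) (s : Fin σ)
    (v w : Fin (N + 1)) : (H.attach s v w).Grown := by
  have hmono {l e} (he : e ∈ H.edge l) : e ∈ (H.attach s v w).edge l :=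
    mem_attach_edge.2 (.inl he)
  exact ⟨fun a ha h0 => (h.1 a ha h0).imp fun _ => hmono,
    fun l hl a ha => (h.2.1 l hl a ha).imp fun _ => hmono,
    fun a ha => (h.2.2 a ha).imp fun _ => And.imp_right (Exists.imp fun _ => hmono)⟩

theorem Grown.addVertex_attach {N : ℕ} {H : TypedDigraph (Fin (N + 1)) σ} (h : H.Grown) {s : Fin σ}
    {v : Fin (N + 1)} {t : VType σ}
    (ht : (s = ⊤ ∧ (t = .source ∨ t = .internal ⊤)) ∨ (s ≠ ⊤ ∧ (t = .sink ∨ t = .internal s))) :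
    ((H.addVertex t).attach s v.castSucc (Fin.last (N + 1))).Grown := by
  have hmono {l a b} (he : (a, b) ∈ H.edge l) : (a.castSucc, b.castSucc) ∈
      ((H.addVertex t).attach s v.castSucc (Fin.last (N + 1))).edge l :=
    mem_attach_edge.2 (.inl (castSucc_mem_addVertex_edge.2 he))
  have hnew : (if s = ⊤ then (Fin.last (N + 1), v.castSucc) else (v.castSucc, Fin.last (N + 1))) ∈
      ((H.addVertex t).attach s v.castSucc (Fin.last (N + 1))).edge s :=
    mem_attach_edge.2 (.inr ⟨rfl, rfl⟩)
  have hold {a t'} : ((H.addVertex t).attach s v.castSucc (Fin.last (N + 1))).HasType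
      (Fin.castSucc a) t' ↔ H.HasType a t' :=
    hasType_attach.trans hasType_addVertex_castSucc
  have hlast {t'} : ((H.addVertex t).attach s v.castSucc (Fin.last (N + 1))).HasType
      (Fin.last (N + 1)) t' ↔ t = t' :=
    hasType_attach.trans hasType_addVertex_last
  refine ⟨fun a ha h0 => ?_, fun l hl a ha => ?_, fun a ha => ?_⟩
  · induction a using Fin.lastCases with
    | last =>
      have ha : t = .internal ⊤ ∨ t = .source :=
        ha.imp (hlast (t' := .internal ⊤)).1 (hlast (t' := .source)).1
      rcases ht with ⟨rfl, _⟩ | ⟨hs, ht⟩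
      · rw [if_pos rfl] at hnew
        exact ⟨_, hnew⟩
      · rcases ha with rfl | rfl
        · simp only [reduceCtorEq, VType.internal.injEq, false_or] at ht
          exact absurd ht.symm hs
        · simp at ht
    | cast a =>
      have ha : a ∈ H.internal ⊤ ∨ a ∈ H.src :=
        ha.imp (hold (t' := .internal ⊤)).1 (hold (t' := .source)).1
      obtain ⟨b, hb⟩ := h.1 a ha (fun e => h0 (by rw [e]; rfl))
      exact ⟨_, hmono hb⟩
  · induction a using Fin.lastCases with
    | last =>
      have ha : t = .internal l := (hlast (t' := .internal l)).1 ha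
      subst ha
      simp only [reduceCtorEq, VType.internal.injEq, false_or] at ht
      rcases ht with ⟨_, e⟩ | ⟨hs, rfl⟩
      · exact absurd e hl
      · rw [if_neg hs] at hnew
        exact ⟨_, hnew⟩
    | cast a =>
      obtain ⟨b, hb⟩ := h.2.1 l hl a ((hold (t' := .internal l)).1 ha)
      exact ⟨_, hmono hb⟩
  · induction a using Fin.lastCases with
    | last =>
      have ha : t = .sink := (hlast (t' := .sink)).1 ha
      subst ha
      simp only [reduceCtorEq, false_or, and_false, true_or, and_true] at ht
      rw [if_neg ht] at hnew
      exact ⟨s, ht, _, hnew⟩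
    | cast a =>
      obtain ⟨l, hl, b, hb⟩ := h.2.2 a ((hold (t' := .sink)).1 ha)
      exact ⟨l, hl, _, hmono hb⟩

/-- A connected part of a Toom graph is an incomplete Toom graph if its vertices come with the edges
by which they were found. -/
theorem IsPart.isIncomplete {N : ℕ} {H : TypedDigraph (Fin (N + 1)) σ} {φ : Fin (N + 1) → V}
    (h : H.IsPart G φ) (hG : G.IsToomGraph) (h0 : φ 0 ∈ G.src) (hc : H.Connected)
    (hg : H.Grown) : H.IsIncomplete := by
  have hout1 (l a) : H.outDeg l a ≤ 1 := outDeg_le_one_iff.2 fun b c hb hc =>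
    h.inj (hG.edge_right_unique (h.edge _ _ _ hb) (h.edge _ _ _ hc))
  have hin1 (l a) : H.inDeg l a ≤ 1 := inDeg_le_one_iff.2 fun b c hb hc =>
    h.inj (hG.edge_left_unique (h.edge _ _ _ hb) (h.edge _ _ _ hc))
  have hout0 (l a) (h' : G.outDeg l (φ a) = 0) : H.outDeg l a = 0 :=
    outDeg_eq_zero_iff.2 fun b hb => outDeg_eq_zero_iff.1 h' _ (h.edge _ _ _ hb)
  have hin0 (l a) (h' : G.inDeg l (φ a) = 0) : H.inDeg l a = 0 :=
    inDeg_eq_zero_iff.2 fun b hb => inDeg_eq_zero_iff.1 h' _ (h.edge _ _ _ hb)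
  refine ⟨fun a => ?_, hc, h.src.2 h0,
    fun a ha l => ⟨hin0 _ _ (hG.source _ (h.src.1 ha) l).1, hout1 l a⟩,
    fun a ha l => ⟨hout0 _ _ (hG.sink _ (h.snk.1 ha) l).1, hin1 l a⟩,
    fun s a ha => ⟨hin1 s a, hout1 s a, fun l hl => ?_⟩, .inr ⟨fun a ha ha0 => ?_,
    fun l hl a ha => ?_, fun a ha => ?_⟩⟩
  · rw [h.src, h.snk]
    simp only [h.internal]
    exact hG.typed (φ a)
  · obtain ⟨h1, h2⟩ := (hG.inner s _ (h.internal.1 ha)).2.2 l hl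
    exact ⟨hin0 _ _ h1, hout0 _ _ h2⟩
  · exact le_antisymm (hout1 _ _) (outDeg_pos_iff.2 (hg.1 a ha ha0))
  · exact le_antisymm (hin1 _ _) (inDeg_pos_iff.2 (hg.2.1 l hl a ha))
  · obtain ⟨l, hl, hl'⟩ := hg.2.2 a ha
    exact ⟨l, hl, le_antisymm (hin1 _ _) (inDeg_pos_iff.2 hl')⟩

end Toom

end TypedDigraph

/-- A stage of the exploration of a graph with vertex set `V`: a graph `H` with vertex set
`{0, …, n}`, in which the vertices are numbered in the order in which they were found, and the map
`φ` that identifies them with vertices of the explored graph. -/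
structure Stage (V : Type*) (σ : ℕ) where
  n : ℕ
  H : TypedDigraph (Fin (n + 1)) σ
  φ : Fin (n + 1) → V

namespace TypedDigraph

variable {V : Type*} {σ : ℕ} [NeZero σ]

/-- `Explore G r k S`: the exploration of `G` that starts at the root `r` and successively finds the
edge at the most urgent loose end is at the stage `S` after `k` steps. -/
inductive Explore (G : TypedDigraph V σ) (r : V) : ℕ → Stage V σ → Prop
  | start : Explore G r 0 ⟨0, TypedDigraph.start σ, fun _ => r⟩
  | join {k n : ℕ} {H : TypedDigraph (Fin (n + 1)) σ} {φ : Fin (n + 1) → V} {v : Fin (n + 1)}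
      {s : Fin σ} (hS : Explore G r k ⟨n, H, φ⟩) (hv : H.MostUrgent v s) (w : Fin (n + 1))
      (hw : G.Link s (φ v) (φ w)) : Explore G r (k + 1) ⟨n, H.attach s v w, φ⟩
  | grow {k n : ℕ} {H : TypedDigraph (Fin (n + 1)) σ} {φ : Fin (n + 1) → V} {v : Fin (n + 1)}
      {s : Fin σ} (hS : Explore G r k ⟨n, H, φ⟩) (hv : H.MostUrgent v s) (w : V) (t : VType σ)
      (hw : G.Link s (φ v) w) (hr : w ∉ Set.range φ) (ht : G.HasType w t) :
      Explore G r (k + 1) ⟨n + 1, (H.addVertex t).attach s v.castSucc (Fin.last (n + 1)),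
        Fin.snoc (α := fun _ => V) φ w⟩

namespace Explore

variable {G : TypedDigraph V σ} {r : V} {k : ℕ} {S : Stage V σ}

theorem map_zero (h : Explore G r k S) : S.φ 0 = r := by
  induction h with
  | start => rfl
  | join _ _ _ _ ih => exact ih
  | grow _ _ w _ _ _ _ ih =>
    rw [← Fin.castSucc_zero]
    exact (Fin.snoc_castSucc (α := fun _ => V) w _ _).trans ih

theorem connected (h : Explore G r k S) : S.H.Connected := by
  induction h with
  | start =>
    rw [Connected, SimpleGraph.connected_iff]
    exact ⟨fun a b => by rw [Fin.fin_one_eq_zero a, Fin.fin_one_eq_zero b], inferInstance⟩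
  | join _ _ _ _ ih => exact ih.attach _ _ _
  | grow _ _ _ _ _ _ _ ih => exact ih.addVertex_attach _ _ _

theorem exists_pred {k' : ℕ} (h : Explore G r k S) (hk : k' ≤ k) : ∃ S', Explore G r k' S' := by
  induction h with
  | start =>
    obtain rfl : k' = 0 := by omega
    exact ⟨_, .start⟩
  | @join k _ _ _ _ _ hS hv w hw ih =>
    rcases Nat.lt_or_ge k k' with h | h
    · obtain rfl : k' = k + 1 := by omega
      exact ⟨_, .join hS hv w hw⟩
    · exact ih h
  | @grow k _ _ _ _ _ hS hv w t hw hR ht ih =>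
    rcases Nat.lt_or_ge k k' with h | h
    · obtain rfl : k' = k + 1 := by omega
      exact ⟨_, .grow hS hv w t hw hR ht⟩
    · exact ih h

theorem sum_card_edge (h : Explore G r k S) : ∑ s, (S.H.edge s).card = k := by
  induction h with
  | start => simp [TypedDigraph.start]
  | join _ hv w _ ih => rw [sum_card_attach_edge (hv.1.not_link w), ih]
  | grow _ hv w t _ _ _ ih =>
    rw [sum_card_attach_edge, ← ih]
    · simp [addVertex]
    · unfold Link
      split_ifs <;> intro h <;> obtain ⟨a, b, _, e⟩ := mem_addVertex_edge.1 h
      · exact (Fin.castSucc_lt_last a).ne (Prod.mk.inj e).1.symm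
      · exact (Fin.castSucc_lt_last b).ne (Prod.mk.inj e).2.symm

/-- The stages of the exploration of `G` are the constructible parts of `G` that contain the root.
-/
theorem of_constructible {N : ℕ} {H : TypedDigraph (Fin (N + 1)) σ} (hH : H.Constructible)
    {φ : Fin (N + 1) → V} (hp : H.IsPart G φ) (h0 : φ 0 = r) : ∃ k, Explore G r k ⟨N, H, φ⟩ := by
  induction hH with
  | start =>
    obtain rfl : φ = fun _ => r := funext fun v => by rw [Fin.fin_one_eq_zero v, h0]
    exact ⟨0, .start⟩
  | join _ hv w _ ih =>
    obtain ⟨k, hk⟩ := ih hp.of_attach h0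
    exact ⟨k + 1, .join hk hv w (hp.link (link_attach _ _ _ _))⟩
  | @grow N H v s _ hv t _ ih =>
    have hp' := hp.of_attach
    obtain ⟨k, hk⟩ := ih hp'.of_addVertex h0
    have hl := hp.link (link_attach _ _ _ _)
    have := Explore.grow hk hv (φ (Fin.last _)) t hl
      (by
        rintro ⟨a, ha⟩
        exact (Fin.castSucc_lt_last a).ne (hp.inj ha))
      ((hp'.type _ t).1 (hasType_addVertex_last.2 rfl))
    refine ⟨k + 1, ?_⟩
    convert this using 2
    exact (Fin.snoc_init_self (α := fun _ => V) φ).symm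

variable [DecidableEq V]

theorem isPart (h : Explore G r k S) (hG : G.IsToomGraph) (hr : r ∈ G.src) (hr' : r ∉ G.snk) :
    S.H.IsPart G S.φ := by
  induction h with
  | start =>
    refine ⟨fun a b _ => (Fin.fin_one_eq_zero a).trans (Fin.fin_one_eq_zero b).symm, fun v t => ?_,
      fun s v w h => absurd h (Finset.notMem_empty _)⟩
    have ht (t) : G.HasType r t ↔ VType.source = t :=
      ⟨fun h => hG.hasType_unique (fun h => hr' h.2) hr h, fun h => h ▸ hr⟩
    rw [ht]
    cases t <;> simp [HasType, TypedDigraph.start]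
    exact Fin.fin_one_eq_zero v
  | join _ _ _ hw ih => exact ih.attach hw
  | grow _ _ w t hw hr ht ih =>
    have := ih.addVertex hr (w := w) (t := t) fun t' => ⟨fun h => h ▸ ht,
      fun h => hG.hasType_unique (hG.link_not_both hw) ht h⟩
    refine this.attach ?_
    rwa [Fin.snoc_castSucc, Fin.snoc_last]

theorem grown (h : Explore G r k S) (hG : G.IsToomGraph) : S.H.Grown := by
  induction h with
  | start =>
    refine ⟨fun v _ h => absurd (Fin.fin_one_eq_zero v) h, fun _ _ v hv => ?_, fun v hv => ?_⟩ <;>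
    simp [TypedDigraph.start] at hv
  | join _ _ _ _ ih => exact ih.attach _ _ _
  | grow _ _ w t hw _ ht ih =>
    refine ih.addVertex_attach ?_
    have hu {t'} (h : G.HasType w t') : t = t' := hG.hasType_unique (hG.link_not_both hw) ht h
    rcases hG.link_type hw with ⟨hs, h⟩ | ⟨hs, h⟩
    · exact .inl ⟨hs, h.imp (fun h => hu (t' := .source) h.1) fun h => hu (t' := .internal ⊤) h⟩
    · exact .inr ⟨hs, h.imp (fun h => hu (t' := .sink) h.1) fun h => hu (t' := .internal _) h⟩

theorem isIncomplete (h : Explore G r k S) (hG : G.IsToomGraph) (hr : r ∈ G.src)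
    (hr' : r ∉ G.snk) : S.H.IsIncomplete :=
  (h.isPart hG hr hr').isIncomplete hG (h.map_zero.symm ▸ hr) h.connected (h.grown hG)

theorem constructible (h : Explore G r k S) (hG : G.IsToomGraph) (hr : r ∈ G.src)
    (hr' : r ∉ G.snk) : S.H.Constructible := by
  induction h with
  | start => exact .start
  | join hS hv w hw ih => exact .join ih hv w ((Explore.join hS hv w hw).isIncomplete hG hr hr')
  | grow hS hv w t hw hR ht ih =>
    exact .grow ih hv t ((Explore.grow hS hv w t hw hR ht).isIncomplete hG hr hr')

/-- The exploration is deterministic. -/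
theorem unique (hG : G.IsToomGraph) (hr : r ∈ G.src) (hr' : r ∉ G.snk) (h : Explore G r k S)
    {S' : Stage V σ} (h' : Explore G r k S') : S = S' := by
  induction h generalizing S' with
  | start =>
    cases h'
    rfl
  | join hS hv w hw ih =>
    cases h' with
    | join hS' hv' w' hw' =>
      cases ih hS'
      obtain ⟨rfl, rfl⟩ := hv.unique hv'
      rw [(hS.isPart hG hr hr').inj (hG.link_unique hw hw')]
    | grow hS' hv' w' t' hw' hR' ht' =>
      cases ih hS'
      obtain ⟨rfl, rfl⟩ := hv.unique hv'
      exact absurd ⟨w, hG.link_unique hw hw'⟩ hR'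
  | grow hS hv w t hw hR ht ih =>
    cases h' with
    | join hS' hv' w' hw' =>
      cases ih hS'
      obtain ⟨rfl, rfl⟩ := hv.unique hv'
      exact absurd ⟨w', hG.link_unique hw' hw⟩ hR
    | grow hS' hv' w' t' hw' hR' ht' =>
      cases ih hS'
      obtain ⟨rfl, rfl⟩ := hv.unique hv'
      obtain rfl := hG.link_unique hw hw'
      rw [hG.hasType_unique (hG.link_not_both hw) ht ht']

theorem exists_looseEnd (h : Explore G r (k + 1) S) {S' : Stage V σ} (h' : Explore G r k S')
    (hG : G.IsToomGraph) (hr : r ∈ G.src) (hr' : r ∉ G.snk) : ∃ v s, S'.H.MostUrgent v s := by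
  cases h with
  | join hS hv w hw =>
    cases h'.unique hG hr hr' hS
    exact ⟨_, _, hv⟩
  | grow hS hv w t hw hR ht =>
    cases h'.unique hG hr hr' hS
    exact ⟨_, _, hv⟩

/-- The exploration passes only once through a stage without loose ends. -/
theorem terminal_unique (hG : G.IsToomGraph) (hr : r ∈ G.src) (hr' : r ∉ G.snk)
    (h : Explore G r k S) (hc : ∀ v s, ¬ S.H.LooseEnd v s) {k' : ℕ} {S' : Stage V σ}
    (h' : Explore G r k' S') : k' ≤ k := by
  by_contra hk
  obtain ⟨S'', h''⟩ := h'.exists_pred (k' := k + 1) (by omega)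
  obtain ⟨v, s, hv⟩ := h''.exists_looseEnd h hG hr hr'
  exact hc v s hv.1

theorem exists_succ (h : Explore G r k S) (hG : G.IsToomGraph) (hr : r ∈ G.src) (hr' : r ∉ G.snk)
    {v : Fin (S.n + 1)} {s : Fin σ} (hv : S.H.LooseEnd v s) : ∃ S', Explore G r (k + 1) S' := by
  obtain ⟨v, s, hv⟩ := hv.exists_mostUrgent
  obtain ⟨w, hw⟩ := (h.isPart hG hr hr').exists_link hG hv.1
  by_cases hR : w ∈ Set.range S.φ
  · obtain ⟨w, rfl⟩ := hR
    exact ⟨_, .join h hv w hw⟩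
  · obtain ⟨t, ht⟩ : ∃ t, G.HasType w t := by
      rcases hG.typed w with h | h | ⟨l, h⟩
      · exact ⟨.source, h⟩
      · exact ⟨.sink, h⟩
      · exact ⟨.internal l, h⟩
    exact ⟨_, .grow h hv w t hw hR ht⟩

variable (G r) in
/-- The exploration ends, since each step finds a new edge. -/
theorem exists_terminal (hG : G.IsToomGraph) (hr : r ∈ G.src) (hr' : r ∉ G.snk) :
    ∃ k S, Explore G r k S ∧ ∀ v s, ¬ S.H.LooseEnd v s := by
  by_contra! hne
  have hall (k : ℕ) : ∃ S, Explore G r k S := by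
    induction k with
    | zero => exact ⟨_, .start⟩
    | succ k ih =>
      obtain ⟨S, hS⟩ := ih
      obtain ⟨v, s, hv⟩ := hne k S hS
      exact hS.exists_succ hG hr hr' hv
  obtain ⟨S, hS⟩ := hall (∑ s, (G.edge s).card + 1)
  have hp := hS.isPart hG hr hr'
  have hle : ∑ s, (S.H.edge s).card ≤ ∑ s, (G.edge s).card :=
    Finset.sum_le_sum fun s _ => Finset.card_le_card_of_injOn (Prod.map S.φ S.φ)
      (fun e he => hp.edge s _ _ he) (hp.inj.prodMap hp.inj).injOn
  rw [hS.sum_card_edge] at hle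
  omega

end Explore

end TypedDigraph

/-! ### The natural order -/

namespace TypedDigraph

section Map

variable {V W : Type*} {σ : ℕ} {G H : TypedDigraph V σ}

theorem ext_type_edge (ht : ∀ v t, G.HasType v t ↔ H.HasType v t)
    (he : ∀ s v w, (v, w) ∈ G.edge s ↔ (v, w) ∈ H.edge s) : G = H := by
  obtain ⟨a, b, c, d⟩ := G
  obtain ⟨a', b', c', d'⟩ := H
  rw [TypedDigraph.mk.injEq]
  exact ⟨Finset.ext fun v => ht v .source, Finset.ext fun v => ht v .sink,
    funext fun s => Finset.ext fun v => ht v (.internal s),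
    funext fun s => Finset.ext fun e => he s e.1 e.2⟩

theorem hasType_map {χ : V ≃ W} {v : W} {t : VType σ} :
    (G.map χ).HasType v t ↔ G.HasType (χ.symm v) t := by
  cases t <;> exact Finset.mem_map_equiv

theorem mem_map_edge {χ : V ≃ W} {s : Fin σ} {v w : W} :
    (v, w) ∈ (G.map χ).edge s ↔ (χ.symm v, χ.symm w) ∈ G.edge s :=
  Finset.mem_map_equiv

theorem isPart_map (χ : V ≃ W) : (G.map χ).IsPart G χ.symm :=
  ⟨χ.symm.injective, fun _ _ => hasType_map, fun _ _ _ => mem_map_edge.1⟩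

end Map

section Terminal

variable {V : Type*} [DecidableEq V] {σ : ℕ} {G : TypedDigraph V σ}

/-- If a part of a Toom graph is itself a Toom graph, then it contains all edges at its vertices. -/
theorem IsPart.exists_adj {W : Type*} [DecidableEq W] {H : TypedDigraph W σ} {φ : W → V}
    (hp : H.IsPart G φ) (hG : G.IsToomGraph) (hH : H.IsToomGraph) {s : Fin σ} {v : W} {b : V} :
    ((φ v, b) ∈ G.edge s → ∃ w, φ w = b ∧ (v, w) ∈ H.edge s) ∧
      ((b, φ v) ∈ G.edge s → ∃ w, φ w = b ∧ (w, v) ∈ H.edge s) := by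
  constructor <;> intro h
  · have := hG.edge_start h
    rw [← hp.src, ← hp.snk, ← hp.internal] at this
    obtain ⟨w, hw⟩ := hH.exists_edge_from this
    exact ⟨w, hG.edge_right_unique (hp.edge _ _ _ hw) h, hw⟩
  · have := hG.edge_end h
    rw [← hp.src, ← hp.snk, ← hp.internal] at this
    obtain ⟨w, hw⟩ := hH.exists_edge_to this
    exact ⟨w, hG.edge_left_unique (hp.edge _ _ _ hw) h, hw⟩

/-- A Toom graph that is part of a connected Toom graph is all of it. -/
theorem IsPart.surjective {W : Type*} [DecidableEq W] [Nonempty W] {H : TypedDigraph W σ}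
    {φ : W → V} (hp : H.IsPart G φ) (hG : G.IsToomGraph) (hH : H.IsToomGraph)
    (hc : G.Connected) : Function.Surjective φ := by
  have hwalk {a b : V} (p : (SimpleGraph.fromRel fun v w => ∃ s, (v, w) ∈ G.edge s).Walk a b)
      (ha : a ∈ Set.range φ) : b ∈ Set.range φ := by
    induction p with
    | nil => exact ha
    | cons h _ ih =>
      obtain ⟨v, rfl⟩ := ha
      refine ih ?_
      obtain ⟨_, ⟨s, hs⟩ | ⟨s, hs⟩⟩ := (SimpleGraph.fromRel_adj _ _ _).1 h
      · exact ((hp.exists_adj hG hH).1 hs).imp fun _ => And.left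
      · exact ((hp.exists_adj hG hH).2 hs).imp fun _ => And.left
  intro b
  obtain ⟨p⟩ := hc.preconnected (φ (Classical.arbitrary W)) b
  exact hwalk p ⟨_, rfl⟩

theorem IsPart.eq_map {W : Type*} [DecidableEq W] {H : TypedDigraph W σ} {χ : V ≃ W}
    (hp : H.IsPart G χ.symm) (hG : G.IsToomGraph) (hH : H.IsToomGraph) : G.map χ = H := by
  refine ext_type_edge (fun v t => hasType_map.trans (hp.type v t).symm) fun s v w => ?_
  rw [mem_map_edge]
  refine ⟨fun h => ?_, hp.edge s v w⟩
  obtain ⟨w', hw, h'⟩ := (hp.exists_adj hG hH).1 h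
  rwa [← χ.symm.injective hw]

theorem IsToomGraph.not_looseEnd_map [NeZero σ] {N : ℕ} (hG : G.IsToomGraph) (χ : V ≃ Fin (N + 1))
    (v : Fin (N + 1)) (s : Fin σ) : ¬ (G.map χ).LooseEnd v s := by
  intro h
  obtain ⟨w, hw⟩ := (isPart_map χ).exists_link hG h
  refine h.not_link (χ w) ?_
  unfold Link at hw ⊢
  split_ifs at hw ⊢ <;> rw [mem_map_edge, χ.symm_apply_apply] <;> exact hw

end Terminal

end TypedDigraph

namespace DecGraph

open TypedDigraph

variable {Λ : Type u} [Group Λ] {σ m : ℕ} {A : Fin σ → Fin m → Finset Λ}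
  {D : DecGraph Λ σ m}

/-- If the root is also a sink, it is isolated, so by connectedness there is no other vertex. -/
theorem IsContour.isTrivial_iff (hD : D.IsContour A) : D.G.IsTrivial ↔ D.root ∈ D.G.snk := by
  constructor
  · rintro ⟨h0, _, h, _⟩
    rw [h, Finset.mem_singleton]
    ext
    have := D.root.isLt
    simp only [Fin.val_zero]
    omega
  · intro h
    have hall (v : Fin (D.N + 1)) : v = D.root := by
      by_contra hv
      obtain ⟨p⟩ := hD.conn.preconnected D.root v
      cases p with
      | nil => exact hv rfl
      | cons h' p =>
        obtain ⟨_, ⟨s, hs⟩ | ⟨s, hs⟩⟩ := (SimpleGraph.fromRel_adj _ _ _).1 h'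
        · exact outDeg_eq_zero_iff.1 (hD.toom.sink _ h s).1 _ hs
        · exact inDeg_eq_zero_iff.1 (hD.toom.source _ hD.root s).1 _ hs
    have hN : D.N = 0 := by
      by_contra hN
      have h1 := (hall 0).trans (hall (Fin.last D.N)).symm
      have := congrArg Fin.val h1
      simp at this
      omega
    have h0 : D.root = 0 := (hall 0).symm
    refine ⟨hN, ?_, ?_, fun s => ?_, fun s => ?_⟩
    · rw [← h0]
      exact Finset.eq_singleton_iff_unique_mem.2 ⟨hD.root, fun v _ => hall v⟩
    · rw [← h0]
      exact Finset.eq_singleton_iff_unique_mem.2 ⟨h, fun v _ => hall v⟩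
    · refine Finset.eq_empty_of_forall_notMem fun v hv => ?_
      exact hD.toom.not_snk_of_internal hv (hall v ▸ h)
    · refine Finset.eq_empty_of_forall_notMem fun e he => ?_
      refine outDeg_eq_zero_iff.1 (hD.toom.sink _ h s).1 e.2 ?_
      rw [← hall e.1]
      exact he

variable [NeZero σ]

/-- In a nontrivial contour, the relabelled graph of a natural order is the final stage of the
exploration. -/
theorem IsContour.explore_of_isNatural (hD : D.IsContour A) (h : D.root ∉ D.G.snk)
    {η : Equiv.Perm (Fin (D.N + 1))} (hη : D.IsNatural η) :
    ∃ k, D.G.Explore D.root k ⟨D.N, D.G.map η, η.symm⟩ := by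
  obtain ⟨h0, hc⟩ := hη
  rw [hD.isTrivial_iff] at hc
  exact Explore.of_constructible (hc.resolve_left h) (isPart_map η)
    (by rw [← h0, η.symm_apply_apply])

theorem IsContour.existsUnique_isNatural (hσ : 2 ≤ σ) (hD : D.IsContour A) :
    ∃! η, D.IsNatural η := by
  by_cases hT : D.root ∈ D.G.snk
  · have hT := hD.isTrivial_iff.2 hT
    have hsub : Subsingleton (Fin (D.N + 1)) := by
      rw [hT.1]
      exact (inferInstance : Subsingleton (Fin 1))
    exact ⟨Equiv.refl _, ⟨Subsingleton.elim _ _, .inl hT⟩, fun η _ =>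
      Equiv.ext fun v => Subsingleton.elim _ _⟩
  refine existsUnique_of_exists_of_unique ?_ fun η η' hη hη' => ?_
  · obtain ⟨k, S, hS, hc⟩ := Explore.exists_terminal D.G D.root hD.toom hD.root hT
    have hp := hS.isPart hD.toom hD.root hT
    have hH := (hS.isIncomplete hD.toom hD.root hT).isToomGraph hσ hc
    have hbij : Function.Bijective S.φ := ⟨hp.inj, hp.surjective hD.toom hH hD.conn⟩
    obtain ⟨n, H, φ⟩ := S
    obtain rfl : n = D.N := by simpa using Fintype.card_of_bijective hbij
    let e := Equiv.ofBijective φ hbij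
    have hmap : D.G.map e.symm = H := IsPart.eq_map (χ := e.symm) hp hD.toom hH
    refine ⟨e.symm, ?_, .inr ?_⟩
    · rw [Equiv.symm_apply_eq]
      exact hS.map_zero.symm
    · rw [hmap]
      exact hS.constructible hD.toom hD.root hT
  · obtain ⟨k, hk⟩ := hD.explore_of_isNatural hT hη
    obtain ⟨k', hk'⟩ := hD.explore_of_isNatural hT hη'
    have h1 := hk.terminal_unique hD.toom hD.root hT (hD.toom.not_looseEnd_map η) hk'
    have h2 := hk'.terminal_unique hD.toom hD.root hT (hD.toom.not_looseEnd_map η') hk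
    obtain rfl := le_antisymm h1 h2
    have := hk.unique hD.toom hD.root hT hk'
    rw [Stage.mk.injEq] at this
    exact Equiv.symm_bijective.injective (DFunLike.coe_injective (eq_of_heq this.2.2))

end DecGraph

/-! ### Weights of the stages of the exploration -/

namespace DecGraph

open TypedDigraph

variable {Λ : Type u} {σ m : ℕ}

/-- `E` is identified through `φ` with a part of `D`: the decoration of `E` is that of `D`,
restricted to the points of `E`. -/
structure IsPartOf (E D : DecGraph Λ σ m) (φ : Fin (E.N + 1) → Fin (D.N + 1)) : Prop where
  graph : E.G.IsPart D.G φ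
  root : φ E.root = D.root
  pos : ∀ v, E.pos v = D.pos (φ v)
  dec : ∀ i ∈ Set.range E.pos, E.dec i = D.dec i
  off : ∀ i, i ∉ Set.range E.pos → E.dec i = none

open scoped Classical in
/-- The incomplete contour that is explored at the stage `S` of the exploration of `D`. -/
noncomputable abbrev atStage (D : DecGraph Λ σ m) (S : Stage (Fin (D.N + 1)) σ) :
    DecGraph Λ σ m where
  N := S.n
  G := S.H
  root := 0
  pos := D.pos ∘ S.φ
  dec i := if i ∈ Set.range (D.pos ∘ S.φ) then D.dec i else none

theorem IsPartOf.eq_atStage {D E : DecGraph Λ σ m} {φ : Fin (E.N + 1) → Fin (D.N + 1)}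
    (h : E.IsPartOf D φ) (h0 : E.root = 0) : E = D.atStage ⟨E.N, E.G, φ⟩ := by
  have hpos : E.pos = D.pos ∘ φ := funext h.pos
  have hdec : E.dec = (D.atStage ⟨E.N, E.G, φ⟩).dec := by
    funext i
    by_cases hi : i ∈ Set.range E.pos
    · rw [h.dec i hi]
      rw [hpos] at hi
      exact (if_pos hi).symm
    · rw [h.off i hi]
      rw [hpos] at hi
      exact (if_neg hi).symm
  obtain ⟨N, G, root, pos, dec⟩ := E
  rw [atStage, DecGraph.mk.injEq]
  exact ⟨rfl, HEq.rfl, heq_of_eq h0, heq_of_eq hpos, hdec⟩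

theorem atStage_dec (D : DecGraph Λ σ m) (S : Stage (Fin (D.N + 1)) σ) (v : Fin (S.n + 1)) :
    (D.atStage S).dec (D.pos (S.φ v)) = D.dec (D.pos (S.φ v)) :=
  if_pos ⟨v, rfl⟩

open scoped Classical in
theorem atStage_grow [NeZero σ] (D : DecGraph Λ σ m) {n : ℕ} (H : TypedDigraph (Fin (n + 1)) σ)
    (φ : Fin (n + 1) → Fin (D.N + 1)) (s : Fin σ) (v : Fin (n + 1)) (w : Fin (D.N + 1))
    (t : VType σ) :
    D.atStage ⟨n + 1, (H.addVertex t).attach s v.castSucc (Fin.last (n + 1)),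
        Fin.snoc (α := fun _ => Fin (D.N + 1)) φ w⟩ =
      (D.atStage ⟨n, H, φ⟩).grow s v t (D.pos w) (D.dec (D.pos w)) := by
  have hpos : D.pos ∘ Fin.snoc (α := fun _ => Fin (D.N + 1)) φ w =
      Fin.snoc (α := fun _ => Λ) (D.pos ∘ φ) (D.pos w) := by
    funext a
    induction a using Fin.lastCases with
    | last => simp
    | cast a => simp
  simp only [atStage, grow, addVertex, attach, DecGraph.mk.injEq, heq_eq_eq, true_and]
  refine ⟨rfl, hpos, funext fun i => ?_⟩
  rw [hpos]
  by_cases hi : i = D.pos w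
  · subst hi
    rw [Function.update_self, if_pos ⟨Fin.last _, Fin.snoc_last (α := fun _ => Λ) _ _⟩]
  · rw [Function.update_of_ne hi]
    have : i ∈ Set.range (Fin.snoc (α := fun _ => Λ) (D.pos ∘ φ) (D.pos w)) ↔
        i ∈ Set.range (D.pos ∘ φ) := by
      rw [Fin.range_snoc, Set.mem_insert_iff, or_iff_right hi]
    simp only [this]

theorem subset_Delta (A : Fin σ → Fin m → Finset Λ) (s : Fin σ) (k : Fin m) :
    A s k ⊆ Delta A k := by
  intro j hj
  simp only [Delta, Finset.mem_biUnion]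
  exact ⟨s, Finset.mem_univ s, hj⟩

theorem vertexType_root [NeZero σ] (D : DecGraph Λ σ m) : D.vertexType D.root = some 0 := if_pos rfl

theorem vertexType_source [NeZero σ] {D : DecGraph Λ σ m} {v : Fin (D.N + 1)} (hv : v ∈ D.G.src)
    (h : v ≠ D.root) : D.vertexType v = none := by
  rw [vertexType, if_neg h, if_pos hv]

variable [Group Λ] {A : Fin σ → Fin m → Finset Λ} {D : DecGraph Λ σ m}

/-- The starting point of an edge has a nonzero decoration, which allows the displacement. -/
theorem IsContour.edge_dec (hD : D.IsContour A) {s : Fin σ} {v w : Fin (D.N + 1)}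
    (he : (v, w) ∈ D.G.edge s) :
    ∃ k, D.dec (D.pos v) = some k ∧ (D.pos v)⁻¹ * D.pos w ∈ Delta A k := by
  by_cases hv : v = D.root
  · obtain ⟨k, hk, h⟩ := hD.dec.inner s (v, w) (Finset.mem_filter.2 ⟨he, .inr hv⟩)
    exact ⟨k, hk, subset_Delta A s k h⟩
  rcases hD.toom.edge_start he with hs | hs
  · exact hD.dec.source s (v, w) (Finset.mem_filter.2 ⟨he, hs.1, hv⟩)
  · obtain ⟨k, hk, h⟩ := hD.dec.inner s (v, w) (Finset.mem_filter.2 ⟨he, .inl hs⟩)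
    exact ⟨k, hk, subset_Delta A s k h⟩

theorem IsContour.exists_dec [NeZero σ] (hD : D.IsContour A) {v : Fin (D.N + 1)}
    (hv : v ∉ D.G.snk) : ∃ k, D.dec (D.pos v) = some k := by
  obtain ⟨s, w, hw⟩ : ∃ s w, (v, w) ∈ D.G.edge s := by
    rcases hD.toom.typed v with h | h | ⟨s, h⟩
    · exact ⟨0, hD.toom.exists_edge_from (.inl ⟨h, hv⟩)⟩
    · exact absurd h hv
    · exact ⟨s, hD.toom.exists_edge_from (.inr h)⟩
  obtain ⟨k, hk, _⟩ := hD.edge_dec hw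
  exact ⟨k, hk⟩

variable [NeZero σ] {k : ℕ} {S : Stage (Fin (D.N + 1)) σ}

theorem IsContour.atStage (hD : D.IsContour A) (hT : D.root ∉ D.G.snk)
    (hS : D.G.Explore D.root k S) : (D.atStage S).IsIncContour A := by
  have hp := hS.isPart hD.toom hD.root hT
  have h0 : S.φ 0 = D.root := hS.map_zero
  have hr {v} : v = 0 ↔ S.φ v = D.root := by rw [← h0, hp.inj.eq_iff]
  refine ⟨hS.isIncomplete hD.toom hD.root hT, rfl, ⟨fun v hv w hw => ?_, fun s v w hv hw hne => ?_⟩,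
    ⟨fun i hi => if_neg hi, fun v hv => ?_, fun s e he => ?_, fun s e he => ?_⟩, ?_⟩
  · exact hD.emb.sink _ (hp.snk.1 hv) _ (hp.inj.ne hw)
  · exact hD.emb.inner s _ _ (hv.imp hp.internal.1 hr.1) (hw.imp hp.internal.1 hr.1) (hp.inj.ne hne)
  · exact (D.atStage_dec S v).trans (hD.dec.sink _ (hp.snk.1 hv))
  · obtain ⟨h1, h2⟩ := Finset.mem_filter.1 he
    obtain ⟨k, hk, h⟩ := hD.dec.inner s (S.φ e.1, S.φ e.2)
      (Finset.mem_filter.2 ⟨hp.edge s _ _ h1, h2.imp hp.internal.1 hr.1⟩)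
    exact ⟨k, (D.atStage_dec S e.1).trans hk, h⟩
  · obtain ⟨h1, h2⟩ := Finset.mem_filter.1 he
    obtain ⟨k, hk, h⟩ := hD.dec.source s (S.φ e.1, S.φ e.2)
      (Finset.mem_filter.2 ⟨hp.edge s _ _ h1, hp.src.1 h2.1, fun h => h2.2 (hr.2 h)⟩)
    exact ⟨k, (D.atStage_dec S e.1).trans hk, h⟩
  · change D.pos (S.φ 0) = 1
    rw [h0, hD.origin]

theorem IsContour.vertexType_internal (hD : D.IsContour A) {v : Fin (D.N + 1)} {s : Fin σ}
    (hv : v ∈ D.G.internal s) : D.vertexType v = some s := by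
  have hs := hD.toom.not_src_of_internal hv
  have hr : v ≠ D.root := fun h => hs (h ▸ hD.root)
  have he : ∃ s, v ∈ D.G.internal s := ⟨s, hv⟩
  rw [vertexType, if_neg hr, if_neg hs, dif_pos he, hD.toom.internal_inj he.choose_spec hv]

end DecGraph

namespace Params

open TypedDigraph DecGraph

variable {Λ : Type u} {σ m : ℕ} {A : Fin σ → Fin m → Finset Λ} (P : Params A)

theorem freshLaw_nonneg (t : Option (Fin σ)) (d : Option (Fin m)) : 0 ≤ P.freshLaw t d := by
  cases d with
  | none => exact P.pHat_mem.1
  | some k => exact mul_nonneg (sub_nonneg.2 P.pHat_mem.2) (P.rHat_nonneg t k)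

variable [NeZero σ]

theorem bInt_nonneg : 0 ≤ P.bInt :=
  tsum_nonneg fun j => Real.iSup_nonneg fun k => P.aInt_nonneg ⊤ k j

theorem bSrc_nonneg : 0 ≤ P.bSrc :=
  tsum_nonneg fun j => Real.iSup_nonneg fun k => P.aSrc_nonneg ⊤ k j

variable (D : DecGraph Λ σ m)

open scoped Classical in
/-- The factor with which the vertex `φ v` contributes to the probability of finding it, if the
vertices are found in the order given by `φ`: the probability of its decoration, unless an earlier
vertex is embedded at the same point. -/
noncomputable def vertexFactor {n : ℕ} (φ : Fin n → Fin (D.N + 1)) (v : Fin n) : ℝ :=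
  if ∃ u < v, D.pos (φ u) = D.pos (φ v) then 1
  else P.freshLaw (D.vertexType (φ v)) (D.dec (D.pos (φ v)))

variable {D} in
theorem vertexFactor_nonneg {n : ℕ} (φ : Fin n → Fin (D.N + 1)) (v : Fin n) :
    0 ≤ P.vertexFactor D φ v := by
  unfold vertexFactor
  split_ifs
  · exact zero_le_one
  · exact P.freshLaw_nonneg _ _

variable [Group Λ]

/-- The factor with which an edge of charge `s` of `D` contributes to the probability of finding
it. -/
noncomputable def edgeFactor (s : Fin σ) (e : Fin (D.N + 1) × Fin (D.N + 1)) : ℝ :=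
  (D.dec (D.pos e.1)).elim 0 fun k =>
    if e.1 ∈ D.G.src ∧ e.1 ≠ D.root then
      P.aSrc s k ((D.pos e.1)⁻¹ * D.pos e.2) * if s = ⊤ then P.pCirc * P.bSrc⁻¹ else 1
    else P.aInt s k ((D.pos e.1)⁻¹ * D.pos e.2) * if s = ⊤ then (1 - P.pCirc) * P.bInt⁻¹ else 1

/-- The probability that the chain follows the exploration of `D` up to the stage `S`. -/
noncomputable def stageWeight (S : Stage (Fin (D.N + 1)) σ) : ℝ :=
  (∏ v, P.vertexFactor D S.φ v) *
    ∏ s, ∏ e ∈ S.H.edge s, P.edgeFactor D s (S.φ e.1, S.φ e.2)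

variable {D}

theorem edgeFactor_nonneg (s : Fin σ) (e : Fin (D.N + 1) × Fin (D.N + 1)) :
    0 ≤ P.edgeFactor D s e := by
  have h1 := P.pCirc_mem.1
  have h2 := sub_nonneg.2 P.pCirc_mem.2
  have h3 := inv_nonneg.2 P.bSrc_nonneg
  have h4 := inv_nonneg.2 P.bInt_nonneg
  unfold edgeFactor
  cases D.dec (D.pos e.1) with
  | none => exact le_rfl
  | some k =>
    simp only [Option.elim]
    split_ifs
    · exact mul_nonneg (P.aSrc_nonneg _ _ _) (mul_nonneg h1 h3)
    · exact mul_nonneg (P.aSrc_nonneg _ _ _) zero_le_one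
    · exact mul_nonneg (P.aInt_nonneg _ _ _) (mul_nonneg h2 h4)
    · exact mul_nonneg (P.aInt_nonneg _ _ _) zero_le_one

theorem stageWeight_nonneg (S : Stage (Fin (D.N + 1)) σ) : 0 ≤ P.stageWeight D S :=
  mul_nonneg (Finset.prod_nonneg fun _ _ => P.vertexFactor_nonneg _ _)
    (Finset.prod_nonneg fun _ _ => Finset.prod_nonneg fun _ _ => P.edgeFactor_nonneg _ _)

theorem prod_attach_edge {V : Type*} [DecidableEq V] {H : TypedDigraph V σ} {s : Fin σ} {v w : V}
    (hl : ¬ H.Link s v w) (f : Fin σ → V × V → ℝ) :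
    ∏ l, ∏ e ∈ (H.attach s v w).edge l, f l e =
      (∏ l, ∏ e ∈ H.edge l, f l e) * f s (if s = ⊤ then (w, v) else (v, w)) := by
  rw [← Finset.mul_prod_erase _ _ (Finset.mem_univ s),
    ← Finset.mul_prod_erase _ (fun l => ∏ e ∈ H.edge l, f l e) (Finset.mem_univ s)]
  have h1 : ∏ e ∈ (H.attach s v w).edge s, f s e =
      f s (if s = ⊤ then (w, v) else (v, w)) * ∏ e ∈ H.edge s, f s e := by
    rw [← Finset.prod_insert hl]
    simp [TypedDigraph.attach]
  have h2 : ∏ l ∈ Finset.univ.erase s, ∏ e ∈ (H.attach s v w).edge l, f l e =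
      ∏ l ∈ Finset.univ.erase s, ∏ e ∈ H.edge l, f l e :=
    Finset.prod_congr rfl fun l hl => by
      simp [TypedDigraph.attach, Function.update_of_ne (Finset.mem_erase.1 hl).1]
  rw [h1, h2]
  ring

variable {n : ℕ} {H : TypedDigraph (Fin (n + 1)) σ} {φ : Fin (n + 1) → Fin (D.N + 1)} {s : Fin σ}
  {v : Fin (n + 1)}

theorem stageWeight_attach {w : Fin (n + 1)} (hl : ¬ H.Link s v w) :
    P.stageWeight D ⟨n, H.attach s v w, φ⟩ = P.stageWeight D ⟨n, H, φ⟩ *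
      P.edgeFactor D s (if s = ⊤ then (φ w, φ v) else (φ v, φ w)) := by
  unfold stageWeight
  rw [prod_attach_edge hl fun l e => P.edgeFactor D l (φ e.1, φ e.2), ← mul_assoc]
  congr 2
  split_ifs <;> rfl

theorem not_link_addVertex_last (t : VType σ) :
    ¬ (H.addVertex t).Link s v.castSucc (Fin.last (n + 1)) := by
  unfold Link
  split_ifs <;> intro h <;> obtain ⟨a, b, _, e⟩ := mem_addVertex_edge.1 h
  · exact (Fin.castSucc_lt_last a).ne (Prod.mk.inj e).1.symm
  · exact (Fin.castSucc_lt_last b).ne (Prod.mk.inj e).2.symm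

open scoped Classical in
theorem stageWeight_grow (w : Fin (D.N + 1)) (t : VType σ) :
    P.stageWeight D ⟨n + 1, (H.addVertex t).attach s v.castSucc (Fin.last (n + 1)),
        Fin.snoc (α := fun _ => Fin (D.N + 1)) φ w⟩ =
      P.stageWeight D ⟨n, H, φ⟩ *
        (P.edgeFactor D s (if s = ⊤ then (w, φ v) else (φ v, w)) *
          if D.pos w ∈ Set.range (D.pos ∘ φ) then 1
          else P.freshLaw (D.vertexType w) (D.dec (D.pos w))) := by
  unfold stageWeight
  simp only
  rw [prod_attach_edge (not_link_addVertex_last t), Fin.prod_univ_castSucc]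
  have h1 (a : Fin (n + 1)) :
      P.vertexFactor D (Fin.snoc (α := fun _ => Fin (D.N + 1)) φ w) a.castSucc =
        P.vertexFactor D φ a := by
    unfold vertexFactor
    have : (∃ u < a.castSucc, D.pos (Fin.snoc (α := fun _ => Fin (D.N + 1)) φ w u) =
        D.pos (Fin.snoc (α := fun _ => Fin (D.N + 1)) φ w a.castSucc)) ↔
        ∃ u < a, D.pos (φ u) = D.pos (φ a) := by
      constructor
      · rintro ⟨u, hu, h⟩
        induction u using Fin.lastCases with
        | last => exact absurd hu (Fin.castSucc_lt_last a).not_gt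
        | cast u =>
          rw [Fin.snoc_castSucc, Fin.snoc_castSucc] at h
          exact ⟨u, hu, h⟩
      · rintro ⟨u, hu, h⟩
        refine ⟨u.castSucc, hu, ?_⟩
        rwa [Fin.snoc_castSucc, Fin.snoc_castSucc]
    rw [Fin.snoc_castSucc (α := fun _ => Fin (D.N + 1))]
    rw [Fin.snoc_castSucc (α := fun _ => Fin (D.N + 1))] at this
    simp only [this]
  have h2 : P.vertexFactor D (Fin.snoc (α := fun _ => Fin (D.N + 1)) φ w) (Fin.last (n + 1)) =
      if D.pos w ∈ Set.range (D.pos ∘ φ) then 1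
        else P.freshLaw (D.vertexType w) (D.dec (D.pos w)) := by
    unfold vertexFactor
    have : (∃ u < Fin.last (n + 1), D.pos (Fin.snoc (α := fun _ => Fin (D.N + 1)) φ w u) =
        D.pos w) ↔ D.pos w ∈ Set.range (D.pos ∘ φ) := by
      constructor
      · rintro ⟨u, hu, h⟩
        induction u using Fin.lastCases with
        | last => exact absurd hu (lt_irrefl _)
        | cast u =>
          rw [Fin.snoc_castSucc] at h
          exact ⟨u, h⟩
      · rintro ⟨u, hu⟩
        refine ⟨u.castSucc, Fin.castSucc_lt_last u, ?_⟩
        rwa [Fin.snoc_castSucc]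
    rw [Fin.snoc_last (α := fun _ => Fin (D.N + 1))]
    simp only [this]
  have h3 (l : Fin σ) : ∏ e ∈ (H.addVertex t).edge l, P.edgeFactor D l
      (Fin.snoc (α := fun _ => Fin (D.N + 1)) φ w e.1,
        Fin.snoc (α := fun _ => Fin (D.N + 1)) φ w e.2) =
      ∏ e ∈ H.edge l, P.edgeFactor D l (φ e.1, φ e.2) := by
    rw [show (H.addVertex t).edge l =
      (H.edge l).map (Fin.castSuccEmb.prodMap Fin.castSuccEmb) from rfl, Finset.prod_map]
    refine Finset.prod_congr rfl fun e _ => ?_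
    change P.edgeFactor D l (Fin.snoc (α := fun _ => Fin (D.N + 1)) φ w e.1.castSucc,
      Fin.snoc (α := fun _ => Fin (D.N + 1)) φ w e.2.castSucc) = _
    rw [Fin.snoc_castSucc, Fin.snoc_castSucc]
  simp only [h1, h2, h3]
  have h4 (e) (he : e = if s = ⊤ then (Fin.last (n + 1), v.castSucc)
      else (v.castSucc, Fin.last (n + 1))) : (Fin.snoc (α := fun _ => Fin (D.N + 1)) φ w e.1,
        Fin.snoc (α := fun _ => Fin (D.N + 1)) φ w e.2) = if s = ⊤ then (w, φ v) else (φ v, w) := by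
    subst he
    split_ifs <;> simp only [Fin.snoc_castSucc, Fin.snoc_last]
  rw [h4 _ rfl]
  ring

end Params

/-! ### Transition probabilities along the exploration -/

namespace DecGraph

open TypedDigraph

variable {Λ : Type u} {σ m : ℕ} [NeZero σ] {D : DecGraph Λ σ m} {s : Fin σ} {v : Fin (D.N + 1)}

theorem attach_ne_grow (w : Fin (D.N + 1)) (t : VType σ) (i : Λ) (d : Option (Fin m)) :
    D.attach s v w ≠ D.grow s v t i d := fun h =>
  (Nat.succ_ne_self D.N) (congrArg DecGraph.N h).symm

theorem attach_inj (hl : ∀ w, ¬ D.G.Link s v w) {w w' : Fin (D.N + 1)}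
    (h : D.attach s v w = D.attach s v w') : w = w' := by
  have hG : D.G.attach s v w = D.G.attach s v w' := by
    simp only [attach, DecGraph.mk.injEq, heq_eq_eq, true_and] at h
    exact h.1
  have h1 := link_attach D.G s v w
  rw [hG] at h1
  unfold Link at h1
  rcases mem_attach_edge.1 h1 with h1 | ⟨_, h1⟩
  · exact absurd h1 (hl w)
  · split_ifs at h1 <;> cases h1 <;> rfl

open scoped Classical in
theorem grow_inj {t t' : VType σ} {i i' : Λ} {d d' : Option (Fin m)}
    (h : D.grow s v t i d = D.grow s v t' i' d') : t = t' ∧ i = i' ∧ d = d' := by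
  simp only [grow, attach, addVertex, DecGraph.mk.injEq, heq_eq_eq, true_and] at h
  obtain ⟨hG, hpos, hdec⟩ := h
  have hi : i = i' := by
    have := congrFun hpos (Fin.last _)
    rwa [Fin.snoc_last, Fin.snoc_last] at this
  subst hi
  refine ⟨?_, rfl, ?_⟩
  · have h1 : ((D.G.addVertex t').attach s v.castSucc (Fin.last _)).HasType (Fin.last _) t := by
      rw [← hG]
      exact hasType_attach.2 (hasType_addVertex_last.2 rfl)
    exact (hasType_addVertex_last.1 (hasType_attach.1 h1)).symm
  · have := congrFun hdec i
    rwa [Function.update_self, Function.update_self] at this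

end DecGraph

namespace Params

open TypedDigraph DecGraph

variable {Λ : Type u} [Group Λ] {σ m : ℕ} {A : Fin σ → Fin m → Finset Λ} [NeZero σ] {P : Params A}
  {D : DecGraph Λ σ m} {s : Fin σ} {v : Fin (D.N + 1)}

theorem stepProb_of_ne_top (hv : D.G.MostUrgent v s) (hs : s ≠ ⊤) (E : DecGraph Λ σ m) :
    P.stepProb D E = P.upProb D v s E := by
  unfold stepProb
  rw [Finset.sum_eq_single v, Finset.sum_eq_single s, if_pos hv, if_neg hs]
  · exact fun l _ hl => if_neg fun h => hl (h.unique hv).2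
  · exact fun h => absurd (Finset.mem_univ _) h
  · exact fun w _ hw => Finset.sum_eq_zero fun l _ => if_neg fun h => hw (h.unique hv).1
  · exact fun h => absurd (Finset.mem_univ _) h

theorem stepProb_top (hv : D.G.MostUrgent v ⊤) (E : DecGraph Λ σ m) :
    P.stepProb D E = (1 - P.pCirc) * P.downProb D v E + P.pCirc * P.sourceProb D v E := by
  unfold stepProb
  rw [Finset.sum_eq_single v, Finset.sum_eq_single ⊤, if_pos hv, if_pos rfl]
  · exact fun l _ hl => if_neg fun h => hl (h.unique hv).2
  · exact fun h => absurd (Finset.mem_univ _) h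
  · exact fun w _ hw => Finset.sum_eq_zero fun l _ => if_neg fun h => hw (h.unique hv).1
  · exact fun h => absurd (Finset.mem_univ _) h

theorem upProb_attach (hl : ∀ w, ¬ D.G.Link s v w) {w : Fin (D.N + 1)} (hw : w ∈ D.G.snk)
    (hd : D.dec (D.pos w) = none) {k : Fin m} (hk : D.dec (D.pos v) = some k)
    (hj : (D.pos v)⁻¹ * D.pos w ∈ Delta A k) :
    P.upProb D v s (D.attach s v w) =
      if v ∈ D.G.src ∧ v ≠ D.root then P.aSrc s k ((D.pos v)⁻¹ * D.pos w)
      else P.aInt s k ((D.pos v)⁻¹ * D.pos w) := by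
  classical
  have hres (i d) : UpResult D v s i d (D.attach s v w) ↔ i = D.pos w := by
    constructor
    · rintro (⟨w', _, rfl, h⟩ | ⟨_, h⟩)
      · rw [attach_inj hl h]
      · exact absurd h (attach_ne_grow _ _ _ _)
    · rintro rfl
      exact .inl ⟨w, hw, rfl, rfl⟩
  simp only [upProb, hk, Option.elim_some, hres]
  rw [Finset.sum_eq_single_of_mem _ hj, Finset.sum_eq_single_of_mem none (Finset.mem_univ _)]
  · rw [mul_inv_cancel_left, if_pos rfl, decLaw, if_pos (Set.mem_range_self w), if_pos hd, mul_one]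
  · intro d _ hd'
    rw [mul_inv_cancel_left, if_pos rfl, decLaw, if_pos (Set.mem_range_self w),
      if_neg (show ¬ D.dec (D.pos w) = d from fun h => hd' (h.symm.trans hd)), mul_zero]
  · intro j _ hj'
    refine Finset.sum_eq_zero fun d _ => if_neg fun h => hj' ?_
    rw [← h, inv_mul_cancel_left]

theorem upProb_grow {i : Λ} {d : Option (Fin m)} (hi : ∀ w ∈ D.G.snk, D.pos w ≠ i) {k : Fin m}
    (hk : D.dec (D.pos v) = some k) (hj : (D.pos v)⁻¹ * i ∈ Delta A k) {t : VType σ}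
    (ht : t = d.elim VType.sink fun _ => VType.internal s) :
    P.upProb D v s (D.grow s v t i d) =
      (if v ∈ D.G.src ∧ v ≠ D.root then P.aSrc s k ((D.pos v)⁻¹ * i)
        else P.aInt s k ((D.pos v)⁻¹ * i)) * P.decLaw D i (some s) d := by
  subst ht
  classical
  have hres (i' d') : UpResult D v s i' d'
      (D.grow s v (d.elim VType.sink fun _ => VType.internal s) i d) ↔ i' = i ∧ d' = d := by
    constructor
    · rintro (⟨w', _, rfl, h⟩ | ⟨_, h⟩)
      · exact absurd h.symm (attach_ne_grow _ _ _ _)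
      · exact ⟨(grow_inj h).2.1.symm, (grow_inj h).2.2.symm⟩
    · rintro ⟨rfl, rfl⟩
      exact .inr ⟨fun ⟨w, hw, h⟩ => hi w hw h, rfl⟩
  simp only [upProb, hk, Option.elim_some, hres]
  rw [Finset.sum_eq_single_of_mem _ hj, Finset.sum_eq_single_of_mem d (Finset.mem_univ _)]
  · rw [mul_inv_cancel_left, if_pos ⟨rfl, rfl⟩]
  · exact fun d' _ hd' => if_neg fun h => hd' h.2
  · intro j _ hj'
    refine Finset.sum_eq_zero fun d _ => if_neg fun h => hj' ?_
    rw [← h.1, inv_mul_cancel_left]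

theorem downProb_attach_root (h1 : D.pos D.root = 1) (h0 : D.G.outDeg ⊤ D.root = 0) {k : Fin m}
    (hk : D.dec 1 = some k) (hj : D.pos v ∈ Delta A k) :
    P.downProb D v (D.attach ⊤ v D.root) = P.bInt⁻¹ * P.aInt ⊤ k (D.pos v) := by
  classical
  have hres (i k') : DownResult D v i k' (D.attach ⊤ v D.root) ↔ i = 1 := by
    constructor
    · rintro (⟨h, _⟩ | ⟨_, h⟩)
      · exact h
      · exact absurd h (attach_ne_grow _ _ _ _)
    · rintro rfl
      exact .inl ⟨rfl, h0, rfl⟩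
  have hr : (1 : Λ) ∈ Set.range D.pos := ⟨_, h1⟩
  simp only [downProb, hres]
  rw [Finset.sum_eq_single_of_mem k (Finset.mem_univ _), Finset.sum_eq_single_of_mem _ hj]
  · rw [mul_inv_cancel, if_pos rfl, decLaw, if_pos hr, if_pos hk, mul_one]
  · intro j _ hj'
    exact if_neg fun h => hj' (mul_inv_eq_one.1 h).symm
  · intro k' _ hk'
    refine Finset.sum_eq_zero fun j _ => ?_
    split_ifs with h
    · rw [h, decLaw, if_pos hr, if_neg, mul_zero]
      rw [hk]
      exact fun h => hk' (Option.some.inj h).symm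
    · rfl

theorem downProb_grow {i : Λ} {k : Fin m} (hi : ¬ (i = 1 ∧ D.G.outDeg ⊤ D.root = 0))
    (hj : i⁻¹ * D.pos v ∈ Delta A k) :
    P.downProb D v (D.grow ⊤ v (VType.internal ⊤) i (some k)) =
      P.bInt⁻¹ * P.aInt ⊤ k (i⁻¹ * D.pos v) * P.decLaw D i (some ⊤) (some k) := by
  classical
  have hres (i' k') : DownResult D v i' k' (D.grow ⊤ v (VType.internal ⊤) i (some k)) ↔
      i' = i ∧ k' = k := by
    constructor
    · rintro (⟨_, _, h⟩ | ⟨_, h⟩)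
      · exact absurd h.symm (attach_ne_grow _ _ _ _)
      · exact ⟨(grow_inj h).2.1.symm, Option.some.inj (grow_inj h).2.2.symm⟩
    · rintro ⟨rfl, rfl⟩
      exact .inr ⟨hi, rfl⟩
  simp only [downProb, hres]
  rw [Finset.sum_eq_single_of_mem k (Finset.mem_univ _), Finset.sum_eq_single_of_mem _ hj]
  · rw [mul_inv_rev, inv_inv, mul_inv_cancel_left, if_pos ⟨rfl, rfl⟩]
  · intro j _ hj'
    refine if_neg fun h => hj' ?_
    rw [← h.1]
    group
  · exact fun k' _ hk' => Finset.sum_eq_zero fun j _ => if_neg fun h => hk' h.2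

theorem downProb_grow_source {i : Λ} {d : Option (Fin m)} :
    P.downProb D v (D.grow ⊤ v VType.source i d) = 0 := by
  refine Finset.sum_eq_zero fun k _ => Finset.sum_eq_zero fun j _ => if_neg ?_
  rintro (⟨_, _, h⟩ | ⟨_, h⟩)
  · exact absurd h.symm (attach_ne_grow _ _ _ _)
  · exact absurd (grow_inj h).1 (by simp)

theorem sourceProb_grow {i : Λ} {k : Fin m} (hj : i⁻¹ * D.pos v ∈ Delta A k) :
    P.sourceProb D v (D.grow ⊤ v VType.source i (some k)) =
      P.bSrc⁻¹ * P.aSrc ⊤ k (i⁻¹ * D.pos v) * P.decLaw D i none (some k) := by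
  classical
  have hres (i' k') : D.grow ⊤ v VType.source i (some k) = D.grow ⊤ v VType.source i' (some k') ↔
      i' = i ∧ k' = k := by
    constructor
    · exact fun h => ⟨(grow_inj h).2.1.symm, Option.some.inj (grow_inj h).2.2.symm⟩
    · rintro ⟨rfl, rfl⟩
      rfl
  simp only [sourceProb, hres]
  rw [Finset.sum_eq_single_of_mem k (Finset.mem_univ _), Finset.sum_eq_single_of_mem _ hj]
  · rw [mul_inv_rev, inv_inv, mul_inv_cancel_left, if_pos ⟨rfl, rfl⟩]
  · intro j _ hj'
    refine if_neg fun h => hj' ?_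
    rw [← h.1]
    group
  · exact fun k' _ hk' => Finset.sum_eq_zero fun j _ => if_neg fun h => hk' h.2

theorem sourceProb_attach {w : Fin (D.N + 1)} : P.sourceProb D v (D.attach ⊤ v w) = 0 :=
  Finset.sum_eq_zero fun _ _ => Finset.sum_eq_zero fun _ _ => if_neg (attach_ne_grow _ _ _ _)

theorem sourceProb_grow_internal {l : Fin σ} {i : Λ} {d : Option (Fin m)} :
    P.sourceProb D v (D.grow ⊤ v (VType.internal l) i d) = 0 :=
  Finset.sum_eq_zero fun k _ => Finset.sum_eq_zero fun j _ =>
    if_neg fun h => absurd (grow_inj h).1 (by simp)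

end Params

namespace DecGraph.IsContour

open TypedDigraph

variable {Λ : Type u} [Group Λ] {σ m : ℕ} {A : Fin σ → Fin m → Finset Λ} [NeZero σ] (P : Params A)
  {D : DecGraph Λ σ m} {r k n : ℕ} {H : TypedDigraph (Fin (n + 1)) σ}
  {φ : Fin (n + 1) → Fin (D.N + 1)} {s : Fin σ} {v : Fin (n + 1)}

/-- When the exploration finds an edge to a vertex that it had found before, then this vertex is a
sink or the root. -/
theorem join_type (hD : D.IsContour A) (hT : D.root ∉ D.G.snk)
    (hS : D.G.Explore D.root k ⟨n, H, φ⟩) (hv : H.LooseEnd v s) {w : Fin (n + 1)}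
    (hw : D.G.Link s (φ v) (φ w)) : (s ≠ ⊤ ∧ w ∈ H.snk) ∨ (s = ⊤ ∧ w = 0 ∧ H.outDeg ⊤ 0 = 0) := by
  have hp : H.IsPart D.G φ := hS.isPart hD.toom hD.root hT
  have hg : H.Grown := hS.grown hD.toom
  rcases hD.toom.link_type hw with ⟨rfl, h⟩ | ⟨hs, h⟩
  · have hno (b) : (w, b) ∉ H.edge ⊤ := fun hb => by
      simp only [Link, if_true] at hw
      have := hp.inj (hD.toom.edge_right_unique (hp.edge _ _ _ hb) hw)
      subst this
      refine hv.not_link w ?_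
      simpa only [Link, if_true] using hb
    have hw0 : w = 0 := by
      by_contra hw0
      obtain ⟨b, hb⟩ := hg.1 w (h.symm.imp hp.internal.2 fun h => hp.src.2 h.1) hw0
      exact hno b hb
    exact .inr ⟨rfl, hw0, outDeg_eq_zero_iff.2 fun b hb => hno b (hw0 ▸ hb)⟩
  · refine .inl ⟨hs, ?_⟩
    rcases h with h | h
    · exact hp.snk.2 h.1
    · obtain ⟨b, hb⟩ := hg.2.1 s hs w (hp.internal.2 h)
      simp only [Link, if_neg hs] at hw
      have := hp.inj (hD.toom.edge_left_unique (hp.edge _ _ _ hb) hw)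
      subst this
      refine absurd ?_ (hv.not_link w)
      simpa only [Link, if_neg hs] using hb

/-- When the exploration finds an edge to a known vertex, the chain makes the corresponding
extension by drawing the displacement of the edge; the decorations of both points are known. -/
theorem stepProb_join (hD : D.IsContour A) (hT : D.root ∉ D.G.snk)
    (hS : D.G.Explore D.root k ⟨n, H, φ⟩) (hv : H.MostUrgent v s) {w : Fin (n + 1)}
    (hw : D.G.Link s (φ v) (φ w)) :
    P.stepProb (D.atStage ⟨n, H, φ⟩) (D.atStage ⟨n, H.attach s v w, φ⟩) =
      P.edgeFactor D s (if s = ⊤ then (φ w, φ v) else (φ v, φ w)) := by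
  have hp : H.IsPart D.G φ := hS.isPart hD.toom hD.root hT
  have h0 : φ 0 = D.root := hS.map_zero
  have hE : D.atStage ⟨n, H.attach s v w, φ⟩ = (D.atStage ⟨n, H, φ⟩).attach s v w := rfl
  rw [hE]
  rcases hD.join_type hT hS hv.1 hw with ⟨hs, hsnk⟩ | ⟨rfl, rfl, hout⟩
  · rw [Link, if_neg hs] at hw
    obtain ⟨k, hk, hj⟩ := hD.edge_dec hw
    have hv' : (D.atStage ⟨n, H, φ⟩).G.MostUrgent v s := hv
    rw [Params.stepProb_of_ne_top hv' hs, Params.upProb_attach (k := k) hv.1.not_link hsnk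
      ((D.atStage_dec ⟨n, H, φ⟩ w).trans (hD.dec.sink _ (hp.snk.1 hsnk)))
      ((D.atStage_dec ⟨n, H, φ⟩ v).trans hk) hj]
    have hiff : (v ∈ (D.atStage ⟨n, H, φ⟩).G.src ∧ v ≠ (D.atStage ⟨n, H, φ⟩).root) ↔
        (φ v ∈ D.G.src ∧ φ v ≠ D.root) := by
      rw [← h0, hp.inj.ne_iff]
      exact and_congr_left fun _ => hp.src
    simp only [Params.edgeFactor, if_neg hs, hk, Option.elim_some, mul_one]
    by_cases h : φ v ∈ D.G.src ∧ φ v ≠ D.root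
    · rw [if_pos h, if_pos (hiff.2 h)]
      rfl
    · rw [if_neg h, if_neg (mt hiff.1 h)]
      rfl
  · rw [Link, if_pos rfl] at hw
    obtain ⟨k, hk, hj⟩ := hD.edge_dec hw
    have hv' : (D.atStage ⟨n, H, φ⟩).G.MostUrgent v ⊤ := hv
    have h1 : D.pos (φ 0) = 1 := by rw [h0, hD.origin]
    rw [h1, inv_one, one_mul] at hj
    have hk' : (D.atStage ⟨n, H, φ⟩).dec 1 = some k := by
      rw [← h1]
      exact (D.atStage_dec ⟨n, H, φ⟩ 0).trans hk
    have hdown : P.downProb (D.atStage ⟨n, H, φ⟩) v ((D.atStage ⟨n, H, φ⟩).attach ⊤ v 0) =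
        P.bInt⁻¹ * P.aInt ⊤ k (D.pos (φ v)) :=
      Params.downProb_attach_root (D := D.atStage ⟨n, H, φ⟩) h1 hout hk' hj
    rw [Params.stepProb_top hv', Params.sourceProb_attach, hdown]
    have hiff : ¬ (φ 0 ∈ D.G.src ∧ φ 0 ≠ D.root) := fun h => h.2 h0
    rw [h1] at hk
    simp only [Params.edgeFactor, if_true, hk, Option.elim_some, if_neg hiff, h1]
    rw [inv_one, one_mul]
    ring

open scoped Classical in
/-- When the exploration finds a new vertex `w`, the chain makes the corresponding extension by
drawing the displacement of the edge and, if the point of `w` is new, its decoration. -/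
theorem stepProb_grow (hD : D.IsContour A) (hT : D.root ∉ D.G.snk)
    (hS : D.G.Explore D.root k ⟨n, H, φ⟩) (hv : H.MostUrgent v s) {w : Fin (D.N + 1)} {t : VType σ}
    (hw : D.G.Link s (φ v) w) (hR : w ∉ Set.range φ) (ht : D.G.HasType w t) :
    P.stepProb (D.atStage ⟨n, H, φ⟩)
        (D.atStage ⟨n + 1, (H.addVertex t).attach s v.castSucc (Fin.last (n + 1)),
          Fin.snoc (α := fun _ => Fin (D.N + 1)) φ w⟩) =
      P.edgeFactor D s (if s = ⊤ then (w, φ v) else (φ v, w)) *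
        if D.pos w ∈ Set.range (D.pos ∘ φ) then 1
        else P.freshLaw (D.vertexType w) (D.dec (D.pos w)) := by
  have hp : H.IsPart D.G φ := hS.isPart hD.toom hD.root hT
  have h0 : φ 0 = D.root := hS.map_zero
  have hwr : w ≠ D.root := fun h => hR ⟨0, h0.trans h.symm⟩
  have hu {t'} (h : D.G.HasType w t') : t = t' :=
    hD.toom.hasType_unique (hD.toom.link_not_both hw) ht h
  have hlaw (t : Option (Fin σ)) (h : D.dec (D.pos w) = none ∨ D.vertexType w = t) :
      P.decLaw (D.atStage ⟨n, H, φ⟩) (D.pos w) t (D.dec (D.pos w)) =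
        if D.pos w ∈ Set.range (D.pos ∘ φ) then 1
        else P.freshLaw (D.vertexType w) (D.dec (D.pos w)) := by
    rw [Params.decLaw]
    change (if D.pos w ∈ Set.range (D.pos ∘ φ) then _ else _) = _
    split_ifs with h1 h2
    · rfl
    · exact absurd (if_pos h1) h2
    · rcases h with h | h
      · rw [h]
        rfl
      · rw [h]
  rw [atStage_grow]
  by_cases hs : s = ⊤
  · subst hs
    have hv' : (D.atStage ⟨n, H, φ⟩).G.MostUrgent v ⊤ := hv
    rw [Link, if_pos rfl] at hw
    obtain ⟨k, hk, hj⟩ := hD.edge_dec hw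
    rw [Params.stepProb_top hv', if_pos rfl]
    rcases hD.toom.edge_start hw with h | h
    · obtain rfl := hu (t' := .source) h.1
      rw [Params.downProb_grow_source, hk,
        Params.sourceProb_grow (D := D.atStage ⟨n, H, φ⟩) (v := v) hj, ← hk,
        hlaw none (.inr (vertexType_source h.1 hwr))]
      simp only [Params.edgeFactor, if_true, hk, Option.elim_some, if_pos (And.intro h.1 hwr)]
      change _ + P.pCirc * (P.bSrc⁻¹ * P.aSrc ⊤ k ((D.pos w)⁻¹ * D.pos (φ v)) * _) = _
      ring
    · obtain rfl := hu (t' := .internal ⊤) h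
      -- The root counts as internal vertex of charge `⊤`, so the new vertex is not at the origin.
      have h1 : D.pos w ≠ 1 := by
        rw [← hD.origin]
        exact hD.emb.inner ⊤ w D.root (.inl h) (.inr rfl) hwr
      rw [Params.sourceProb_grow_internal, hk,
        Params.downProb_grow (D := D.atStage ⟨n, H, φ⟩) (v := v) (fun h => h1 h.1) hj, ← hk,
        hlaw (some ⊤) (.inr (hD.vertexType_internal h))]
      have hns : ¬ (w ∈ D.G.src ∧ w ≠ D.root) := fun h' => hD.toom.not_src_of_internal h h'.1
      simp only [Params.edgeFactor, if_true, hk, Option.elim_some, if_neg hns]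
      change _ * (P.bInt⁻¹ * P.aInt ⊤ k ((D.pos w)⁻¹ * D.pos (φ v)) * _) + _ = _
      ring
  · have hv' : (D.atStage ⟨n, H, φ⟩).G.MostUrgent v s := hv
    rw [Link, if_neg hs] at hw
    obtain ⟨k, hk, hj⟩ := hD.edge_dec hw
    have hno : ∀ a ∈ (D.atStage ⟨n, H, φ⟩).G.snk, (D.atStage ⟨n, H, φ⟩).pos a ≠ D.pos w :=
      fun a ha => hD.emb.sink _ (hp.snk.1 ha) w fun h => hR ⟨a, h⟩
    have hiff : (v ∈ (D.atStage ⟨n, H, φ⟩).G.src ∧ v ≠ (D.atStage ⟨n, H, φ⟩).root) ↔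
        (φ v ∈ D.G.src ∧ φ v ≠ D.root) := by
      rw [← h0, hp.inj.ne_iff]
      exact and_congr_left fun _ => hp.src
    have htype : t = (D.dec (D.pos w)).elim VType.sink (fun _ => VType.internal s) ∧
        (D.dec (D.pos w) = none ∨ D.vertexType w = some s) := by
      rcases hD.toom.edge_end hw with h | h
      · rw [hD.dec.sink w h.1]
        exact ⟨hu (t' := .sink) h.1, .inl rfl⟩
      · obtain ⟨k, hk⟩ := hD.exists_dec (hD.toom.not_snk_of_internal h)
        rw [hk]
        exact ⟨hu (t' := .internal s) h, .inr (hD.vertexType_internal h)⟩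
    rw [Params.stepProb_of_ne_top hv' hs, Params.upProb_grow (k := k) hno
      ((D.atStage_dec ⟨n, H, φ⟩ v).trans hk) hj htype.1, hlaw _ htype.2, if_neg hs]
    simp only [Params.edgeFactor, if_neg hs, hk, Option.elim_some, mul_one]
    by_cases h : φ v ∈ D.G.src ∧ φ v ≠ D.root
    · rw [if_pos h, if_pos (hiff.2 h)]
      rfl
    · rw [if_neg h, if_neg (mt hiff.1 h)]
      rfl

/-- Each step of the exploration of `D` is made by the chain with the probability by which the
weight of the stage changes. -/
theorem stageWeight_succ (hD : D.IsContour A) (hT : D.root ∉ D.G.snk)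
    {S S' : Stage (Fin (D.N + 1)) σ} (hS : D.G.Explore D.root k S)
    (hS' : D.G.Explore D.root (k + 1) S') :
    P.stageWeight D S' = P.stageWeight D S * P.stepProb (D.atStage S) (D.atStage S') := by
  cases hS' with
  | join h hv w hw =>
    cases hS.unique hD.toom hD.root hT h
    rw [hD.stepProb_join P hT hS hv hw, P.stageWeight_attach (hv.1.not_link w)]
  | grow h hv w t hw hR ht =>
    cases hS.unique hD.toom hD.root hT h
    rw [hD.stepProb_grow P hT hS hv hw hR ht, P.stageWeight_grow]

end DecGraph.IsContour

/-! ### The weight of the final stage -/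

open scoped Classical in
/-- The product over the vertices that are the first ones at their points is a product over these
points. -/
theorem DecGraph.prod_vertexFactor {Λ : Type u} {σ m : ℕ} [NeZero σ]
    {A : Fin σ → Fin m → Finset Λ} (P : Params A) (D : DecGraph Λ σ m)
    (η : Equiv.Perm (Fin (D.N + 1))) :
    ∏ v, P.vertexFactor D η.symm v =
      ∏ i ∈ Finset.univ.image D.pos, P.freshLaw (D.pointType η i) (D.dec i) := by
  let F : Finset (Fin (D.N + 1)) :=
    Finset.univ.filter fun v => ¬ ∃ u < v, D.pos (η.symm u) = D.pos (η.symm v)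
  have hF {v} : v ∈ F ↔ ¬ ∃ u < v, D.pos (η.symm u) = D.pos (η.symm v) := by simp [F]
  have hinj : Set.InjOn (fun v => D.pos (η.symm v)) F := by
    intro u hu v hv h
    rcases lt_trichotomy u v with h' | h' | h'
    · exact absurd ⟨u, h', h⟩ (hF.1 hv)
    · exact h'
    · exact absurd ⟨v, h', h.symm⟩ (hF.1 hu)
  have himage : Finset.univ.image D.pos = F.image fun v => D.pos (η.symm v) := by
    ext i
    simp only [Finset.mem_image, Finset.mem_univ, true_and]
    constructor
    · rintro ⟨a, rfl⟩
      obtain ⟨v, hv, hmin⟩ := wellFounded_lt.has_min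
        {v : Fin (D.N + 1) | D.pos (η.symm v) = D.pos a} ⟨η a, by simp⟩
      have hv' : D.pos (η.symm v) = D.pos a := hv
      exact ⟨v, hF.2 fun ⟨u, hu, h⟩ => hmin u (h.trans hv') hu, hv'⟩
    · rintro ⟨v, _, rfl⟩
      exact ⟨_, rfl⟩
  rw [himage, Finset.prod_image hinj, ← Finset.prod_subset (Finset.subset_univ F)]
  · refine Finset.prod_congr rfl fun v hv => ?_
    have hv := hF.1 hv
    have hinf : sInf {k | D.pos (η.symm k) = D.pos (η.symm v)} = v := by
      refine IsLeast.csInf_eq ⟨rfl, fun u hu => ?_⟩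
      by_contra huv
      exact hv ⟨u, not_le.1 huv, hu⟩
    rw [Params.vertexFactor, if_neg hv, pointType, hinf]
  · intro v _ hv
    rw [hF, not_not] at hv
    exact if_pos hv

namespace DecGraph.IsContour

open TypedDigraph

variable {Λ : Type u} [Group Λ] {σ m : ℕ} {A : Fin σ → Fin m → Finset Λ} {D : DecGraph Λ σ m}

/-- Edges of the same charge have different endpoints in space-time, so they can be identified with
their images. -/
theorem edge_pos_injOn (hD : D.IsContour A) (s : Fin σ) :
    Set.InjOn (fun e => (D.pos e.1, D.pos e.2))
      (D.G.edge s : Set (Fin (D.N + 1) × Fin (D.N + 1))) := by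
  rintro ⟨a, b⟩ hab ⟨c, d⟩ hcd h
  have h2 : D.pos b = D.pos d := (Prod.mk.inj h).2
  have hbd : b = d := by
    by_contra hne
    rcases hD.toom.edge_end hab with hb | hb
    · exact hD.emb.sink b hb.1 d hne h2
    rcases hD.toom.edge_end hcd with hd | hd
    · exact hD.emb.sink d hd.1 b (Ne.symm hne) h2.symm
    · exact hD.emb.inner s b d (.inl hb) (.inl hd) hne h2
  subst hbd
  rw [hD.toom.edge_left_unique hab hcd]

theorem prod_edgeImage (hD : D.IsContour A) {s : Fin σ} {F : Finset (Fin (D.N + 1) × Fin (D.N + 1))}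
    (hF : F ⊆ D.G.edge s) (f : Λ × Λ → ℝ) :
    ∏ e ∈ D.edgeImage F, f e = ∏ e ∈ F, f (D.pos e.1, D.pos e.2) := by
  classical
  exact Finset.prod_image ((hD.edge_pos_injOn s).mono (Finset.coe_subset.2 hF))

variable [NeZero σ] (P : Params A)

theorem prod_edgeSrc (hD : D.IsContour A) (s : Fin σ) :
    ∏ e ∈ D.G.edgeSrc D.root s, P.edgeFactor D s e =
      (∏ e ∈ D.edgeImage (D.G.edgeSrc D.root s),
        (D.dec e.1).elim 0 fun k => P.aSrc s k (e.1⁻¹ * e.2)) *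
      if s = ⊤ then (P.pCirc * P.bSrc⁻¹) ^ D.nSrc else 1 := by
  rw [hD.prod_edgeImage (s := s) (F := D.G.edgeSrc D.root s) (Finset.filter_subset _ _)]
  have h1 : (if s = ⊤ then (P.pCirc * P.bSrc⁻¹) ^ D.nSrc else 1) =
      ∏ e ∈ D.G.edgeSrc D.root s, if s = ⊤ then P.pCirc * P.bSrc⁻¹ else 1 := by
    split_ifs with hs
    · rw [Finset.prod_const, nSrc, hs]
    · rw [Finset.prod_const_one]
  rw [h1, ← Finset.prod_mul_distrib]
  refine Finset.prod_congr rfl fun e he => ?_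
  rw [Params.edgeFactor]
  cases D.dec (D.pos e.1) with
  | none => simp
  | some k => rw [Option.elim_some, Option.elim_some, if_pos (Finset.mem_filter.1 he).2]

theorem prod_edgeInt (hD : D.IsContour A) (s : Fin σ) :
    ∏ e ∈ D.G.edgeInt D.root s, P.edgeFactor D s e =
      (∏ e ∈ D.edgeImage (D.G.edgeInt D.root s),
        (D.dec e.1).elim 0 fun k => P.aInt s k (e.1⁻¹ * e.2)) *
      if s = ⊤ then ((1 - P.pCirc) * P.bInt⁻¹) ^ D.nInt else 1 := by
  rw [hD.prod_edgeImage (s := s) (F := D.G.edgeInt D.root s) (Finset.filter_subset _ _)]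
  have h1 : (if s = ⊤ then ((1 - P.pCirc) * P.bInt⁻¹) ^ D.nInt else 1) =
      ∏ e ∈ D.G.edgeInt D.root s, if s = ⊤ then (1 - P.pCirc) * P.bInt⁻¹ else 1 := by
    split_ifs with hs
    · rw [Finset.prod_const, nInt, hs]
    · rw [Finset.prod_const_one]
  rw [h1, ← Finset.prod_mul_distrib]
  refine Finset.prod_congr rfl fun e he => ?_
  have hns : ¬ (e.1 ∈ D.G.src ∧ e.1 ≠ D.root) := by
    rintro ⟨h2, h3⟩
    rcases (Finset.mem_filter.1 he).2 with h | h
    · exact hD.toom.not_src_of_internal h h2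
    · exact h3 h
  rw [Params.edgeFactor]
  cases D.dec (D.pos e.1) with
  | none => simp
  | some k => rw [Option.elim_some, Option.elim_some, if_neg hns]

theorem prod_edge (hD : D.IsContour A) :
    ∏ s, ∏ e ∈ D.G.edge s, P.edgeFactor D s e =
      (∏ s, ∏ e ∈ D.edgeImage (D.G.edgeSrc D.root s),
        (D.dec e.1).elim 0 fun k => P.aSrc s k (e.1⁻¹ * e.2)) *
      (∏ s, ∏ e ∈ D.edgeImage (D.G.edgeInt D.root s),
        (D.dec e.1).elim 0 fun k => P.aInt s k (e.1⁻¹ * e.2)) *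
      ((P.pCirc * P.bSrc⁻¹) ^ D.nSrc * ((1 - P.pCirc) * P.bInt⁻¹) ^ D.nInt) := by
  have h1 (s) : ∏ e ∈ D.G.edge s, P.edgeFactor D s e =
      (∏ e ∈ D.G.edgeSrc D.root s, P.edgeFactor D s e) *
        ∏ e ∈ D.G.edgeInt D.root s, P.edgeFactor D s e := by
    rw [← Finset.prod_union (hD.disjoint_edgeSrc_edgeInt s), hD.edgeSrc_union_edgeInt]
  simp only [h1, hD.prod_edgeSrc P, hD.prod_edgeInt P, Finset.prod_mul_distrib,
    Finset.prod_ite_eq', Finset.mem_univ, if_true]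
  ring

theorem prod_freshLaw (hD : D.IsContour A) (η : Equiv.Perm (Fin (D.N + 1))) :
    ∏ v, P.vertexFactor D η.symm v = P.pHat ^ D.nStar * (1 - P.pHat) ^ D.nDiamond *
      ∏ i ∈ D.nonSinkPoints, (D.dec i).elim 0 fun k => P.rHat (D.pointType η i) k := by
  classical
  have hsub : D.G.snk.image D.pos ⊆ Finset.univ.image D.pos :=
    Finset.image_subset_image (Finset.subset_univ _)
  rw [prod_vertexFactor, ← Finset.prod_sdiff hsub]
  have h1 : ∏ i ∈ D.G.snk.image D.pos, P.freshLaw (D.pointType η i) (D.dec i) =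
      P.pHat ^ D.nStar := by
    have hcard : (D.G.snk.image D.pos).card = D.nStar :=
      Finset.card_image_of_injOn fun v hv w _ h => by
        by_contra hne
        exact hD.emb.sink v hv w hne h
    rw [← hcard, ← Finset.prod_const]
    refine Finset.prod_congr rfl fun i hi => ?_
    obtain ⟨v, hv, rfl⟩ := Finset.mem_image.1 hi
    rw [hD.dec.sink v hv]
    rfl
  have h2 : ∏ i ∈ Finset.univ.image D.pos \ D.G.snk.image D.pos,
      P.freshLaw (D.pointType η i) (D.dec i) = (1 - P.pHat) ^ D.nDiamond *
        ∏ i ∈ D.nonSinkPoints, (D.dec i).elim 0 fun k => P.rHat (D.pointType η i) k := by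
    rw [nDiamond, ← Finset.prod_const, ← Finset.prod_mul_distrib]
    refine Finset.prod_congr (by unfold nonSinkPoints; congr) fun i hi => ?_
    obtain ⟨hi, hi'⟩ := Finset.mem_sdiff.1 hi
    obtain ⟨v, _, rfl⟩ := Finset.mem_image.1 hi
    obtain ⟨k, hk⟩ := hD.exists_dec fun hv => hi' (Finset.mem_image_of_mem _ hv)
    rw [hk]
    rfl
  rw [h1, h2]
  ring

/-- The weight of the final stage of the exploration is the product formula. -/
theorem stageWeight_eq_weight (hD : D.IsContour A) (η : Equiv.Perm (Fin (D.N + 1))) :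
    P.stageWeight D ⟨D.N, D.G.map η, η.symm⟩ = P.weight D η := by
  have h1 (s) : ∏ e ∈ (D.G.map η).edge s, P.edgeFactor D s (η.symm e.1, η.symm e.2) =
      ∏ e ∈ D.G.edge s, P.edgeFactor D s e := by
    rw [show (D.G.map η).edge s = (D.G.edge s).map (η.prodCongr η).toEmbedding from rfl,
      Finset.prod_map]
    simp
  rw [Params.stageWeight]
  simp only [h1]
  rw [hD.prod_freshLaw, hD.prod_edge, Params.weight]
  simp only [mul_pow, inv_pow]
  ring

end DecGraph.IsContour

/-! ### The transition probabilities of the chain sum to one -/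

section Sums

theorem tsum_option_ennreal {α : Type*} (f : Option α → ENNReal) :
    ∑' x, f x = f none + ∑' x, f (some x) := by
  rw [← (Equiv.optionEquivSumPUnit.{0} α).symm.tsum_eq f,
    ENNReal.summable.tsum_sum ENNReal.summable, add_comm]
  simp

theorem sum_ite_le_of_unique {α : Type*} (T : Finset α) (R : α → Prop) [DecidablePred R]
    (hR : ∀ x ∈ T, ∀ y ∈ T, R x → R y → x = y) {c : ℝ} (hc : 0 ≤ c) :
    ∑ x ∈ T, (if R x then c else 0) ≤ c := by
  by_cases h : ∃ x ∈ T, R x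
  · obtain ⟨x, hx, hx'⟩ := h
    rw [Finset.sum_eq_single_of_mem x hx fun y hy hne => if_neg fun h => hne (hR y hy x hx h hx'),
      if_pos hx']
  · rw [Finset.sum_eq_zero fun x hx => if_neg fun h' => h ⟨x, hx, h'⟩]
    exact hc

/-- The weights `B⁻¹ a_k(j)` with `B = ∑_j sup_k a_k(j)`, multiplied with subprobability laws in `k`
for each `j`, have total mass at most one. -/
theorem sum_inv_tsum_iSup_mul_le_one {Λ : Type*} {m : ℕ} (U : Fin m → Finset Λ)
    (a q : Fin m → Λ → ℝ) (ha : ∀ k j, 0 ≤ a k j) (hoff : ∀ k, ∀ j ∉ U k, a k j = 0)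
    (hq : ∀ k j, 0 ≤ q k j) (hq1 : ∀ j, ∑ k, q k j ≤ 1) :
    ∑ k, ∑ j ∈ U k, (∑' j, ⨆ k, a k j)⁻¹ * a k j * q k j ≤ 1 := by
  classical
  have hle (k j) : a k j ≤ ⨆ k, a k j := le_ciSup (Set.finite_range fun k => a k j).bddAbove k
  have hsup (j) : 0 ≤ ⨆ k, a k j := Real.iSup_nonneg fun k => ha k j
  have hB : ∑' j, ⨆ k, a k j = ∑ j ∈ Finset.univ.biUnion U, ⨆ k, a k j := by
    refine tsum_eq_sum fun j hj => ?_
    have : ∀ k, a k j = 0 := fun k => hoff k j fun h =>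
      hj (Finset.mem_biUnion.2 ⟨k, Finset.mem_univ _, h⟩)
    simp [this]
  have hB0 : 0 ≤ ∑' j, ⨆ k, a k j := tsum_nonneg hsup
  set B := ∑' j, ⨆ k, a k j
  calc ∑ k, ∑ j ∈ U k, B⁻¹ * a k j * q k j
      = ∑ k, ∑ j ∈ Finset.univ.biUnion U, B⁻¹ * a k j * q k j :=
        Finset.sum_congr rfl fun k _ => Finset.sum_subset
          (fun j hj => Finset.mem_biUnion.2 ⟨k, Finset.mem_univ _, hj⟩)
          fun j _ hj => by rw [hoff k j hj, mul_zero, zero_mul]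
    _ = ∑ j ∈ Finset.univ.biUnion U, ∑ k, B⁻¹ * a k j * q k j := Finset.sum_comm
    _ ≤ ∑ j ∈ Finset.univ.biUnion U, B⁻¹ * ⨆ k, a k j := by
        refine Finset.sum_le_sum fun j _ => ?_
        calc ∑ k, B⁻¹ * a k j * q k j ≤ ∑ k, B⁻¹ * (⨆ k, a k j) * q k j := by
              refine Finset.sum_le_sum fun k _ => mul_le_mul_of_nonneg_right ?_ (hq k j)
              exact mul_le_mul_of_nonneg_left (hle k j) (inv_nonneg.2 hB0)
          _ = B⁻¹ * (⨆ k, a k j) * ∑ k, q k j := by rw [Finset.mul_sum]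
          _ ≤ B⁻¹ * (⨆ k, a k j) * 1 :=
              mul_le_mul_of_nonneg_left (hq1 j) (mul_nonneg (inv_nonneg.2 hB0) (hsup j))
          _ = B⁻¹ * ⨆ k, a k j := mul_one _
    _ = B⁻¹ * B := by rw [← Finset.mul_sum, hB]
    -- If `B = 0`, then the left-hand side is `0`.
    _ ≤ 1 := inv_mul_le_one_of_le₀ le_rfl hB0

end Sums

namespace Params

open TypedDigraph DecGraph

variable {Λ : Type u} {σ m : ℕ} {A : Fin σ → Fin m → Finset Λ} (P : Params A)

theorem sum_freshLaw (t : Option (Fin σ)) : ∑ d, P.freshLaw t d = 1 := by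
  rw [Fintype.sum_option]
  simp only [freshLaw, Option.elim_none, Option.elim_some]
  rw [← Finset.mul_sum, P.rHat_sum]
  ring

theorem decLaw_nonneg (D : DecGraph Λ σ m) (i : Λ) (t : Option (Fin σ)) (d : Option (Fin m)) :
    0 ≤ P.decLaw D i t d := by
  unfold decLaw
  split_ifs
  · exact zero_le_one
  · exact le_rfl
  · exact P.freshLaw_nonneg t d

theorem sum_decLaw (D : DecGraph Λ σ m) (i : Λ) (t : Option (Fin σ)) :
    ∑ d, P.decLaw D i t d = 1 := by
  unfold decLaw
  split_ifs
  · simp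
  · exact P.sum_freshLaw t

theorem sum_decLaw_some_le (D : DecGraph Λ σ m) (i : Λ) (t : Option (Fin σ)) :
    ∑ k : Fin m, P.decLaw D i t (some k) ≤ 1 := by
  have := P.sum_decLaw D i t
  rw [Fintype.sum_option] at this
  linarith [P.decLaw_nonneg D i t none]

theorem sum_Delta_aInt_le (s : Fin σ) (k : Fin m) : ∑ j ∈ Delta A k, P.aInt s k j ≤ 1 := by
  rw [← Finset.sum_subset (subset_Delta A s k) fun j _ hj => P.aInt_off s k j hj]
  exact P.aInt_sum s k

theorem aInt_off_Delta (s : Fin σ) (k : Fin m) : ∀ j ∉ Delta A k, P.aInt s k j = 0 :=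
  fun j hj => P.aInt_off s k j fun h => hj (subset_Delta A s k h)

variable [NeZero σ]

theorem UpResult.unique {D E E' : DecGraph Λ σ m} {v : Fin (D.N + 1)} {s : Fin σ} {i : Λ}
    {d : Option (Fin m)} (hD : D.G.IsEmbedding D.root D.pos) (h : UpResult D v s i d E)
    (h' : UpResult D v s i d E') : E = E' := by
  rcases h with ⟨w, hw, hwi, rfl⟩ | ⟨h, rfl⟩
  · rcases h' with ⟨w', hw', hwi', rfl⟩ | ⟨h', _⟩
    · have : w = w' := by
        by_contra hne
        exact hD.sink w hw w' hne (hwi.trans hwi'.symm)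
      rw [this]
    · exact absurd ⟨w, hw, hwi⟩ h'
  · rcases h' with ⟨w', hw', hwi', _⟩ | ⟨_, rfl⟩
    · exact absurd ⟨w', hw', hwi'⟩ h
    · rfl

variable [Group Λ]

theorem DownResult.unique {D E E' : DecGraph Λ σ m} {v : Fin (D.N + 1)} {i : Λ} {k : Fin m}
    (h : DownResult D v i k E) (h' : DownResult D v i k E') : E = E' := by
  rcases h with ⟨h1, h2, rfl⟩ | ⟨h, rfl⟩
  · rcases h' with ⟨_, _, rfl⟩ | ⟨h', _⟩
    · rfl
    · exact absurd ⟨h1, h2⟩ h'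
  · rcases h' with ⟨h1, h2, _⟩ | ⟨_, rfl⟩
    · exact absurd ⟨h1, h2⟩ h
    · rfl

variable {D : DecGraph Λ σ m} {v : Fin (D.N + 1)} {s : Fin σ} {T : Finset (IncContour A)}

theorem upProb_nonneg (E : DecGraph Λ σ m) : 0 ≤ P.upProb D v s E := by
  unfold upProb
  cases D.dec (D.pos v) with
  | none => exact le_rfl
  | some k =>
    refine Finset.sum_nonneg fun j _ => Finset.sum_nonneg fun d _ => ?_
    split_ifs
    · exact mul_nonneg (P.aSrc_nonneg _ _ _) (P.decLaw_nonneg _ _ _ _)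
    · exact mul_nonneg (P.aInt_nonneg _ _ _) (P.decLaw_nonneg _ _ _ _)
    · exact le_rfl

theorem downProb_nonneg (E : DecGraph Λ σ m) : 0 ≤ P.downProb D v E := by
  refine Finset.sum_nonneg fun k _ => Finset.sum_nonneg fun j _ => ?_
  split_ifs
  · exact mul_nonneg (mul_nonneg (inv_nonneg.2 P.bInt_nonneg) (P.aInt_nonneg _ _ _))
      (P.decLaw_nonneg _ _ _ _)
  · exact le_rfl

theorem sourceProb_nonneg (E : DecGraph Λ σ m) : 0 ≤ P.sourceProb D v E := by
  refine Finset.sum_nonneg fun k _ => Finset.sum_nonneg fun j _ => ?_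
  split_ifs
  · exact mul_nonneg (mul_nonneg (inv_nonneg.2 P.bSrc_nonneg) (P.aSrc_nonneg _ _ _))
      (P.decLaw_nonneg _ _ _ _)
  · exact le_rfl

theorem stepProb_nonneg (E : DecGraph Λ σ m) : 0 ≤ P.stepProb D E := by
  refine Finset.sum_nonneg fun v _ => Finset.sum_nonneg fun s _ => ?_
  split_ifs
  · exact add_nonneg (mul_nonneg (sub_nonneg.2 P.pCirc_mem.2) (P.downProb_nonneg E))
      (mul_nonneg P.pCirc_mem.1 (P.sourceProb_nonneg E))
  · exact P.upProb_nonneg E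
  · exact le_rfl

theorem sum_upProb_le (hD : D.G.IsEmbedding D.root D.pos) :
    ∑ y ∈ T, P.upProb D v s y.1 ≤ 1 := by
  classical
  unfold upProb
  cases D.dec (D.pos v) with
  | none => simp
  | some k =>
    simp only [Option.elim_some]
    rw [Finset.sum_comm]
    set a : Λ → ℝ := fun j => if v ∈ D.G.src ∧ v ≠ D.root then P.aSrc s k j else P.aInt s k j
    have ha (j) : 0 ≤ a j := by
      simp only [a]
      split_ifs
      · exact P.aSrc_nonneg _ _ _
      · exact P.aInt_nonneg _ _ _
    have ha1 : ∑ j ∈ Delta A k, a j ≤ 1 := by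
      simp only [a]
      split_ifs
      · exact P.aSrc_sum _ _
      · exact P.sum_Delta_aInt_le _ _
    refine le_trans (Finset.sum_le_sum fun j _ => ?_) ha1
    rw [Finset.sum_comm]
    calc _ ≤ ∑ d, a j * P.decLaw D (D.pos v * j) (some s) d :=
          Finset.sum_le_sum fun d _ => sum_ite_le_of_unique T _
            (fun x _ y _ hx hy => Subtype.ext (hx.unique hD hy))
            (mul_nonneg (ha j) (P.decLaw_nonneg _ _ _ _))
      _ = a j := by rw [← Finset.mul_sum, P.sum_decLaw, mul_one]

theorem sum_downProb_le : ∑ y ∈ T, P.downProb D v y.1 ≤ 1 := by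
  classical
  unfold downProb
  rw [Finset.sum_comm]
  refine le_trans (Finset.sum_le_sum fun k _ => ?_) (sum_inv_tsum_iSup_mul_le_one (Delta A)
    (P.aInt ⊤) (fun k j => P.decLaw D (D.pos v * j⁻¹) (some ⊤) (some k)) (P.aInt_nonneg ⊤)
    (P.aInt_off_Delta ⊤) (fun _ _ => P.decLaw_nonneg _ _ _ _) fun _ => P.sum_decLaw_some_le _ _ _)
  rw [Finset.sum_comm]
  exact Finset.sum_le_sum fun j _ => sum_ite_le_of_unique T _
    (fun x _ y _ hx hy => Subtype.ext (hx.unique hy))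
    (mul_nonneg (mul_nonneg (inv_nonneg.2 P.bInt_nonneg) (P.aInt_nonneg _ _ _))
      (P.decLaw_nonneg _ _ _ _))

theorem sum_sourceProb_le : ∑ y ∈ T, P.sourceProb D v y.1 ≤ 1 := by
  classical
  unfold sourceProb
  rw [Finset.sum_comm]
  refine le_trans (Finset.sum_le_sum fun k _ => ?_) (sum_inv_tsum_iSup_mul_le_one (Delta A)
    (P.aSrc ⊤) (fun k j => P.decLaw D (D.pos v * j⁻¹) none (some k)) (P.aSrc_nonneg ⊤)
    (P.aSrc_off ⊤) (fun _ _ => P.decLaw_nonneg _ _ _ _) fun _ => P.sum_decLaw_some_le _ _ _)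
  rw [Finset.sum_comm]
  exact Finset.sum_le_sum fun j _ => sum_ite_le_of_unique T _
    (fun x _ y _ hx hy => Subtype.ext (hx.trans hy.symm))
    (mul_nonneg (mul_nonneg (inv_nonneg.2 P.bSrc_nonneg) (P.aSrc_nonneg _ _ _))
      (P.decLaw_nonneg _ _ _ _))

theorem sum_stepProb_le (hD : D.G.IsEmbedding D.root D.pos) :
    ∑ y ∈ T, P.stepProb D y.1 ≤ 1 := by
  by_cases h : ∃ v s, D.G.MostUrgent v s
  · obtain ⟨v, s, hv⟩ := h
    by_cases hs : s = ⊤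
    · subst hs
      simp only [stepProb_top hv, Finset.sum_add_distrib, ← Finset.mul_sum]
      have h1 := mul_le_mul_of_nonneg_left (P.sum_downProb_le (D := D) (v := v) (T := T))
        (sub_nonneg.2 P.pCirc_mem.2)
      have h2 := mul_le_mul_of_nonneg_left (P.sum_sourceProb_le (D := D) (v := v) (T := T))
        P.pCirc_mem.1
      linarith
    · simp only [stepProb_of_ne_top hv hs]
      exact P.sum_upProb_le hD
  · have h0 (E : DecGraph Λ σ m) : P.stepProb D E = 0 :=
      Finset.sum_eq_zero fun v _ => Finset.sum_eq_zero fun s _ => if_neg fun hv => h ⟨v, s, hv⟩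
    simp [h0]

theorem tsum_transInc_le (x : IncContour A) : ∑' y, P.transInc x y ≤ 1 := by
  by_cases hx : x.1.Complete
  · simp [transInc, hx]
  · simp only [transInc, if_neg hx]
    rw [ENNReal.tsum_eq_iSup_sum]
    refine iSup_le fun T => ?_
    rw [← ENNReal.ofReal_sum_of_nonneg fun y _ => P.stepProb_nonneg y.1]
    exact ENNReal.ofReal_le_one.2 (P.sum_stepProb_le x.2.emb)

theorem tsum_trans (x : Option (IncContour A)) : ∑' y, P.trans x y = 1 := by
  rw [tsum_option_ennreal]
  cases x with
  | none => simp [trans]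
  | some x => exact tsub_add_cancel_of_le (P.tsum_transInc_le x)

end Params

namespace DecGraph

open TypedDigraph

variable {Λ : Type u} [Group Λ] {σ m : ℕ}

theorem trivial_injective : Function.Injective (trivial Λ σ (m := m)) := by
  intro d d' h
  have h := congrFun (congrArg DecGraph.dec h) 1
  simpa [trivial] using h

variable [NeZero σ] (A : Fin σ → Fin m → Finset Λ)

theorem trivial_isIncContour (d : Option (Fin m)) : (trivial Λ σ d).IsIncContour A := by
  have hin (s v) : (trivial Λ σ d).G.inDeg s v = 0 := rfl
  have hout (s v) : (trivial Λ σ d).G.outDeg s v = 0 := rfl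
  have hz (v : Fin ((trivial Λ σ d).N + 1)) : v = 0 := Fin.fin_one_eq_zero v
  have hi (s v) : v ∉ (trivial Λ σ d).G.internal s := Finset.notMem_empty _
  have hsrc (v) : v ∈ (trivial Λ σ d).G.src := Finset.mem_singleton.2 (hz v)
  refine ⟨⟨fun v => .inl (hsrc v), ?_, hsrc _,
    fun v _ s => ⟨hin s v, (hout s v).le.trans zero_le_one⟩,
    fun v _ s => ⟨hout s v, (hin s v).le.trans zero_le_one⟩, fun s v hv => absurd hv (hi s v), ?_⟩,
    rfl, ⟨fun v _ w h => absurd ((hz v).trans (hz w).symm) h,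
      fun s v w _ _ h => absurd ((hz v).trans (hz w).symm) h⟩, ⟨fun i h => ?_, fun v hv => ?_,
      fun s e he => ?_, fun s e he => ?_⟩, rfl⟩
  · rw [Connected, SimpleGraph.connected_iff]
    exact ⟨fun a b => by rw [hz a, hz b], ⟨0⟩⟩
  · cases d with
    | none => exact .inl ⟨rfl, rfl, rfl, fun _ => rfl, fun _ => rfl⟩
    | some k =>
      exact .inr ⟨fun v _ h => absurd (hz v) h, fun s _ v hv => absurd hv (hi s v),
        fun v hv => absurd hv (Finset.notMem_empty v)⟩
  · have hi1 : i ≠ 1 := by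
      rintro rfl
      exact h ⟨0, rfl⟩
    simp [trivial, hi1]
  · cases d with
    | none => simp [trivial]
    | some k => exact absurd hv (Finset.notMem_empty v)
  · exact absurd (Finset.mem_filter.1 he).1 (Finset.notMem_empty _)
  · exact absurd (Finset.mem_filter.1 he).1 (Finset.notMem_empty _)

end DecGraph

namespace Params

variable {Λ : Type u} [Group Λ] {σ m : ℕ} {A : Fin σ → Fin m → Finset Λ} [NeZero σ] (P : Params A)

open DecGraph

theorem initLaw_eq_zero {x : IncContour A} (hx : ∀ d, x.1 ≠ DecGraph.trivial Λ σ d) :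
    P.initLaw (some x) = 0 :=
  Finset.sum_eq_zero fun d _ => if_neg (hx d)

theorem initLaw_trivial {x : IncContour A} {d : Option (Fin m)}
    (hx : x.1 = DecGraph.trivial Λ σ d) :
    P.initLaw (some x) = ENNReal.ofReal (P.freshLaw (some 0) d) := by
  unfold initLaw
  simp only
  rw [Finset.sum_eq_single_of_mem d (Finset.mem_univ d), if_pos hx]
  exact fun d' _ hd' => if_neg fun h => hd' (trivial_injective (h.symm.trans hx))

theorem tsum_initLaw : ∑' x, P.initLaw x = 1 := by
  classical
  rw [tsum_option_ennreal]
  have h1 (d : Option (Fin m)) : (∑' x : IncContour A, if x.1 = DecGraph.trivial Λ σ d then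
      ENNReal.ofReal (P.freshLaw (some 0) d) else 0) = ENNReal.ofReal (P.freshLaw (some 0) d) := by
    rw [tsum_eq_single ⟨_, trivial_isIncContour A d⟩, if_pos rfl]
    exact fun x hx => if_neg fun h => hx (Subtype.ext h)
  unfold initLaw
  rw [zero_add]
  rw [Summable.tsum_finsetSum fun _ _ => ENNReal.summable]
  simp only [h1]
  rw [← ENNReal.ofReal_sum_of_nonneg fun d _ => P.freshLaw_nonneg _ d, P.sum_freshLaw,
    ENNReal.ofReal_one]

end Params

/-- There are countably many incomplete contours, since the decoration vanishes outside the finitely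
many points of the contour. -/
instance countable_incContour {Λ : Type u} [Group Λ] [Countable Λ] {σ m : ℕ} [NeZero σ]
    (A : Fin σ → Fin m → Finset Λ) : Countable (IncContour A) := by
  let f (x : IncContour A) : Σ N : ℕ, Finset (Fin (N + 1)) × Finset (Fin (N + 1)) ×
      (Fin σ → Finset (Fin (N + 1))) × (Fin σ → Finset (Fin (N + 1) × Fin (N + 1))) ×
      Fin (N + 1) × (Fin (N + 1) → Λ) × (Fin (N + 1) → Option (Fin m)) :=
    ⟨x.1.N, x.1.G.src, x.1.G.snk, x.1.G.internal, x.1.G.edge, x.1.root, x.1.pos, x.1.dec ∘ x.1.pos⟩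
  refine Function.Injective.countable (f := f) ?_
  rintro ⟨⟨N, ⟨a, b, c, d⟩, r, p, e⟩, hx⟩ ⟨⟨N', ⟨a', b', c', d'⟩, r', p', e'⟩, hy⟩ h
  simp only [f, Sigma.mk.injEq] at h
  obtain ⟨rfl, h⟩ := h
  simp only [heq_eq_eq, Prod.mk.injEq] at h
  obtain ⟨rfl, rfl, rfl, rfl, rfl, rfl, h⟩ := h
  have he : e = e' := by
    funext i
    by_cases hi : i ∈ Set.range p
    · obtain ⟨v, rfl⟩ := hi
      exact congrFun h v
    · exact (hx.dec.off i hi).trans (hy.dec.off i hi).symm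
  subst he
  rfl

/-! ### The chain follows the exploration of the contour that it reaches -/

namespace DecGraph

open TypedDigraph

section Contour

variable {Λ : Type u} {σ m : ℕ} [Group Λ] {A : Fin σ → Fin m → Finset Λ} {D : DecGraph Λ σ m}

theorem IsContour.eq_trivial (hD : D.IsContour A) (h : D.root ∈ D.G.snk) :
    D = trivial Λ σ none := by
  obtain ⟨hN, h1, h2, h3, h4⟩ := hD.isTrivial_iff.2 h
  have hoff := hD.dec.off
  have hdec := hD.dec.sink _ h
  have ho := hD.origin
  obtain ⟨N, ⟨src, snk, internal, edge⟩, root, pos, dec⟩ := D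
  obtain rfl : N = 0 := hN
  obtain rfl : src = {0} := h1
  obtain rfl : snk = {0} := h2
  obtain rfl : internal = fun _ => ∅ := funext h3
  obtain rfl : edge = fun _ => ∅ := funext h4
  obtain rfl : root = 0 := Fin.fin_one_eq_zero root
  obtain rfl : pos = fun _ => 1 := funext fun v => by rw [Fin.fin_one_eq_zero v]; exact ho
  obtain rfl : dec = fun _ => none := funext fun i => by
    by_cases hi : i = 1
    · rw [hi]; exact hdec
    · exact hoff i fun ⟨_, h⟩ => hi h.symm
  simp [trivial]

/-- With the vertices in the natural order, the contour is the one found at the end of the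
exploration. -/
theorem IsContour.iso_atStage (hD : D.IsContour A) {η : Equiv.Perm (Fin (D.N + 1))}
    (h0 : η D.root = 0) : (D.atStage ⟨D.N, D.G.map η, η.symm⟩).Iso D := by
  classical
  refine Iso.symm ⟨η, h0, rfl, fun v => ?_, funext fun i => ?_⟩
  · change _ = D.pos (η.symm (η v))
    rw [η.symm_apply_apply]
  · change _ = ite _ _ _
    split_ifs with h
    · rfl
    · refine hD.dec.off i fun ⟨v, hv⟩ => h ⟨η v, ?_⟩
      change D.pos (η.symm (η v)) = i
      rw [η.symm_apply_apply, hv]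

variable [NeZero σ]

theorem IsContour.atStage_start (hD : D.IsContour A) (hT : D.root ∉ D.G.snk) :
    D.atStage ⟨0, TypedDigraph.start σ, fun _ => D.root⟩ = trivial Λ σ (D.dec 1) := by
  classical
  obtain ⟨k, hk⟩ := hD.exists_dec hT
  rw [hD.origin] at hk
  simp only [trivial, hk, DecGraph.mk.injEq, heq_eq_eq, true_and]
  refine ⟨by simp [TypedDigraph.start], funext fun _ => hD.origin, funext fun i => ?_⟩
  by_cases hi : i = 1
  · subst hi
    rw [if_pos ⟨0, hD.origin⟩, Function.update_self, hk]
  · rw [if_neg, Function.update_of_ne hi]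
    rintro ⟨_, h⟩
    exact hi (h.symm.trans hD.origin)

end Contour

section Extension

variable {Λ : Type u} {σ m : ℕ}

theorem IsPartOf.of_iso {D E : DecGraph Λ σ m} (hE : ∀ i, i ∉ Set.range E.pos → E.dec i = none)
    (h : E.Iso D) : ∃ φ, E.IsPartOf D φ := by
  obtain ⟨χ, h1, h2, h3, h4⟩ := h
  refine ⟨χ, ?_, h1, h3, fun i _ => congrFun h4 i, hE⟩
  have := isPart_map (G := E.G) χ
  rw [h2] at this
  exact ⟨χ.injective, fun v t => by rw [this.type, χ.symm_apply_apply],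
    fun s v w hvw => by rw [← h2, mem_map_edge, χ.symm_apply_apply, χ.symm_apply_apply]; exact hvw⟩

variable [NeZero σ]

/-- `E` arises from `D` by an extension at the most urgent loose end that respects the decoration of
the points of `D`. -/
def IsExtension (D E : DecGraph Λ σ m) : Prop :=
  ∃ v s, D.G.MostUrgent v s ∧ ((∃ w, E = D.attach s v w) ∨
    ∃ t i d, E = D.grow s v t i d ∧ (i ∈ Set.range D.pos → D.dec i = d))

theorem IsExtension.exists_edge {D E : DecGraph Λ σ m} (h : D.IsExtension E) :
    ∃ s e, e ∈ E.G.edge s := by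
  obtain ⟨v, s, _, ⟨w, rfl⟩ | ⟨t, i, d, rfl, _⟩⟩ := h
  · exact ⟨s, _, link_attach D.G s v w⟩
  · exact ⟨s, _, link_attach (D.G.addVertex t) s v.castSucc (Fin.last _)⟩

/-- If an extension of `E` is a part of `D`, then so is `E`, and the extension is the one by which
the exploration of `D` continues. -/
theorem IsExtension.isPartOf {D E F : DecGraph Λ σ m} (h : E.IsExtension F)
    (hoff : ∀ i, i ∉ Set.range E.pos → E.dec i = none) {φ : Fin (F.N + 1) → Fin (D.N + 1)}
    (hF : F.IsPartOf D φ) : ∃ φ' : Fin (E.N + 1) → Fin (D.N + 1), E.IsPartOf D φ' ∧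
      ∀ r k, D.G.Explore r k ⟨E.N, E.G, φ'⟩ → D.G.Explore r (k + 1) ⟨F.N, F.G, φ⟩ := by
  classical
  obtain ⟨v, s, hv, ⟨w, rfl⟩ | ⟨t, i, d, rfl, hd⟩⟩ := h
  · exact ⟨φ, ⟨hF.graph.of_attach, hF.root, hF.pos, hF.dec, hF.off⟩,
      fun r k hk => .join hk hv w (hF.graph.link (link_attach E.G s v w))⟩
  · have hp : (E.G.addVertex t).IsPart D.G φ := hF.graph.of_attach
    have hpos (a : Fin (E.N + 1)) : E.pos a = D.pos (φ a.castSucc) :=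
      (Fin.snoc_castSucc (α := fun _ => Λ) i E.pos a).symm.trans (hF.pos a.castSucc)
    refine ⟨φ ∘ Fin.castSucc, ⟨hp.of_addVertex, hF.root, hpos, fun i' hi' => ?_, hoff⟩,
      fun r k hk => ?_⟩
    · rw [← hF.dec i']
      · change E.dec i' = Function.update E.dec i d i'
        by_cases hii : i' = i
        · subst hii
          rw [Function.update_self, hd hi']
        · rw [Function.update_of_ne hii]
      · obtain ⟨a, rfl⟩ := hi'
        exact ⟨a.castSucc, Fin.snoc_castSucc (α := fun _ => Λ) i E.pos a⟩
    · let ψ : Fin (E.N + 1 + 1) → Fin (D.N + 1) := φ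
      change D.G.Explore r (k + 1)
        ⟨E.N + 1, (E.G.addVertex t).attach s v.castSucc (Fin.last (E.N + 1)), ψ⟩
      rw [← Fin.snoc_init_self (α := fun _ => Fin (D.N + 1)) ψ]
      refine .grow hk hv (ψ (Fin.last _)) t
        (hF.graph.link (link_attach (E.G.addVertex t) s v.castSucc (Fin.last _))) ?_
        ((hp.type _ t).1 (hasType_addVertex_last.2 rfl))
      rintro ⟨a, ha⟩
      exact (Fin.castSucc_lt_last a).ne (hp.inj ha)

section Trajectory

variable [Group Λ]

theorem complete_trivial_none : (trivial Λ σ (none : Option (Fin m))).Complete := by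
  have hz (v : Fin ((trivial Λ σ (none : Option (Fin m))).N + 1)) : v = 0 := Fin.fin_one_eq_zero v
  have hsrc (v) : v ∈ (trivial Λ σ (none : Option (Fin m))).G.src := Finset.mem_singleton.2 (hz v)
  have hsnk (v) : v ∈ (trivial Λ σ (none : Option (Fin m))).G.snk := Finset.mem_singleton.2 (hz v)
  rintro v s (⟨_, ⟨_, h⟩ | h, _⟩ | ⟨_, ⟨_, h⟩ | h, _⟩)
  · exact h (hsnk v)
  · exact Finset.notMem_empty _ h
  · exact h (hsrc v)
  · exact Finset.notMem_empty _ h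

/-- If a sequence of extensions of a trivial contour leads to a part of `D`, then it follows the
exploration of `D`. -/
theorem explore_of_isExtension {A : Fin σ → Fin m → Finset Λ} {D : DecGraph Λ σ m}
    (x : ℕ → IncContour A) {n : ℕ} {k : Fin m} (h0 : (x 0).1 = trivial Λ σ (some k))
    (hx : ∀ j < n, (x j).1.IsExtension (x (j + 1)).1) {φ : Fin ((x n).1.N + 1) → Fin (D.N + 1)}
    (hφ : (x n).1.IsPartOf D φ) :
    ∀ j ≤ n, ∃ S, D.G.Explore D.root j S ∧ (x j).1 = D.atStage S := by
  have key (n : ℕ) (hx : ∀ j < n, (x j).1.IsExtension (x (j + 1)).1)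
      (φ : Fin ((x n).1.N + 1) → Fin (D.N + 1)) (hφ : (x n).1.IsPartOf D φ) :
      D.G.Explore D.root n ⟨(x n).1.N, (x n).1.G, φ⟩ := by
    induction n with
    | zero =>
      generalize (x 0).1 = E at h0 φ hφ
      subst h0
      obtain rfl : φ = fun _ => D.root := funext fun v => by
        rw [show v = (trivial Λ σ (some k)).root from Fin.fin_one_eq_zero v, hφ.root]
      exact .start
    | succ n ih =>
      obtain ⟨φ', hφ', he⟩ := (hx n n.lt_succ_self).isPartOf (x n).2.dec.off hφ
      exact he _ _ (ih (fun j hj => hx j (by omega)) φ' hφ')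
  intro j hj
  induction n, hj using Nat.le_induction with
  | base =>
    exact ⟨_, key j hx φ hφ, hφ.eq_atStage (x j).2.root⟩
  | succ n _ ih =>
    obtain ⟨φ', hφ', _⟩ := (hx n n.lt_succ_self).isPartOf (x n).2.dec.off hφ
    exact ih (fun j hj => hx j (by omega)) hφ'

end Trajectory

end Extension

end DecGraph

namespace Params

open TypedDigraph DecGraph

variable {Λ : Type u} {σ m : ℕ} {A : Fin σ → Fin m → Finset Λ} (P : Params A)

theorem decLaw_ne_zero {D : DecGraph Λ σ m} {i : Λ} {t : Option (Fin σ)} {d : Option (Fin m)}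
    (h : P.decLaw D i t d ≠ 0) (hi : i ∈ Set.range D.pos) : D.dec i = d := by
  by_contra hd
  rw [decLaw, if_pos hi, if_neg hd] at h
  exact h rfl

variable [Group Λ] [NeZero σ]

theorem isExtension_of_stepProb_ne_zero {D E : DecGraph Λ σ m} (h : P.stepProb D E ≠ 0) :
    D.IsExtension E := by
  classical
  obtain ⟨v, -, h⟩ := Finset.exists_ne_zero_of_sum_ne_zero h
  obtain ⟨s, -, h⟩ := Finset.exists_ne_zero_of_sum_ne_zero h
  rw [ne_eq, ite_eq_right_iff, Classical.not_imp] at h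
  obtain ⟨hv, h⟩ := h
  refine ⟨v, s, hv, ?_⟩
  split_ifs at h with hs
  · subst hs
    by_cases h' : P.downProb D v E = 0
    · rw [h', mul_zero, zero_add] at h
      obtain ⟨k, -, h⟩ := Finset.exists_ne_zero_of_sum_ne_zero (right_ne_zero_of_mul h)
      obtain ⟨j, -, h⟩ := Finset.exists_ne_zero_of_sum_ne_zero h
      rw [ne_eq, ite_eq_right_iff, Classical.not_imp] at h
      exact .inr ⟨_, _, _, h.1, P.decLaw_ne_zero (right_ne_zero_of_mul h.2)⟩
    · obtain ⟨k, -, h⟩ := Finset.exists_ne_zero_of_sum_ne_zero h'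
      obtain ⟨j, -, h⟩ := Finset.exists_ne_zero_of_sum_ne_zero h
      rw [ne_eq, ite_eq_right_iff, Classical.not_imp] at h
      rcases h.1 with ⟨_, _, h1⟩ | ⟨_, h1⟩
      · exact .inl ⟨_, h1⟩
      · exact .inr ⟨_, _, _, h1, P.decLaw_ne_zero (right_ne_zero_of_mul h.2)⟩
  · unfold upProb at h
    cases hk : D.dec (D.pos v) with
    | none => simp [hk] at h
    | some k =>
      rw [hk, Option.elim_some] at h
      obtain ⟨j, -, h⟩ := Finset.exists_ne_zero_of_sum_ne_zero h
      obtain ⟨d, -, h⟩ := Finset.exists_ne_zero_of_sum_ne_zero h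
      rw [ne_eq, ite_eq_right_iff, Classical.not_imp] at h
      rcases h.1 with ⟨w, _, _, h1⟩ | ⟨_, h1⟩
      · exact .inl ⟨w, h1⟩
      · exact .inr ⟨_, _, _, h1, P.decLaw_ne_zero (right_ne_zero_of_mul h.2)⟩

theorem stageWeight_of_no_edge {D : DecGraph Λ σ m} {H : TypedDigraph (Fin (0 + 1)) σ}
    (hH : ∀ s, H.edge s = ∅) {φ : Fin (0 + 1) → Fin (D.N + 1)} (h0 : φ 0 = D.root) :
    P.stageWeight D ⟨0, H, φ⟩ = P.freshLaw (some 0) (D.dec (D.pos D.root)) := by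
  simp [stageWeight, vertexFactor, hH, h0, vertexType_root]

/-- The trajectory `y` has a possible starting point and makes only possible transitions. -/
structure IsTrajectory (y : ℕ → Option (IncContour A)) : Prop where
  init : P.initLaw (y 0) ≠ 0
  step : ∀ n, P.trans (y n) (y (n + 1)) ≠ 0

variable {P}

namespace IsTrajectory

variable {y : ℕ → Option (IncContour A)}

theorem exists_trivial (hy : P.IsTrajectory y) :
    ∃ x d, y 0 = some x ∧ x.1 = DecGraph.trivial Λ σ d := by
  have h := hy.init
  cases hx : y 0 with
  | none => exact absurd (by rw [hx]; rfl) h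
  | some x =>
    by_contra! hne
    rw [hx] at h
    exact h (P.initLaw_eq_zero fun d => hne x d rfl)

/-- Complete contours are absorbing. -/
theorem absorb (hy : P.IsTrajectory y) {n n' : ℕ} {x : IncContour A} (hn : y n = some x)
    (hx : x.1.Complete) (h : n ≤ n') : y n' = some x := by
  classical
  induction n', h using Nat.le_induction with
  | base => exact hn
  | succ j _ ih =>
    have hj := hy.step j
    rw [ih] at hj
    cases hz : y (j + 1) with
    | none =>
      rw [hz] at hj
      refine absurd ?_ hj
      have (z : IncContour A) : P.transInc x z = if x = z then 1 else 0 := if_pos hx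
      simp [trans, this]
    | some z =>
      rw [hz] at hj
      by_contra hne
      refine hj ((if_pos hx).trans (if_neg ?_))
      rintro rfl
      exact hne rfl

theorem exists_some (hy : P.IsTrajectory y) {n j : ℕ} (hj : j ≤ n) {c : IncContour A}
    (hn : y n = some c) : ∃ x, y j = some x := by
  by_contra! hne
  have hnone (i) (hi : j ≤ i) : y i = none := by
    induction i, hi using Nat.le_induction with
    | base => exact Option.eq_none_iff_forall_ne_some.2 hne
    | succ i _ ih =>
      cases hz : y (i + 1) with
      | none => rfl
      | some z => exact absurd (by rw [ih, hz]; rfl) (hy.step i)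
  rw [hnone n hj] at hn
  cases hn

theorem isExtension (hy : P.IsTrajectory y) {n : ℕ} {x z : IncContour A} (hx : y n = some x)
    (hc : ¬ x.1.Complete) (hz : y (n + 1) = some z) : x.1.IsExtension z.1 := by
  have h := hy.step n
  rw [hx, hz] at h
  have h' : P.transInc x z ≠ 0 := h
  rw [transInc, if_neg hc] at h'
  exact P.isExtension_of_stepProb_ne_zero fun h0 => h' (by rw [h0, ENNReal.ofReal_zero])

/-- Until its first visit to a given contour, a trajectory makes only extensions. -/
theorem exists_first (hy : P.IsTrajectory y) {n : ℕ} {c : IncContour A} (hn : y n = some c) :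
    ∃ (l : ℕ) (x : ℕ → IncContour A), x l = c ∧
      (∀ j ≤ l, y j = some (x j)) ∧ ∀ j < l, (x j).1.IsExtension (x (j + 1)).1 := by
  classical
  have hex : ∃ n, y n = some c := ⟨n, hn⟩
  have hl := Nat.find_spec hex
  have hmin (j) (hj : j < Nat.find hex) := Nat.find_min hex hj
  set l := Nat.find hex
  have hx (j) (hj : j ≤ l) : y j = some ((y j).getD c) := by
    obtain ⟨x, hx⟩ := hy.exists_some hj hl
    rw [hx, Option.getD_some]
  refine ⟨l, fun j => (y j).getD c, Option.some_injective _ ((hx l le_rfl).symm.trans hl), hx,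
    fun j hj =>
    hy.isExtension (hx j hj.le) (fun hj' => hmin j hj ?_) (hx (j + 1) hj)⟩
  rw [← hl, hy.absorb (hx j hj.le) hj' hj.le]
  exact hx j hj.le

end IsTrajectory

end Params

namespace DecGraph.IsContour

open TypedDigraph DecGraph Params

variable {Λ : Type u} [Group Λ] {σ m : ℕ} {A : Fin σ → Fin m → Finset Λ} [NeZero σ] {P : Params A}
  {D : DecGraph Λ σ m}

/-- A trajectory reaches the trivial contour if and only if it starts there. -/
theorem reach_trivial_iff {y : ℕ → Option (IncContour A)} (hy : P.IsTrajectory y) :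
    (∃ n x, y n = some x ∧ x.1.Complete ∧ x.1.Iso (trivial Λ σ none)) ↔
      y 0 = some ⟨trivial Λ σ none, trivial_isIncContour A none⟩ := by
  constructor
  · rintro ⟨n, c, hn, hc, χ, h1, h2, -⟩
    obtain ⟨l, x, rfl, hx, hxs⟩ := hy.exists_first hn
    cases l with
    | zero =>
      obtain ⟨x', d, hx', hd⟩ := hy.exists_trivial
      obtain rfl : x 0 = x' := Option.some_injective _ ((hx 0 le_rfl).symm.trans hx')
      generalize x 0 = c at *
      obtain ⟨c, hc'⟩ := c
      subst hd
      cases d with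
      | none => exact hx'
      | some k =>
        have h := (isPart_map (G := (trivial Λ σ (some k)).G) χ).snk (v := 0)
        rw [h2] at h
        exact absurd (h.1 (Finset.mem_singleton_self _)) (Finset.notMem_empty _)
    | succ l =>
      obtain ⟨s, e, he⟩ := (hxs l l.lt_succ_self).exists_edge
      have : (χ e.1, χ e.2) ∈ ((x (l + 1)).1.G.map χ).edge s := by
        rw [mem_map_edge, χ.symm_apply_apply, χ.symm_apply_apply]
        exact he
      rw [h2] at this
      exact absurd this (Finset.notMem_empty _)
  · intro h
    exact ⟨0, _, h, complete_trivial_none, .refl _⟩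

/-- A trajectory reaches a nontrivial contour if and only if it follows the exploration of this
contour. -/
theorem reach_iff (hD : D.IsContour A) (hT : D.root ∉ D.G.snk) {y : ℕ → Option (IncContour A)}
    (hy : P.IsTrajectory y) {η : Equiv.Perm (Fin (D.N + 1))} (hη : D.IsNatural η) {l : ℕ}
    {S : ℕ → Stage (Fin (D.N + 1)) σ} (hS : ∀ k ≤ l, D.G.Explore D.root k (S k))
    (hl : S l = ⟨D.N, D.G.map η, η.symm⟩) :
    (∃ n x, y n = some x ∧ x.1.Complete ∧ x.1.Iso D) ↔
      ∀ k ≤ l, ∃ x, y k = some x ∧ x.1 = D.atStage (S k) := by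
  have hend : ∀ v s, ¬ (S l).H.LooseEnd v s := by
    rw [hl]
    exact hD.toom.not_looseEnd_map η
  constructor
  · rintro ⟨n, c, hn, hc, hiso⟩
    obtain ⟨l', x, rfl, hx, hxs⟩ := hy.exists_first hn
    obtain ⟨x', d, hx', hd⟩ := hy.exists_trivial
    obtain rfl : x 0 = x' := Option.some_injective _ ((hx 0 (Nat.zero_le _)).symm.trans hx')
    cases d with
    | none =>
      exfalso
      have : x 0 = x l' := Option.some_injective _
        ((hy.absorb hx' (hd ▸ complete_trivial_none) (Nat.zero_le l')).symm.trans (hx l' le_rfl))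
      rw [← this, hd] at hiso
      obtain ⟨χ, h1, h2, -⟩ := hiso
      refine hT ?_
      rw [← h1, ← h2, (isPart_map χ).snk, χ.symm_apply_apply]
      exact Finset.mem_singleton_self _
    | some k =>
      obtain ⟨φ, hφ⟩ := IsPartOf.of_iso (x l').2.dec.off hiso
      have hx1 := explore_of_isExtension x hd hxs hφ
      have hlast : ∃ S', D.G.Explore D.root l' S' ∧ ∀ v s, ¬ S'.H.LooseEnd v s := by
        obtain ⟨S', hS', he⟩ := hx1 l' le_rfl
        unfold Complete at hc
        rw [he] at hc
        exact ⟨S', hS', hc⟩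
      obtain ⟨S', hS', hc'⟩ := hlast
      have hle := hS'.terminal_unique hD.toom hD.root hT hc' (hS l le_rfl)
      intro k hk
      obtain ⟨S'', hS'', he⟩ := hx1 k (hk.trans hle)
      refine ⟨x k, hx k (hk.trans hle), ?_⟩
      rw [he, hS''.unique hD.toom hD.root hT (hS k hk)]
  · intro h
    obtain ⟨x, hx, he⟩ := h l le_rfl
    refine ⟨l, x, hx, ?_, ?_⟩
    · rw [he]
      exact hend
    · rw [he, hl]
      exact hD.iso_atStage hη.1

variable (P) in
/-- The probability that the chain follows the exploration of a contour up to time `n`. -/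
theorem prod_trans (hD : D.IsContour A) (hT : D.root ∉ D.G.snk) {l : ℕ}
    {S : ℕ → Stage (Fin (D.N + 1)) σ} (hS : ∀ k ≤ l, D.G.Explore D.root k (S k))
    {x : ℕ → IncContour A} (hx : ∀ k ≤ l, (x k).1 = D.atStage (S k)) :
    P.initLaw (some (x 0)) * ∏ k ∈ Finset.range l, P.trans (some (x k)) (some (x (k + 1))) =
      ENNReal.ofReal (P.stageWeight D (S l)) := by
  induction l with
  | zero =>
    have h0 := (hS 0 le_rfl).unique hD.toom hD.root hT .start
    have hx0 := hx 0 le_rfl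
    rw [h0, hD.atStage_start hT] at hx0
    rw [P.initLaw_trivial hx0, Finset.range_zero, Finset.prod_empty, mul_one, h0]
    rw [P.stageWeight_of_no_edge (fun _ => rfl) rfl, hD.origin]
  | succ l ih =>
    have h1 := hS l l.le_succ
    have h2 := hS (l + 1) le_rfl
    rw [Finset.prod_range_succ, ← mul_assoc, ih (fun k hk => hS k (by omega))
      fun k hk => hx k (by omega), hD.stageWeight_succ P hT h1 h2,
      ENNReal.ofReal_mul (P.stageWeight_nonneg _)]
    congr 1
    have hc : ¬ (x l).1.Complete := by
      unfold Complete
      rw [hx l l.le_succ]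
      obtain ⟨v, s, hv⟩ := h2.exists_looseEnd h1 hD.toom hD.root hT
      exact fun h => h v s hv.1
    change P.transInc _ _ = _
    rw [transInc, if_neg hc, hx l l.le_succ, hx (l + 1) le_rfl]

/-- The chain reaches a contour with the probability given by the product formula. -/
theorem measure_reach [Countable Λ] (hD : D.IsContour A) {η : Equiv.Perm (Fin (D.N + 1))}
    (hη : D.IsNatural η) {Ω : Type*} [MeasurableSpace Ω] {μ : Measure Ω}
    {X : ℕ → Ω → Option (IncContour A)} (hX : P.IsContourChain μ X) :
    μ {ω | ∃ n x, X n ω = some x ∧ x.1.Complete ∧ x.1.Iso D} =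
      ENNReal.ofReal (P.weight D η) := by
  have hae : ∀ᵐ ω ∂μ, P.IsTrajectory fun n => X n ω :=
    (ae_transition_ne_zero hX.law).mono fun ω h => ⟨h.1, h.2⟩
  rw [← hD.stageWeight_eq_weight P]
  by_cases hT : D.root ∈ D.G.snk
  · obtain rfl := hD.eq_trivial hT
    have hev : {ω | ∃ n x, X n ω = some x ∧ x.1.Complete ∧ x.1.Iso (trivial Λ σ none)} =ᵐ[μ]
        {ω | ∀ k ≤ 0, X k ω = some ⟨trivial Λ σ none, trivial_isIncContour A none⟩} := by
      filter_upwards [hae] with ω hω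
      refine propext ((reach_trivial_iff hω).trans ?_)
      change _ ↔ ∀ k ≤ 0, _
      simp
    rw [measure_congr hev, hX.law 0 fun _ => some ⟨trivial Λ σ none, trivial_isIncContour A none⟩,
      Finset.range_zero, Finset.prod_empty, mul_one, P.initLaw_trivial rfl]
    congr 1
    refine .trans ?_ (P.stageWeight_of_no_edge (fun _ => rfl) (Fin.fin_one_eq_zero _)).symm
    simp [trivial]
  · obtain ⟨l, hl⟩ := hD.explore_of_isNatural hT hη
    have hex (k : ℕ) : ∃ S, D.G.Explore D.root (min k l) S := hl.exists_pred (min_le_right _ _)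
    choose S hS using hex
    have hS' (k) (hk : k ≤ l) : D.G.Explore D.root k (S k) := by
      have := hS k
      rwa [min_eq_left hk] at this
    have hSl := (hS' l le_rfl).unique hD.toom hD.root hT hl
    let x (k : ℕ) : IncContour A := ⟨D.atStage (S k), hD.atStage hT (hS k)⟩
    have hev : {ω | ∃ n x, X n ω = some x ∧ x.1.Complete ∧ x.1.Iso D} =ᵐ[μ]
        {ω | ∀ k ≤ l, X k ω = some (x k)} := by
      filter_upwards [hae] with ω hω
      refine propext ((hD.reach_iff hT hω hη hS' hSl).trans ?_)
      change _ ↔ ∀ k ≤ l, X k ω = some (x k)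
      refine forall₂_congr fun k _ => ⟨?_, fun h => ⟨_, h, rfl⟩⟩
      rintro ⟨z, hz, he⟩
      rw [hz, show z = x k from Subtype.ext he]
    rw [measure_congr hev, hX.law l fun k => some (x k), hD.prod_trans P hT hS' fun k _ => rfl, hSl]

end DecGraph.IsContour

namespace Params.IsContourChain

open DecGraph

variable {Λ : Type u} [Group Λ] [Countable Λ] {σ m : ℕ} {A : Fin σ → Fin m → Finset Λ} [NeZero σ]
  {P : Params A} {Ω : Type*} [MeasurableSpace Ω] {μ : Measure Ω}
  {X : ℕ → Ω → Option (IncContour A)}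

/-- The law of the final state of the chain, up to isomorphism. -/
theorem exists_law (hX : P.IsContourChain μ X) [IsProbabilityMeasure μ] :
    ∃ ν : Measure (ContourClass A), ν Set.univ ≤ 1 ∧ ∀ D : Contour A,
      ν {Quotient.mk _ D} = μ {ω | ∃ n x, X n ω = some x ∧ x.1.Complete ∧ x.1.Iso D.1} := by
  have hae : ∀ᵐ ω ∂μ, P.IsTrajectory fun n => X n ω :=
    (ae_transition_ne_zero hX.law).mono fun ω h => ⟨h.1, h.2⟩
  let R (c : ContourClass A) : Set Ω :=
    {ω | ∃ n x, X n ω = some x ∧ x.1.Complete ∧ x.1.Iso c.out.1}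
  have hR (c) : MeasurableSet (R c) := by
    have : R c = ⋃ n, X n ⁻¹' {y | ∃ x, y = some x ∧ x.1.Complete ∧ x.1.Iso c.out.1} := by
      ext ω
      simp [R]
    rw [this]
    exact MeasurableSet.iUnion fun n => hX.meas n _
  refine ⟨Measure.sum fun c => μ (R c) • Measure.dirac c, ?_, fun D => ?_⟩
  · rw [Measure.sum_apply _ .univ]
    simp only [Measure.smul_apply, measure_univ, smul_eq_mul, mul_one]
    refine (tsum_meas_le_meas_iUnion_of_disjoint₀ μ (fun c => (hR c).nullMeasurableSet)
      fun c c' hne => ?_).trans prob_le_one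
    -- A trajectory stays in the complete contour that it reaches, so it reaches only one class.
    refine measure_mono_null (fun ω hω => ?_) hae
    rintro hy
    obtain ⟨⟨n, x, hn, hc, hx⟩, n', x', hn', hc', hx'⟩ := hω
    have h1 := hy.absorb hn hc (le_max_left n n')
    have h2 := hy.absorb hn' hc' (le_max_right n n')
    obtain rfl : x = x' := Option.some_injective _ (h1.symm.trans h2)
    refine hne ?_
    rw [← c.out_eq, ← c'.out_eq]
    exact Quotient.sound (hx.symm.trans hx')
  · have hs : MeasurableSet ({Quotient.mk _ D} : Set (ContourClass A)) := trivial
    rw [Measure.sum_apply _ hs, tsum_eq_single (Quotient.mk _ D)]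
    · rw [Measure.smul_apply, Measure.dirac_apply' _ hs]
      simp only [Set.mem_singleton_iff, Set.indicator_of_mem, Pi.one_apply, smul_eq_mul, mul_one]
      have hD : (Quotient.out (Quotient.mk _ D : ContourClass A)).1.Iso D.1 := Quotient.mk_out D
      congr 1
      ext ω
      exact exists₂_congr fun n x => and_congr_right fun _ => and_congr_right fun _ =>
        ⟨fun h => h.trans hD, fun h => h.trans hD.symm⟩
    · intro c hc
      rw [Measure.smul_apply, Measure.dirac_apply' _ hs,
        Set.indicator_of_notMem (by simpa using hc),
        smul_zero]

end Params.IsContourChain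

end Toom

theorem theoremT {Λ : Type u} [Group Λ] [Countable Λ]
    (h : Λ → ℤ) (hh : ∀ i j, h (i * j) = h i + h j)
    {σ m : ℕ} [NeZero σ] (hσ : 2 ≤ σ) (A : Fin σ → Fin m → Finset Λ)
    (hA : ∀ s k, ∀ j ∈ A s k, h j = 1) (P : Toom.Params A) :
    -- the natural order, `n_∘` and `n_•`, and the final state of the chain are well defined
    (∀ D : Toom.Contour A, ∃! η, D.1.IsNatural η) ∧
    (∀ (D : Toom.Contour A) (s : Fin σ),
      (D.1.G.edgeSrc D.1.root s).card = D.1.nSrc ∧ (D.1.G.edgeInt D.1.root s).card = D.1.nInt) ∧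
    (∀ x : Toom.IncContour A, x.1.Complete → x.1.IsContour A) ∧
    -- the product formula defines a subprobability measure on contours up to isomorphism
    ∃ ν : Measure (Toom.ContourClass A),
      ν Set.univ ≤ 1 ∧
      (∀ (D : Toom.Contour A) (η : Equiv.Perm (Fin (D.1.N + 1))), D.1.IsNatural η →
        ν {Quotient.mk _ D} = ENNReal.ofReal (P.weight D.1 η)) ∧
      -- it is the law of the final state of the contour extending Markov chain
      ∃ (Ω : Type u) (_ : MeasurableSpace Ω) (μ : Measure Ω)
        (X : ℕ → Ω → Option (Toom.IncContour A)),
        IsProbabilityMeasure μ ∧ P.IsContourChain μ X ∧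
        ∀ D : Toom.Contour A,
          μ {ω | ∃ n x, X n ω = some x ∧ x.1.Complete ∧ x.1.Iso D.1} = ν {Quotient.mk _ D} := by
  obtain ⟨Ω, _, μ, X, hμ, hmeas, hlaw⟩ :=
    Toom.exists_markov_chain P.initLaw P.tsum_initLaw P.trans P.tsum_trans
  have hX : P.IsContourChain μ X := ⟨hmeas, hlaw⟩
  obtain ⟨ν, hν, hνD⟩ := hX.exists_law
  have hsrc (D : Toom.Contour A) (s : Fin σ) : (D.1.G.edgeSrc D.1.root s).card = D.1.nSrc :=
    (D.2.card_edgeSrc s).trans (D.2.card_edgeSrc ⊤).symm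
  refine ⟨fun D => D.2.existsUnique_isNatural hσ, fun D s => ⟨hsrc D s, ?_⟩,
    fun x hx => x.2.isContour hσ hx, ν, hν,
    fun D η hη => (hνD D).trans (D.2.measure_reach hη hX), Ω, _, μ, X, hμ, hX,
    fun D => (hνD D).symm⟩
  have h1 := D.2.card_edgeSrc_add_card_edgeInt s
  have h2 := D.2.card_edgeSrc_add_card_edgeInt ⊤
  have h3 := D.2.card_edge h hh hA s
  have h4 := D.2.card_edge h hh hA ⊤
  have h5 := hsrc D s
  unfold Toom.DecGraph.nSrc at h5
  unfold Toom.DecGraph.nInt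
  omega
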